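/- Let $F$ be a number field that contains a CM subfield (so $F$ is totally complex, of degree $n=2r_2$), and let $K$ be its maximal CM subfield, with maximal totally real subfield $K^+$. Let $\mathfrak m$ be a nonzero ideal of $\mathbb Z_F$ and $U(\mathfrak m)$ the group of idèles that are $1$ at the archimedean places, units at all finite primes, and congruent to $1$ modulo $\mathfrak m$. A Hecke character is a continuous character $\chi:\mathbb A_F^\times/F^\times\to\{z\in\mathbb C:|z|=1\}$; it has modulus $\mathfrak m$ if it is trivial on $U(\mathfrak m)$. At each archimedean place $\sigma$ (for which one complex embedding is chosen) it has local parameters $(k_\sigma,\varphi_\sigma)\in\mathbb Z\times\mathbb R$, given by $\chi_\sigma(z)=(z/|z|)^{k_\sigma}|z|^{2i\varphi_\sigma}$, and it is almost-algebraic if $\varphi_\sigma=0$ for all $\sigma$. Choose a finite set $S$ of primes generating the class group, uniformizers $\pi_{\mathfrak p}$, and an isomorphism $\log_{\mathfrak m}:(\mathbb Z_F/\mathfrak m)^\times\cong\mathbb Z^{r}/\Lambda_{\mathfrak m}$. Put $\ell=|S|+r$, and let $G=\mathbb R^{\ell+n}=\mathbb R^S\times\mathbb R^r\times\mathbb R^{r_2}\times\mathbb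 R^{r_2}$ with its standard inner product. For an $S$-unit $\alpha\in F^\times$ let $$\mathcal L_S(\alpha)=\Bigl((v_{\mathfrak p}(\alpha))_{\mathfrak p\in S},\ \log_{\mathfrak m}(u \bmod \mathfrak m),\ \bigl(\tfrac{1}{\pi}\log|\sigma(\alpha)|\bigr)_\sigma,\ \bigl(\tfrac{\arg\sigma(\alpha)}{2\pi}\bigr)_\sigma\Bigr)\in(\mathbb Z^\ell\times\mathbb R^n)/(\Lambda_{\mathfrak m}+\mathbb Z^{r_2}),$$ where $u_{\mathfrak p}=\alpha\pi_{\mathfrak p}^{-v_{\mathfrak p}(\alpha)}$ for every prime $\mathfrak p$, $\Lambda_{\mathfrak m}\subset\mathbb R^r$, and $\mathbb Z^{r_2}$ lies in the last factor. For $\chi$ of modulus $\mathfrak m$ let $$\mathcal L^*(\chi)=\Bigl(\bigl(\tfrac{\arg\chi(\pi_{\mathfrak p})}{2\pi}\bigr)_{\mathfrak p\in S},\ \bigl(\tfrac{\arg\chi(\log_{\mathfrak m}^{-1}(g_i))}{2\pi}\bigr)_{i\le r},\ (\varphi_\sigma)_\sigma,\ (k_\sigma)_\sigma\Bigr)\in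 G/\mathbb Z^\ell,$$ where $\chi(\pi_{\mathfrak p})$ is the value at the idèle $\pi_{\mathfrak p}$ supported at $\mathfrak p$, $g_i$ is the class of the $i$-th standard basis vector of $\mathbb Z^r$, and $\chi(g)$ for $g\in(\mathbb Z_F/\mathfrak m)^\times$ is the value of $\chi$ at any idèle of $\prod_{\mathfrak p}\mathbb Z_{\mathfrak p}^\times$ reducing to $g$. Let $v_0\in G$ have all coordinates in the third factor equal to $2$ and all others $0$. Let $\Lambda_0\subset G$ be the group $\mathcal L_S(\mathbb Z_{F,S}^\times)+\Lambda_{\mathfrak m}+\mathbb Z^{r_2}+\mathbb Z v_0$, and let $\Lambda_0^\perp=\{x\in G: x\cdot y\in\mathbb Z\ \forall y\in\Lambda_0\}$. Let $H^\perp\subset G$ be the subspace of vectors with all $\varphi_\sigma=0$ and $(k_\sigma)_\sigma$ factoring through $K$ (extending $k$ to all embeddings by $k_{\bar\sigma}=-k_\sigma$, the value $k_\sigma$ depends only on $\sigma|_K$), and let $H$ be its orthogonal in $G$. Let $\mathrm{Nm}_{F/K}:\mathbb Z^{r_2}\to\mathbb Z^{r_2(K)}$ be $(a_\sigma)_\sigma\mapsto(\sum_{\sigma|_K=\tau}a_\sigma)_\tau$,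 again with $a_{\bar\sigma}=-a_\sigma$. Then: 1. A Hecke character $\chi$ of modulus $\mathfrak m$ is almost-algebraic if and only if $\mathcal L^*(\chi)\in(\Lambda_0^\perp\cap H^\perp)/\mathbb Z^\ell$, and $\mathcal L^*$ is an isomorphism from the group of almost-algebraic characters of modulus $\mathfrak m$ onto $(\Lambda_0^\perp\cap H^\perp)/\mathbb Z^\ell$. 2. $\Lambda_0\cap H$ has full rank in $H$. More precisely, for every unit $u\in\mathbb Z_F^\times$ with $u\equiv1\bmod\mathfrak m$ such that $\mathrm{Nm}_{F/K}(u)$ is a totally positive element of $K^+$, the class $\mathcal L_S(u)$ has a representative in $H$, unique modulo $\ker(\mathrm{Nm}_{F/K}:\mathbb Z^{r_2}\to\mathbb Z^{r_2(K)})$. The group $U$ generated by $v_0$, this kernel, and these representatives is contained in $H\cap\Lambda_0$ and has full rank in $H$. -/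

import Mathlib

open NumberField IsDedekindDomain

noncomputable section

namespace HeckeAlg

section Ideles

variable (F : Type*) [Field F] [NumberField F]

/-- The idèle group `𝔸_F^×`, with the unit-group topology. -/
abbrev Idele : Type _ := (AdeleRing (𝓞 F) F)ˣ

variable {F}

/-- The component of an idèle at a finite prime. -/
def finComp (x : Idele F) (p : HeightOneSpectrum (𝓞 F)) : p.adicCompletion F :=
  (x : AdeleRing (𝓞 F) F).2 p

/-- The component of an idèle at an archimedean place `w`, seen in `ℂ` through the
embedding `w.embedding` chosen at `w`. -/
def infComp (x : Idele F) (w : InfinitePlace F) : ℂ :=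
  InfinitePlace.Completion.extensionEmbedding w ((x : AdeleRing (𝓞 F) F).1 w)

/-- The principal idèle attached to `α ∈ F^×`. -/
def principal : Fˣ →* Idele F :=
  Units.map (algebraMap F (AdeleRing (𝓞 F) F)).toMonoidHom

/-- The restricted-product element with component `x` at `p` and `1` elsewhere. -/
def finAdeleSingle (p : HeightOneSpectrum (𝓞 F)) (x : p.adicCompletion F) :
    FiniteAdeleRing (𝓞 F) F :=
  letI := Classical.decEq (HeightOneSpectrum (𝓞 F))
  RestrictedProduct.mulSingle (fun v : HeightOneSpectrum (𝓞 F) => v.adicCompletionIntegers F) p x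

theorem finAdeleSingle_mul (p : HeightOneSpectrum (𝓞 F)) (x y : p.adicCompletion F)
    (h : x * y = 1) : finAdeleSingle p x * finAdeleSingle p y = 1 := by
  let _ := Classical.decEq (HeightOneSpectrum (𝓞 F))
  have h1 := RestrictedProduct.mulSingle_mul
    (fun v : HeightOneSpectrum (𝓞 F) => v.adicCompletionIntegers F) p x y
  rw [h, RestrictedProduct.mulSingle_one] at h1
  exact h1.symm

/-- The infinite adèle with component `x` at `w` and `1` elsewhere. -/
def infAdeleSingle (w : InfinitePlace F) (x : w.Completion) : InfiniteAdeleRing F :=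
  letI := Classical.decEq (InfinitePlace F)
  Pi.mulSingle (M := fun v : InfinitePlace F => v.Completion) w x

theorem infAdeleSingle_mul (w : InfinitePlace F) (x y : w.Completion)
    (h : x * y = 1) : infAdeleSingle w x * infAdeleSingle w y = 1 := by
  let _ := Classical.decEq (InfinitePlace F)
  have h1 := Pi.mulSingle_mul (f := fun v : InfinitePlace F => v.Completion) w x y
  rw [h, Pi.mulSingle_one] at h1
  exact h1.symm

/-- The idèle with component `x` at the finite prime `p` and `1` elsewhere. -/
def finSingle (p : HeightOneSpectrum (𝓞 F)) (x : (p.adicCompletion F)ˣ) : Idele F where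
  val := ((1 : InfiniteAdeleRing F), finAdeleSingle p x)
  inv := ((1 : InfiniteAdeleRing F), finAdeleSingle p (x⁻¹ : (p.adicCompletion F)ˣ))
  val_inv := Prod.ext (one_mul _) (finAdeleSingle_mul p _ _ x.mul_inv)
  inv_val := Prod.ext (one_mul _) (finAdeleSingle_mul p _ _ x.inv_mul)

/-- The idèle with component `x` at the archimedean place `w` and `1` elsewhere. -/
def infSingle (w : InfinitePlace F) (x : (w.Completion)ˣ) : Idele F where
  val := (infAdeleSingle w x, (1 : FiniteAdeleRing (𝓞 F) F))
  inv := (infAdeleSingle w (x⁻¹ : (w.Completion)ˣ), (1 : FiniteAdeleRing (𝓞 F) F))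
  val_inv := Prod.ext (infAdeleSingle_mul w _ _ x.mul_inv) (one_mul _)
  inv_val := Prod.ext (infAdeleSingle_mul w _ _ x.inv_mul) (one_mul _)

end Ideles

section Characters

variable {F : Type*} [Field F] [NumberField F]

/-- The exponent `v_p(m)` of the prime `p` in the ideal `m`. -/
def ordAt (p : HeightOneSpectrum (𝓞 F)) (m : Ideal (𝓞 F)) : ℕ :=
  (Associates.mk p.asIdeal).count (Associates.mk m).factors

/-- `u ≡ b mod m`: for every prime `p`, the element `u_p` is congruent modulo `p ^ v_p(m)` to
a lift in `𝓞 F` of the residue class `b`. -/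
def IsResidue (m : Ideal (𝓞 F)) (u : (p : HeightOneSpectrum (𝓞 F)) → p.adicCompletion F)
    (b : (𝓞 F ⧸ m)ˣ) : Prop :=
  ∃ a : 𝓞 F, Ideal.Quotient.mk m a = b ∧
    ∀ p : HeightOneSpectrum (𝓞 F),
      Valued.v (u p - ((a : F) : p.adicCompletion F)) ≤ WithZero.exp (-(ordAt p m : ℤ))

/-- The idèle `x` is a unit at every finite prime and is `1` at every archimedean place. -/
def IsFiniteUnit (x : Idele F) : Prop :=
  (∀ p, Valued.v (finComp x p) = 1) ∧ ∀ w, infComp x w = 1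

/-- The idèle `x` belongs to `U(m)`, for a totally complex field `F`. -/
def IsOneMod (m : Ideal (𝓞 F)) (x : Idele F) : Prop :=
  IsFiniteUnit x ∧ IsResidue m (finComp x) 1

variable (F) in
/-- Hecke characters: continuous characters of the idèle group with values of absolute value
one and trivial on `F^×`. -/
def heckeChars : Subgroup (Idele F →ₜ* Circle) where
  carrier := {χ | ∀ α : Fˣ, χ (principal α) = 1}
  mul_mem' {χ χ'} h h' α := by
    change χ _ * χ' _ = _
    rw [h α, h' α, one_mul]
  one_mem' _ := rfl
  inv_mem' {χ} h α := by
    change (χ _)⁻¹ = _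
    rw [h α, inv_one]

/-- The group of Hecke characters of modulus `m`, for a totally complex field `F`. -/
def heckeCharsMod (m : Ideal (𝓞 F)) : Subgroup (Idele F →ₜ* Circle) where
  carrier := {χ | χ ∈ heckeChars F ∧ ∀ x, IsOneMod m x → χ x = 1}
  mul_mem' {χ χ'} h h' := ⟨mul_mem h.1 h'.1, fun x hx => by
    change χ _ * χ' _ = _
    rw [h.2 x hx, h'.2 x hx, one_mul]⟩
  one_mem' := ⟨one_mem _, fun _ _ => rfl⟩
  inv_mem' {χ} h := ⟨inv_mem h.1, fun x hx => by
    change (χ _)⁻¹ = _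
    rw [h.2 x hx, inv_one]⟩

/-- `χ` has local parameters `(k, φ)` at the archimedean place `w`:
`χ_w(z) = (z / |z|) ^ k * |z| ^ (i n_w φ)`, with `n_w = 1` or `2` the local degree. -/
def HasLocalParam (χ : Idele F →ₜ* Circle) (w : InfinitePlace F) (k : ℤ) (φ : ℝ) : Prop :=
  ∀ x : (w.Completion)ˣ,
    (χ (infSingle w x) : ℂ) =
      (InfinitePlace.Completion.extensionEmbedding w x /
          (‖InfinitePlace.Completion.extensionEmbedding w (x : w.Completion)‖ : ℂ)) ^ k *
        (‖InfinitePlace.Completion.extensionEmbedding w (x : w.Completion)‖ : ℂ) ^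
          (((w.mult : ℝ) * φ : ℝ) * Complex.I)

/-- The almost-algebraic characters of modulus `m`: those with `φ_w = 0` at all
archimedean places. -/
def almostAlgebraic (m : Ideal (𝓞 F)) : Subgroup (Idele F →ₜ* Circle) where
  carrier := {χ | χ ∈ heckeCharsMod m ∧ ∀ w, ∃ k : ℤ, HasLocalParam χ w k 0}
  mul_mem' := by
    rintro χ χ' ⟨h, hk⟩ ⟨h', hk'⟩
    refine ⟨mul_mem h h', fun w => ?_⟩
    obtain ⟨k, hk⟩ := hk w
    obtain ⟨k', hk'⟩ := hk' w
    refine ⟨k + k', fun x => ?_⟩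
    change ((χ _ * χ' _ : Circle) : ℂ) = _
    have hx : (InfinitePlace.Completion.extensionEmbedding w (x : w.Completion)) ≠ 0 := by simp
    rw [Circle.coe_mul, hk x, hk' x, zpow_add₀ (div_ne_zero hx (by simp))]
    simp
  one_mem' := ⟨one_mem _, fun w => ⟨0, fun x => by simp⟩⟩
  inv_mem' := by
    rintro χ ⟨h, hk⟩
    refine ⟨inv_mem h, fun w => ?_⟩
    obtain ⟨k, hk⟩ := hk w
    refine ⟨-k, fun x => ?_⟩
    change (((χ _)⁻¹ : Circle) : ℂ) = _
    rw [Circle.coe_inv, hk x]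
    simp

end Characters

/-! ### The logarithm maps -/

/-- The choices on which the logarithm maps depend: a modulus (for a totally complex field, just
a nonzero integral ideal `m`), a finite set `S` of primes generating the class group, a
uniformizer at every prime, and an isomorphism `log_m : (𝓞 F / m)^× ≃ ℤ^r / Λ_m`. -/
structure LogSetup (F : Type*) [Field F] [NumberField F] where
  m : Ideal (𝓞 F)
  m_ne_bot : m ≠ ⊥
  S : Finset (HeightOneSpectrum (𝓞 F))
  generates : Subgroup.closure
    {c : ClassGroup (𝓞 F) | ∃ p ∈ S, c = ClassGroup.mk0
      ⟨p.asIdeal, mem_nonZeroDivisors_iff_ne_zero.2 p.ne_bot⟩} = ⊤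
  π : (p : HeightOneSpectrum (𝓞 F)) → (p.adicCompletion F)ˣ
  uniformizer : ∀ p, Valued.v (π p : p.adicCompletion F) = WithZero.exp (-1 : ℤ)
  r : ℕ
  Λm : AddSubgroup (Fin r → ℤ)
  logm : Additive (𝓞 F ⧸ m)ˣ ≃+ (Fin r → ℤ) ⧸ Λm

namespace LogSetup

variable {F : Type*} [Field F] [NumberField F] (D : LogSetup F)

/-- The coordinates of `ℝ^(ℓ + n)`, in this order: one for each prime in `S`, `r` for the
residue part, and for each (complex) place a modulus coordinate (`φ_σ` on the character side) and
an argument coordinate (`k_σ` on the character side). -/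
abbrev Idx : Type _ := (D.S ⊕ Fin D.r) ⊕ (InfinitePlace F ⊕ InfinitePlace F)

/-- The space `G = ℝ^(ℓ + n)`; its standard inner product is `⬝ᵥ`. -/
abbrev G : Type _ := D.Idx → ℝ

variable {D}

/-- The vector with given prime, residue, modulus and argument coordinates. -/
def vec (a : D.S → ℝ) (b : Fin D.r → ℝ) (c d : InfinitePlace F → ℝ) : D.G :=
  Sum.elim (Sum.elim a b) (Sum.elim c d)

/-- The coordinate of `v` at a prime of `S`. -/
def atPrime (v : D.G) (p : D.S) : ℝ := v (Sum.inl (Sum.inl p))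

/-- The `i`-th residue coordinate of `v`. -/
def atRes (v : D.G) (i : Fin D.r) : ℝ := v (Sum.inl (Sum.inr i))

/-- The modulus coordinate of `v` at a place. -/
def atAbs (v : D.G) (w : InfinitePlace F) : ℝ := v (Sum.inr (Sum.inl w))

/-- The argument coordinate of `v` at a place. -/
def atArg (v : D.G) (w : InfinitePlace F) : ℝ := v (Sum.inr (Sum.inr w))

variable (D)

/-- `v ∈ ℤ^ℓ × ℝ^n` represents `𝓛_S(x) ∈ (ℤ^ℓ × ℝ^n) / (Λ_m + ℤ^{r₂})`, where `x ∈ U_S`: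
`e p` is the valuation of `x` at `p` and `b` the class modulo `m` of `(x_p π_p ^ (-e p))_p`. -/
def IsLog (x : Idele F) (v : D.G) : Prop :=
  ∃ (e : HeightOneSpectrum (𝓞 F) → ℤ) (b : (𝓞 F ⧸ D.m)ˣ) (t : Fin D.r → ℤ),
    (∀ p, Valued.v (finComp x p) = WithZero.exp (-(e p))) ∧
    (∀ p, p ∉ D.S → e p = 0) ∧
    IsResidue D.m
      (fun p => finComp x p * ((D.π p ^ (-(e p)) : (p.adicCompletion F)ˣ) : p.adicCompletion F)) b ∧
    D.logm (Additive.ofMul b) = QuotientAddGroup.mk t ∧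
    (∀ p : D.S, atPrime v p = e p) ∧
    (∀ i, atRes v i = t i) ∧
    (∀ w, atAbs v w = (w.mult : ℝ) / (2 * Real.pi) * Real.log ‖infComp x w‖) ∧
    (∀ w, infComp x w / (‖infComp x w‖ : ℂ) = Circle.exp (2 * Real.pi * atArg v w))

/-- `v` represents the dual logarithm `𝓛^*(χ) ∈ (ℝ / ℤ)^ℓ × ℝ^n` of a character `χ` of modulus `m`.
In the second clause, `y` is any finite unit idèle reducing to the class in `(𝓞 F / m)^×` whose
`log_m` is the class of the `i`-th standard basis vector of `ℤ^r`. -/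
def IsDualLog (χ : Idele F →ₜ* Circle) (v : D.G) : Prop :=
  (∀ p : D.S, χ (finSingle p.1 (D.π p.1)) = Circle.exp (2 * Real.pi * atPrime v p)) ∧
  (∀ (i : Fin D.r) (y : Idele F), IsFiniteUnit y →
    IsResidue D.m (finComp y)
      (D.logm.symm (QuotientAddGroup.mk (Pi.single i (1 : ℤ)))).toMul →
    χ y = Circle.exp (2 * Real.pi * atRes v i)) ∧
  (∀ w, ∃ k : ℤ, atArg v w = k ∧ HasLocalParam χ w k (atAbs v w))

/-- `v₀`: local degree `n_w` at the modulus coordinates, `0` elsewhere. -/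
def v0 : D.G := vec 0 0 (fun w => (w.mult : ℝ)) 0

/-- The set `𝓛_S(ℤ_{F,S}^×)`: all representatives of logarithms of `S`-units. It is a union of
cosets of `Λ_m + ℤ^{r₂}`. -/
def sUnitLogs : Set D.G :=
  {v | ∃ α ∈ (D.S : Set (HeightOneSpectrum (𝓞 F))).unit F, D.IsLog (principal α) v}

/-- `Λ_m`, embedded in `G`. -/
def embΛm : Set D.G :=
  {v | ∃ t ∈ D.Λm, v = vec 0 (fun i => (t i : ℝ)) 0 0}

/-- `ℤ^{r₂}`, embedded in the argument coordinates of `G`. -/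
def embArgInt : Set D.G :=
  {v | ∃ a : InfinitePlace F → ℤ, v = vec 0 0 0 (fun w => (a w : ℝ))}

/-- `Λ₀ = 𝓛_S(ℤ_{F,S}^×) + Λ_m + ℤ^{r₂} + ℤ v₀`. -/
def Λ₀ : AddSubgroup D.G :=
  AddSubgroup.closure (D.sUnitLogs ∪ D.embΛm ∪ D.embArgInt ∪ {D.v0})

/-- `Λ₀^⊥`, the Pontryagin orthogonal of `Λ₀` in `G`. -/
def dualΛ₀ : AddSubgroup D.G where
  carrier := {x | ∀ y ∈ D.Λ₀, ∃ z : ℤ, x ⬝ᵥ y = z}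
  add_mem' := by
    intro a b ha hb y hy
    obtain ⟨z, hz⟩ := ha y hy
    obtain ⟨z', hz'⟩ := hb y hy
    exact ⟨z + z', by rw [add_dotProduct, hz, hz']; push_cast; rfl⟩
  zero_mem' := fun y _ => ⟨0, by simp⟩
  neg_mem' := by
    intro a ha y hy
    obtain ⟨z, hz⟩ := ha y hy
    exact ⟨-z, by rw [neg_dotProduct, hz]; push_cast; rfl⟩

/-- `ℤ^ℓ`, embedded in the prime and residue coordinates of `G`. -/
def intℓ : AddSubgroup D.G where
  carrier := {x | (∀ j, ∃ z : ℤ, x (Sum.inl j) = z) ∧ ∀ j, x (Sum.inr j) = 0}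
  add_mem' := by
    rintro a b ⟨ha, ha'⟩ ⟨hb, hb'⟩
    refine ⟨fun j => ?_, fun j => by simp [ha', hb']⟩
    obtain ⟨z, hz⟩ := ha j
    obtain ⟨z', hz'⟩ := hb j
    exact ⟨z + z', by simp [hz, hz']⟩
  zero_mem' := ⟨fun j => ⟨0, by simp⟩, fun j => rfl⟩
  neg_mem' := by
    rintro a ⟨ha, ha'⟩
    refine ⟨fun j => ?_, fun j => by simp [ha']⟩
    obtain ⟨z, hz⟩ := ha j
    exact ⟨-z, by simp [hz]⟩

end LogSetup

/-! ### The subfield `K` and the space `H` -/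

section CM

variable {F : Type*} [Field F]

open Classical in
/-- A family indexed by the places of a totally complex field, extended to all embeddings `σ` by
`a_σ = a_w` if `σ` is the embedding chosen at its place `w`, and by `a_σ = - a_w` if it is the
conjugate embedding. -/
def extendOdd (a : InfinitePlace F → ℝ) (σ : F →+* ℂ) : ℝ :=
  if σ = (InfinitePlace.mk σ).embedding then a (InfinitePlace.mk σ)
  else -a (InfinitePlace.mk σ)

theorem extendOdd_add (a b : InfinitePlace F → ℝ) (σ : F →+* ℂ) :
    extendOdd (a + b) σ = extendOdd a σ + extendOdd b σ := by
  unfold extendOdd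
  split_ifs <;> simp [add_comm]

theorem extendOdd_smul (c : ℝ) (a : InfinitePlace F → ℝ) (σ : F →+* ℂ) :
    extendOdd (c • a) σ = c * extendOdd a σ := by
  unfold extendOdd
  split_ifs <;> simp

variable [NumberField F] (K : IntermediateField ℚ F)

/-- The family `(k_σ)` factors through `K`: `k_σ` depends only on the restriction of the
embedding `σ` to `K`. -/
def FactorsThrough (k : InfinitePlace F → ℝ) : Prop :=
  ∃ f : (K →+* ℂ) → ℝ, ∀ σ : F →+* ℂ, extendOdd k σ = f (σ.comp (algebraMap K F))

open Classical in
/-- The norm `Nm_{F/K} : ℝ^{r₂(F)} → ℝ^{r₂(K)}` on argument coordinates: at a place `τ` of `K`,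
the sum of the `a_σ` over the embeddings `σ` of `F` extending the embedding chosen at `τ`. -/
def normArg (a : InfinitePlace F → ℝ) (τ : InfinitePlace K) : ℝ :=
  ∑ σ : F →+* ℂ with σ.comp (algebraMap K F) = τ.embedding, extendOdd a σ

variable (D : LogSetup F)

/-- `H^⊥`: all `φ_σ` vanish and the `k_σ` factor through `K`. -/
def Hperp : Submodule ℝ D.G where
  carrier := {x | (∀ w, LogSetup.atAbs x w = 0) ∧ FactorsThrough K (LogSetup.atArg x)}
  add_mem' := by
    rintro x y ⟨hx, f, hf⟩ ⟨hy, g, hg⟩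
    refine ⟨fun w => ?_, f + g, fun σ => ?_⟩
    · change LogSetup.atAbs x w + LogSetup.atAbs y w = 0
      rw [hx, hy, add_zero]
    · change extendOdd (LogSetup.atArg x + LogSetup.atArg y) σ = _
      rw [extendOdd_add, hf, hg]
      rfl
  zero_mem' := ⟨fun w => rfl, 0, fun σ => by
    change extendOdd (fun _ => (0 : ℝ)) σ = 0
    simp [extendOdd]⟩
  smul_mem' := by
    rintro c x ⟨hx, f, hf⟩
    refine ⟨fun w => ?_, c • f, fun σ => ?_⟩
    · change c * LogSetup.atAbs x w = 0
      rw [hx, mul_zero]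
    · change extendOdd (c • LogSetup.atArg x) σ = _
      rw [extendOdd_smul, hf]
      rfl

/-- `H`, the orthogonal of `H^⊥` in `G`. -/
def H : Submodule ℝ D.G where
  carrier := {x | ∀ y ∈ Hperp K D, x ⬝ᵥ y = 0}
  add_mem' := by
    intro a b ha hb y hy
    rw [add_dotProduct, ha y hy, hb y hy, add_zero]
  zero_mem' := fun y _ => zero_dotProduct y
  smul_mem' := by
    intro c a ha y hy
    rw [smul_dotProduct, ha y hy, smul_zero]

/-- `ker (Nm_{F/K} : ℤ^{r₂(F)} → ℤ^{r₂(K)})`, embedded in the argument coordinates of `G`. -/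
def kerNorm : Set D.G :=
  {v | ∃ a : InfinitePlace F → ℤ, (∀ τ, normArg K (fun w => (a w : ℝ)) τ = 0) ∧
    v = LogSetup.vec 0 0 0 (fun w => (a w : ℝ))}

/-- The units `u ≡ 1 mod m` of `F` whose norm to `K` is a totally positive element of `K⁺`. -/
def IsGoodUnit (u : (𝓞 F)ˣ) : Prop :=
  Ideal.Quotient.mk D.m (u : 𝓞 F) = 1 ∧
  Algebra.norm K ((u : 𝓞 F) : F) ∈ maximalRealSubfield K ∧
  ∀ τ : K →+* ℂ, 0 < (τ (Algebra.norm K ((u : 𝓞 F) : F))).re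

/-- The principal idèle of a unit of `𝓞 F`. -/
def unitIdele (u : (𝓞 F)ˣ) : Idele F :=
  principal (Units.map (algebraMap (𝓞 F) F).toMonoidHom u)

/-- The representatives in `H` of the classes `𝓛_S(u)`, for the units `u` above. -/
def unitLogs : Set D.G :=
  {v | v ∈ H K D ∧ ∃ u : (𝓞 F)ˣ, IsGoodUnit K D u ∧ D.IsLog (unitIdele u) v}

/-- The group `U`. -/
def U : AddSubgroup D.G :=
  AddSubgroup.closure ({D.v0} ∪ kerNorm K D ∪ unitLogs K D)

end CM

/-- The subgroup `A` of `V` is contained in the subspace `W` and has full rank in it. -/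
def HasFullRank {V : Type*} [AddCommGroup V] [Module ℝ V] (A : AddSubgroup V)
    (W : Submodule ℝ V) : Prop :=
  A ≤ W.toAddSubgroup ∧ Submodule.span ℝ (A : Set V) = W ∧
    Module.finrank ℤ A = Module.finrank ℝ W

end HeckeAlg

end

/-! The first half is explicit Pontryagin duality. Modulo `U(m)`, an idèle that is a unit outside
`S` is a product of powers of uniformizers, of lifts of residue generators, and of its archimedean
components. A character χ of modulus `m` with dual logarithm `v` therefore takes the value exp(2πi
v·y) at an idèle with logarithm `y` (`LogSetup.IsDualLog.apply_eq`). Since `S` generates the class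
group, such idèles together with `F^×` generate all idèles (`exists_principal_mul_mem_sIdeles`).
Hence `v` determines χ, and triviality on `F^×` is integrality of the pairing on logarithms of
`S`-units. Conversely, a vector of `Λ₀^⊥` with all φ zero defines a character by the same formula
(`charHom`), continuous because near 1 it involves only the archimedean components. The pairing with
`v₀` is then zero.

It remains to see that the exponents `k_σ` of such a vector factor through `K` (Weil, Artin). They
give a relation ∏ σ(u)^{k_σ} = 1 for all units `u ≡ 1 mod m`. Absolute values and Dirichlet's
theorem force `k` to change sign under complex conjugation (`exponent_conjugate`). The relation is
algebraic, so this also holds for its Galois twists: inserting complex conjugation `c` anywhere in a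
word in the Galois group of a Galois extension `L` of ℚ containing `F` negates `k`. The elements
fixing the conjugates of `K` whose insertion leaves `k` unchanged form a normal subgroup, which
contains every `c h c h⁻¹`. Its fixed field in `F` is a CM field containing `K`, hence equal to `K`,
and `k` is constant on embeddings that agree there (`exists_isCMField_of_normal`,
`exponent_eq_of_restrict_eq`).

For the second half, `H` is cut out by vanishing prime and residue coordinates and vanishing norm of
the arguments (`mem_H_iff`). Every unit has a power whose norm is totally positive in `K⁺`, so
Dirichlet's theorem supplies all modulus vectors of sum zero; `v₀` supplies the missing line and the
kernel of the norm the arguments (`span_U`). Finally `Λ₀ ∩ H` is discrete, since a small element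
comes from a unit close to 1 at every place, and for a discrete group the ℤ-rank is the dimension of
the span. -/

noncomputable section

namespace HeckeAlg

/-! ### Components of idèles and neighbourhoods of 1 -/

section IdeleBasics

variable {F : Type*} [Field F] [NumberField F]

/-- The component at a finite prime, as a homomorphism of groups. -/
def finUnit (p : HeightOneSpectrum (𝓞 F)) : Idele F →* (p.adicCompletion F)ˣ :=
  Units.map
    { toFun := fun x : AdeleRing (𝓞 F) F => x.2 p
      map_one' := rfl
      map_mul' := fun _ _ => rfl }

@[simp] theorem coe_finUnit (p : HeightOneSpectrum (𝓞 F)) (x : Idele F) :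
    (finUnit p x : p.adicCompletion F) = finComp x p := rfl

/-- The component at an archimedean place, as a homomorphism of groups. -/
def infUnit (w : InfinitePlace F) : Idele F →* (w.Completion)ˣ :=
  Units.map
    { toFun := fun x : AdeleRing (𝓞 F) F => x.1 w
      map_one' := rfl
      map_mul' := fun _ _ => rfl }

theorem infComp_eq (w : InfinitePlace F) (x : Idele F) :
    infComp x w = InfinitePlace.Completion.extensionEmbedding w (infUnit w x : w.Completion) := rfl

@[simp] theorem finComp_mul (x y : Idele F) (p) :
    finComp (x * y) p = finComp x p * finComp y p := rfl

@[simp] theorem finComp_one (p) : finComp (1 : Idele F) p = 1 := rfl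

@[simp] theorem finComp_inv (x : Idele F) (p) : finComp x⁻¹ p = (finComp x p)⁻¹ := by
  rw [← coe_finUnit, map_inv, Units.val_inv_eq_inv_val, coe_finUnit]

theorem finComp_ne_zero (x : Idele F) (p) : finComp x p ≠ 0 := (finUnit p x).ne_zero

@[simp] theorem infComp_mul (x y : Idele F) (w) :
    infComp (x * y) w = infComp x w * infComp y w := map_mul _ _ _

@[simp] theorem infComp_one (w) : infComp (1 : Idele F) w = 1 := map_one _

theorem infComp_ne_zero (x : Idele F) (w) : infComp x w ≠ 0 := by
  rw [infComp_eq]; simp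

@[simp] theorem infComp_inv (x : Idele F) (w) : infComp x⁻¹ w = (infComp x w)⁻¹ := by
  rw [infComp_eq, map_inv, Units.val_inv_eq_inv_val, map_inv₀, infComp_eq]

@[simp] theorem infComp_principal (α : Fˣ) (w : InfinitePlace F) :
    infComp (principal α) w = w.embedding (α : F) :=
  InfinitePlace.Completion.extensionEmbedding_coe (v := w) (WithAbs.toAbs w.1 (α : F))

theorem valued_finComp_principal (α : Fˣ) (p : HeightOneSpectrum (𝓞 F)) :
    Valued.v (finComp (principal α) p) = p.valuation F (α : F) :=
  HeightOneSpectrum.valuedAdicCompletion_eq_valuation' p (α : F)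

theorem finComp_finSingle_same (p : HeightOneSpectrum (𝓞 F)) (x : (p.adicCompletion F)ˣ) :
    finComp (finSingle p x) p = x :=
  letI := Classical.decEq (HeightOneSpectrum (𝓞 F))
  RestrictedProduct.mulSingle_eq_same
    (fun v : HeightOneSpectrum (𝓞 F) => v.adicCompletionIntegers F) p _

theorem finComp_finSingle_of_ne {p q : HeightOneSpectrum (𝓞 F)} (h : q ≠ p)
    (x : (p.adicCompletion F)ˣ) : finComp (finSingle p x) q = 1 :=
  letI := Classical.decEq (HeightOneSpectrum (𝓞 F))
  RestrictedProduct.mulSingle_eq_of_ne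
    (fun v : HeightOneSpectrum (𝓞 F) => v.adicCompletionIntegers F) (x : p.adicCompletion F) h

@[simp] theorem infComp_finSingle (p : HeightOneSpectrum (𝓞 F)) (x : (p.adicCompletion F)ˣ) (w) :
    infComp (finSingle p x) w = 1 := map_one _

@[simp] theorem finComp_infSingle (w : InfinitePlace F) (x : (w.Completion)ˣ)
    (p : HeightOneSpectrum (𝓞 F)) : finComp (infSingle w x) p = 1 := rfl

theorem infUnit_infSingle_same (w : InfinitePlace F) (x : (w.Completion)ˣ) :
    infUnit w (infSingle w x) = x :=
  letI := Classical.decEq (InfinitePlace F)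
  Units.ext (Pi.mulSingle_eq_same (M := fun v : InfinitePlace F => v.Completion) w _)

theorem infUnit_infSingle_of_ne {w w' : InfinitePlace F} (h : w' ≠ w) (x : (w.Completion)ˣ) :
    infUnit w' (infSingle w x) = 1 :=
  letI := Classical.decEq (InfinitePlace F)
  Units.ext (Pi.mulSingle_eq_of_ne (M := fun v : InfinitePlace F => v.Completion) h _)

theorem finite_valued_ne_one (x : Idele F) :
    {p : HeightOneSpectrum (𝓞 F) | Valued.v (finComp x p) ≠ 1}.Finite := by
  have h : IsUnit ((x : AdeleRing (𝓞 F) F).2) :=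
    x.isUnit.map (RingHom.snd (InfiniteAdeleRing F) (FiniteAdeleRing (𝓞 F) F))
  exact (FiniteAdeleRing.isUnit_iff.1 h).2

/-- The idèle with prescribed finite components, almost all of them units, and archimedean
components `1`. -/
def ofFin (u : (p : HeightOneSpectrum (𝓞 F)) → (p.adicCompletion F)ˣ)
    (h : ∀ p, Valued.v (u p : p.adicCompletion F) = 1) : Idele F where
  val := ((1 : InfiniteAdeleRing F), ⟨fun p => u p, .of_forall fun p => (h p).le⟩)
  inv := ((1 : InfiniteAdeleRing F), ⟨fun p => ((u p)⁻¹ : (p.adicCompletion F)ˣ),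
    .of_forall fun p => by
      simp [HeightOneSpectrum.mem_adicCompletionIntegers, h p]⟩)
  val_inv := Prod.ext (one_mul _) (FiniteAdeleRing.ext _ fun p => (u p).mul_inv)
  inv_val := Prod.ext (one_mul _) (FiniteAdeleRing.ext _ fun p => (u p).inv_mul)

@[simp] theorem finComp_ofFin (u : (p : HeightOneSpectrum (𝓞 F)) → (p.adicCompletion F)ˣ)
    (h : ∀ p, Valued.v (u p : p.adicCompletion F) = 1) (p) : finComp (ofFin u h) p = u p := rfl

@[simp] theorem infComp_ofFin (u : (p : HeightOneSpectrum (𝓞 F)) → (p.adicCompletion F)ˣ)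
    (h : ∀ p, Valued.v (u p : p.adicCompletion F) = 1) (w) : infComp (ofFin u h) w = 1 :=
  map_one _

theorem continuous_infComp (w : InfinitePlace F) : Continuous fun x : Idele F => infComp x w := by
  have h1 : Continuous fun x : Idele F => (x : AdeleRing (𝓞 F) F).1 w :=
    (continuous_apply (A := fun v : InfinitePlace F => v.Completion) w).comp
      (continuous_fst.comp Units.continuous_val)
  exact (InfinitePlace.Completion.isometry_extensionEmbedding w).continuous.comp h1

theorem continuous_finComp (p : HeightOneSpectrum (𝓞 F)) :
    Continuous fun x : Idele F => finComp x p :=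
  (RestrictedProduct.continuous_eval (R := fun p : HeightOneSpectrum (𝓞 F) => p.adicCompletion F)
    (A := fun p => (p.adicCompletionIntegers F : Set (p.adicCompletion F))) p).comp
      (continuous_snd.comp Units.continuous_val)

theorem isOpen_integral : IsOpen {x : Idele F | ∀ p, Valued.v (finComp x p) ≤ 1} := by
  have h : IsOpen {f : FiniteAdeleRing (𝓞 F) F |
      ∀ p, f.1 p ∈ (p.adicCompletionIntegers F : Set (p.adicCompletion F))} :=
    RestrictedProduct.isOpen_forall_mem
      (A := fun p : HeightOneSpectrum (𝓞 F) =>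
        (p.adicCompletionIntegers F : Set (p.adicCompletion F)))
      (fun p => Valued.isOpen_valuationSubring _)
  have hc : Continuous fun x : Idele F => (x : AdeleRing (𝓞 F) F).2 :=
    continuous_snd.comp Units.continuous_val
  exact h.preimage hc

theorem finite_ordAt_ne_zero {m : Ideal (𝓞 F)} (hm : m ≠ ⊥) :
    {p : HeightOneSpectrum (𝓞 F) | ordAt p m ≠ 0}.Finite := by
  have := Associates.finite_factors hm
  simpa [Filter.eventually_cofinite, ordAt] using this

/-- Division by an element of valuation `exp n` turns this ball into the ring of integers, which is
open. -/
theorem isOpen_valued_le_exp (p : HeightOneSpectrum (𝓞 F)) (n : ℤ) :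
    IsOpen {y : p.adicCompletion F | Valued.v y ≤ WithZero.exp n} := by
  obtain ⟨a, ha⟩ := HeightOneSpectrum.valuedAdicCompletion_surjective F p (WithZero.exp n)
  have h0 : 0 < Valued.v a := by simp [ha]
  have hopen : IsOpen (p.adicCompletionIntegers F : Set (p.adicCompletion F)) :=
    Valued.isOpen_valuationSubring _
  convert! hopen.preimage (continuous_mul_const a⁻¹) using 1
  ext y
  rw [Set.mem_preimage, SetLike.mem_coe, HeightOneSpectrum.mem_adicCompletionIntegers,
    map_mul, map_inv₀, ← div_eq_mul_inv, div_le_one₀ h0, ha]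
  rfl

/-- Integrality of `x` and of `x⁻¹` is open and makes `x` a unit everywhere; the congruence adds
only finitely many open conditions, one for each prime dividing `m`. The archimedean components stay
free, as the continuity argument requires. -/
theorem eventually_isOneMod {m : Ideal (𝓞 F)} (hm : m ≠ ⊥) :
    ∀ᶠ x : Idele F in nhds 1, (∀ p, Valued.v (finComp x p) = 1) ∧
      ∀ p, Valued.v (finComp x p - 1) ≤ WithZero.exp (-(ordAt p m : ℤ)) := by
  have h1 : ∀ᶠ x : Idele F in nhds 1, ∀ p, Valued.v (finComp x p) ≤ 1 :=
    isOpen_integral.mem_nhds (by simp)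
  have h2 : ∀ᶠ x : Idele F in nhds 1, ∀ p, Valued.v (finComp x⁻¹ p) ≤ 1 :=
    (isOpen_integral.preimage continuous_inv).mem_nhds (by simp)
  have h3 : ∀ᶠ x : Idele F in nhds 1, ∀ p ∈ {p : HeightOneSpectrum (𝓞 F) | ordAt p m ≠ 0},
      Valued.v (finComp x p - 1) ≤ WithZero.exp (-(ordAt p m : ℤ)) := by
    rw [Filter.eventually_all_finite (finite_ordAt_ne_zero hm)]
    intro p _
    have hc : Continuous fun x : Idele F => finComp x p - 1 :=
      (continuous_finComp p).sub continuous_const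
    exact ((isOpen_valued_le_exp p _).preimage hc).mem_nhds (by simp)
  filter_upwards [h1, h2, h3] with x hx1 hx2 hx3
  have hu : ∀ p, Valued.v (finComp x p) = 1 := fun p => by
    refine le_antisymm (hx1 p) ?_
    have := hx2 p
    rw [finComp_inv, map_inv₀] at this
    have h0 : 0 < Valued.v (finComp x p) := by
      rw [Valuation.pos_iff]; exact finComp_ne_zero x p
    exact (inv_le_one₀ h0).1 this
  refine ⟨hu, fun p => ?_⟩
  by_cases hp : ordAt p m = 0
  · rw [hp]
    simpa using (Valued.v.map_sub (finComp x p) 1).trans (by simp [hu p])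
  · exact hx3 p hp

end IdeleBasics

end HeckeAlg

end

noncomputable section

namespace HeckeAlg

/-! ### Residues modulo `m` of families of local units -/

section Residues

variable {F : Type*} [Field F] [NumberField F] {m : Ideal (𝓞 F)}

/-- The ring homomorphism from `𝓞 F` to the completion at a finite prime. -/
def toCompl (p : HeightOneSpectrum (𝓞 F)) : 𝓞 F →+* p.adicCompletion F :=
  (algebraMap F (p.adicCompletion F)).comp (algebraMap (𝓞 F) F)

theorem coe_one_adic (p : HeightOneSpectrum (𝓞 F)) :
    (((1 : 𝓞 F) : F) : p.adicCompletion F) = 1 := map_one (toCompl p)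

theorem coe_mul_adic (p : HeightOneSpectrum (𝓞 F)) (a a' : 𝓞 F) :
    (((a * a' : 𝓞 F) : F) : p.adicCompletion F) =
      ((a : F) : p.adicCompletion F) * ((a' : F) : p.adicCompletion F) :=
  map_mul (toCompl p) a a'

theorem valued_coe_sub (p : HeightOneSpectrum (𝓞 F)) (a b : 𝓞 F) :
    Valued.v (((a : F) : p.adicCompletion F) - ((b : F) : p.adicCompletion F)) =
      p.intValuation (a - b) := by
  have h : ((a : F) : p.adicCompletion F) - ((b : F) : p.adicCompletion F) =
      (((a - b : 𝓞 F) : F) : p.adicCompletion F) :=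
    (map_sub (toCompl p) a b).symm
  rw [h, HeightOneSpectrum.valuedAdicCompletion_eq_valuation',
    HeightOneSpectrum.valuation_of_algebraMap]

theorem valued_coe_le_one (p : HeightOneSpectrum (𝓞 F)) (a : 𝓞 F) :
    Valued.v ((a : F) : p.adicCompletion F) ≤ 1 := by
  rw [HeightOneSpectrum.valuedAdicCompletion_eq_valuation',
    HeightOneSpectrum.valuation_of_algebraMap]
  exact p.intValuation_le_one a

theorem mem_iff_intValuation_le (hm : m ≠ ⊥) (a : 𝓞 F) :
    a ∈ m ↔ ∀ p : HeightOneSpectrum (𝓞 F), p.intValuation a ≤ WithZero.exp (-(ordAt p m : ℤ)) := by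
  conv_lhs => rw [← Ideal.iInf_maxPowDividing_eq hm]
  simp only [Ideal.mem_iInf, HeightOneSpectrum.intValuation_le_pow_iff_mem]
  rfl

theorem mk_eq_mk_iff_valued (hm : m ≠ ⊥) (a b : 𝓞 F) :
    Ideal.Quotient.mk m a = Ideal.Quotient.mk m b ↔ ∀ p : HeightOneSpectrum (𝓞 F),
      Valued.v (((a : F) : p.adicCompletion F) - ((b : F) : p.adicCompletion F)) ≤
        WithZero.exp (-(ordAt p m : ℤ)) := by
  rw [Ideal.Quotient.eq, mem_iff_intValuation_le hm]
  simp only [valued_coe_sub]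

theorem isResidue_coe (a : 𝓞 F) (b : (𝓞 F ⧸ m)ˣ) (h : Ideal.Quotient.mk m a = b) :
    IsResidue m (fun p => ((a : F) : p.adicCompletion F)) b :=
  ⟨a, h, fun p => by simp⟩

theorem isResidue_one : IsResidue m (fun _ => 1) 1 :=
  ⟨1, by simp, fun p => by rw [coe_one_adic]; simp⟩

theorem valued_mul_sub_mul_le {p : HeightOneSpectrum (𝓞 F)} {u u' a a' : p.adicCompletion F}
    {γ : WithZero (Multiplicative ℤ)} (hu : Valued.v u ≤ 1) (ha' : Valued.v a' ≤ 1)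
    (h : Valued.v (u - a) ≤ γ) (h' : Valued.v (u' - a') ≤ γ) :
    Valued.v (u * u' - a * a') ≤ γ := by
  have : u * u' - a * a' = u * (u' - a') + (u - a) * a' := by ring
  rw [this]
  refine (Valued.v.map_add _ _).trans (max_le ?_ ?_)
  · rw [map_mul]; exact (mul_le_of_le_one_left' hu).trans h'
  · rw [map_mul]; exact (mul_le_of_le_one_right' ha').trans h

theorem IsResidue.mul {u u' : (p : HeightOneSpectrum (𝓞 F)) → p.adicCompletion F}
    {b b' : (𝓞 F ⧸ m)ˣ} (h : IsResidue m u b) (h' : IsResidue m u' b')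
    (hu : ∀ p, Valued.v (u p) ≤ 1) : IsResidue m (fun p => u p * u' p) (b * b') := by
  obtain ⟨a, ha, h⟩ := h
  obtain ⟨a', ha', h'⟩ := h'
  refine ⟨a * a', by simp [ha, ha'], fun p => ?_⟩
  rw [coe_mul_adic]
  exact valued_mul_sub_mul_le (hu p) (valued_coe_le_one p a') (h p) (h' p)

theorem IsResidue.eq_of_near (hm : m ≠ ⊥)
    {u u' : (p : HeightOneSpectrum (𝓞 F)) → p.adicCompletion F}
    {b b' : (𝓞 F ⧸ m)ˣ} (h : IsResidue m u b) (h' : IsResidue m u' b')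
    (hu : ∀ p, Valued.v (u p - u' p) ≤ WithZero.exp (-(ordAt p m : ℤ))) : b = b' := by
  obtain ⟨a, ha, h⟩ := h
  obtain ⟨a', ha', h'⟩ := h'
  apply Units.ext
  rw [← ha, ← ha', mk_eq_mk_iff_valued hm]
  intro p
  have : ((a : F) : p.adicCompletion F) - ((a' : F) : p.adicCompletion F) =
      -(u p - (a : F)) + ((u p - u' p) + (u' p - (a' : F))) := by ring
  rw [this]
  refine (Valued.v.map_add _ _).trans (max_le ?_ ((Valued.v.map_add _ _).trans
    (max_le (hu p) (h' p))))
  rw [Valuation.map_neg]; exact h p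

theorem IsResidue.unique (hm : m ≠ ⊥)
    {u : (p : HeightOneSpectrum (𝓞 F)) → p.adicCompletion F}
    {b b' : (𝓞 F ⧸ m)ˣ} (h : IsResidue m u b) (h' : IsResidue m u b') : b = b' :=
  h.eq_of_near hm h' fun p => by simp

/-- Two approximations: first by an element of `F`, by density, which is then `p`-integral; next by
an algebraic integer. -/
theorem exists_valued_sub_coe_le (p : HeightOneSpectrum (𝓞 F)) (u : p.adicCompletion F)
    (hu : Valued.v u ≤ 1) (n : ℕ) :
    ∃ a : 𝓞 F, Valued.v (u - ((a : F) : p.adicCompletion F)) ≤ WithZero.exp (-(n : ℤ)) := by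
  have hc : Continuous fun y : p.adicCompletion F => u - y := continuous_const.sub continuous_id
  obtain ⟨k, hk⟩ := (HeightOneSpectrum.denseRange_algebraMap (R := 𝓞 F) (K := F) p).exists_mem_open
    ((isOpen_valued_le_exp p (-(n : ℤ))).preimage hc) ⟨u, by simp⟩
  change Valued.v (u - ((k : F) : p.adicCompletion F)) ≤ _ at hk
  have hexp : WithZero.exp (-(n : ℤ)) ≤ 1 := by
    rw [← WithZero.exp_zero, WithZero.exp_le_exp]; omega
  have hk1 : p.valuation F k ≤ 1 := by
    rw [← HeightOneSpectrum.valuedAdicCompletion_eq_valuation']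
    have : (k : p.adicCompletion F) = -(u - (k : p.adicCompletion F)) + u := by ring
    rw [this]
    refine (Valued.v.map_add _ _).trans (max_le ?_ hu)
    rw [Valuation.map_neg]
    exact hk.trans hexp
  obtain ⟨a, ha⟩ := HeightOneSpectrum.exists_valuation_sub_lt_of_integer p hk1
    (Units.mk0 (WithZero.exp (-(n : ℤ))) (by simp))
  refine ⟨a, ?_⟩
  have : u - ((a : F) : p.adicCompletion F) = (u - (k : p.adicCompletion F)) -
      (((a : F) - k : F) : p.adicCompletion F) := by
    have : (((a : F) - k : F) : p.adicCompletion F) = ((a : F) : p.adicCompletion F) - k :=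
      map_sub (algebraMap F (p.adicCompletion F)) _ _
    rw [this]; ring
  rw [this]
  refine (Valued.v.map_sub _ _).trans (max_le hk ?_)
  rw [HeightOneSpectrum.valuedAdicCompletion_eq_valuation']
  exact ha.le

/-- The Chinese remainder theorem glues the local approximations at the primes dividing `m`;
elsewhere integrality suffices. -/
theorem exists_lift (hm : m ≠ ⊥) (u : (p : HeightOneSpectrum (𝓞 F)) → p.adicCompletion F)
    (hu : ∀ p, Valued.v (u p) ≤ 1) : ∃ a : 𝓞 F, ∀ p,
      Valued.v (u p - ((a : F) : p.adicCompletion F)) ≤ WithZero.exp (-(ordAt p m : ℤ)) := by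
  choose a ha using fun p => exists_valued_sub_coe_le p (u p) (hu p) (ordAt p m)
  obtain ⟨y, hy⟩ := IsDedekindDomain.exists_forall_sub_mem_ideal
    (s := (finite_ordAt_ne_zero hm).toFinset) (fun p => p.asIdeal) (fun p => ordAt p m)
    (fun p _ => p.prime) (fun p _ q _ hpq h => hpq (HeightOneSpectrum.ext h)) (fun p => a p)
  refine ⟨y, fun p => ?_⟩
  by_cases hp : ordAt p m = 0
  · rw [hp]
    simpa using (Valued.v.map_sub _ _).trans (max_le (hu p) (valued_coe_le_one p y))
  · have h1 := hy p (by simpa using hp)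
    have : u p - ((y : F) : p.adicCompletion F) = (u p - ((a p : F) : p.adicCompletion F)) -
      (((y : F) : p.adicCompletion F) - ((a p : F) : p.adicCompletion F)) := by ring
    rw [this]
    refine (Valued.v.map_sub _ _).trans (max_le (ha p) ?_)
    rw [valued_coe_sub, HeightOneSpectrum.intValuation_le_pow_iff_mem]
    exact h1

/-- Lifts of `u` and of `u⁻¹` multiply to 1 modulo `m`, so the residue is invertible. -/
theorem exists_isResidue (hm : m ≠ ⊥) (u : (p : HeightOneSpectrum (𝓞 F)) → p.adicCompletion F)
    (hu : ∀ p, Valued.v (u p) = 1) : ∃ b, IsResidue m u b := by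
  obtain ⟨a, ha⟩ := exists_lift hm u fun p => (hu p).le
  obtain ⟨a', ha'⟩ := exists_lift hm (fun p => (u p)⁻¹) fun p => by simp [hu p]
  have h1 : Ideal.Quotient.mk m a * Ideal.Quotient.mk m a' = 1 := by
    rw [← map_mul, ← map_one (Ideal.Quotient.mk m), mk_eq_mk_iff_valued hm]
    intro p
    have h := valued_mul_sub_mul_le (hu p).le (valued_coe_le_one p a') (ha p) (ha' p)
    have e3 : u p * (u p)⁻¹ = 1 :=
      mul_inv_cancel₀ fun h => by simpa [h] using hu p
    rw [coe_one_adic, coe_mul_adic, Valuation.map_sub_swap, ← e3]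
    exact h
  exact ⟨Units.mkOfMulEqOne _ _ h1, a, rfl, ha⟩

theorem IsResidue.inv (hm : m ≠ ⊥) {u : (p : HeightOneSpectrum (𝓞 F)) → p.adicCompletion F}
    {b : (𝓞 F ⧸ m)ˣ} (h : IsResidue m u b) (hu : ∀ p, Valued.v (u p) = 1) :
    IsResidue m (fun p => (u p)⁻¹) b⁻¹ := by
  obtain ⟨b', hb'⟩ := exists_isResidue hm (fun p => (u p)⁻¹) fun p => by simp [hu p]
  have h1 := h.mul hb' fun p => (hu p).le
  have e3 : (fun p => u p * (u p)⁻¹) = fun _ => 1 :=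
    funext fun p => mul_inv_cancel₀ fun h => by simpa [h] using hu p
  rw [e3] at h1
  rwa [inv_eq_of_mul_eq_one_right (h1.unique hm isResidue_one)]

theorem isFiniteUnit_one : IsFiniteUnit (1 : Idele F) := ⟨by simp, by simp⟩

theorem IsFiniteUnit.mul {x y : Idele F} (hx : IsFiniteUnit x) (hy : IsFiniteUnit y) :
    IsFiniteUnit (x * y) :=
  ⟨fun p => by simp [hx.1 p, hy.1 p], fun w => by simp [hx.2 w, hy.2 w]⟩

theorem IsFiniteUnit.inv {x : Idele F} (hx : IsFiniteUnit x) : IsFiniteUnit x⁻¹ :=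
  ⟨fun p => by simp [hx.1 p], fun w => by simp [hx.2 w]⟩

/-- Place a lift `a` of `b` at the primes dividing `m`, and 1 at the others, where `a` need not be a
unit. -/
theorem exists_isFiniteUnit_isResidue (hm : m ≠ ⊥) (b : (𝓞 F ⧸ m)ˣ) :
    ∃ y : Idele F, IsFiniteUnit y ∧ IsResidue m (finComp y) b := by
  classical
  obtain ⟨a, ha⟩ := Ideal.Quotient.mk_surjective (b : 𝓞 F ⧸ m)
  obtain ⟨a', ha'⟩ := Ideal.Quotient.mk_surjective ((b⁻¹ : (𝓞 F ⧸ m)ˣ) : 𝓞 F ⧸ m)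
  have h1 : a * a' - 1 ∈ m := by
    rw [← Ideal.Quotient.eq_zero_iff_mem]; simp [ha, ha']
  rw [mem_iff_intValuation_le hm] at h1
  -- Since `a * a' ≡ 1 mod m`, no prime dividing `m` can divide `a`.
  have hunit : ∀ p : HeightOneSpectrum (𝓞 F), ordAt p m ≠ 0 →
      Valued.v ((a : F) : p.adicCompletion F) = 1 := by
    intro p hp
    rw [HeightOneSpectrum.valuedAdicCompletion_eq_valuation',
      HeightOneSpectrum.valuation_of_algebraMap]
    refine le_antisymm (p.intValuation_le_one a) (not_lt.1 fun hlt => ?_)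
    have h2 : p.intValuation (a * a' - 1) < 1 := (h1 p).trans_lt (by
      rw [← WithZero.exp_zero, WithZero.exp_lt_exp]; omega)
    have h3 : p.intValuation (a * a') < 1 := by
      rw [map_mul]; exact mul_lt_one_of_lt_of_le hlt (p.intValuation_le_one a')
    have h4 : p.intValuation (a * a' - (a * a' - 1)) < 1 :=
      (p.intValuation.map_sub _ _).trans_lt (max_lt h3 h2)
    simp at h4
  let u : (p : HeightOneSpectrum (𝓞 F)) → (p.adicCompletion F)ˣ := fun p =>
    if hp : ordAt p m ≠ 0 then Units.mk0 ((a : F) : p.adicCompletion F)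
      (fun h => by have := hunit p hp; rw [h, map_zero] at this; exact zero_ne_one this) else 1
  have hu1 : ∀ p, ordAt p m ≠ 0 → (u p : p.adicCompletion F) = ((a : F) : p.adicCompletion F) :=
    fun p hp => by simp only [u, dif_pos hp, Units.val_mk0]
  have hu : ∀ p, Valued.v (u p : p.adicCompletion F) = 1 := fun p => by
    by_cases hp : ordAt p m ≠ 0
    · rw [hu1 p hp, hunit p hp]
    · simp only [u, dif_neg hp, Units.val_one, map_one]
  refine ⟨ofFin u hu, ⟨hu, by simp⟩, a, ha, fun p => ?_⟩
  rw [finComp_ofFin]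
  by_cases hp : ordAt p m ≠ 0
  · simp [hu1 p hp]
  · rw [not_not.1 hp]
    have := (Valued.v.map_sub (u p : p.adicCompletion F) ((a : F) : p.adicCompletion F)).trans
      (max_le (hu p).le (valued_coe_le_one p a))
    simpa using this

end Residues

end HeckeAlg

end

noncomputable section

namespace HeckeAlg

/-! ### Ideals of idèles, and reduction to `S`-idèles -/

section ClassGroups

variable {F : Type*} [Field F] [NumberField F]

open scoped nonZeroDivisors

theorem valuation_eq_exp_neg_count (p : HeightOneSpectrum (𝓞 F)) (α : Fˣ) :
    p.valuation F (α : F) = WithZero.exp (-(FractionalIdeal.count F p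
      (toPrincipalIdeal (𝓞 F) F α : FractionalIdeal (𝓞 F)⁰ F))) := by
  classical
  have hint : ∀ a : 𝓞 F, a ≠ 0 → p.valuation F (algebraMap (𝓞 F) F a) = WithZero.exp
      (-(FractionalIdeal.count F p (FractionalIdeal.spanSingleton (𝓞 F)⁰ (algebraMap _ F a)))) := by
    intro a ha
    rw [HeightOneSpectrum.valuation_of_algebraMap, HeightOneSpectrum.intValuation_if_neg _ ha,
      ← FractionalIdeal.coeIdeal_span_singleton, FractionalIdeal.count_coe]
    simpa using ha
  rw [coe_toPrincipalIdeal]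
  obtain ⟨a, b, hb, hab⟩ := IsFractionRing.div_surjective (A := 𝓞 F) (α : F)
  have hb0 : b ≠ 0 := nonZeroDivisors.ne_zero hb
  have ha0 : a ≠ 0 := by
    rintro rfl
    exact α.ne_zero (by rw [← hab]; simp)
  have hb0' : algebraMap (𝓞 F) F b ≠ 0 := by simpa using hb0
  have hmul : FractionalIdeal.spanSingleton (𝓞 F)⁰ (algebraMap _ F a) =
      FractionalIdeal.spanSingleton (𝓞 F)⁰ (α : F) *
        FractionalIdeal.spanSingleton (𝓞 F)⁰ (algebraMap _ F b) := by
    rw [FractionalIdeal.spanSingleton_mul_spanSingleton, ← hab, div_mul_cancel₀ _ hb0']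
  have hc := FractionalIdeal.count_mul F p (I := FractionalIdeal.spanSingleton (𝓞 F)⁰ (α : F))
    (I' := FractionalIdeal.spanSingleton (𝓞 F)⁰ (algebraMap _ F b)) 
    (FractionalIdeal.spanSingleton_ne_zero_iff.2 α.ne_zero)
    (FractionalIdeal.spanSingleton_ne_zero_iff.2 hb0')
  rw [← hmul] at hc
  rw [← hab, map_div₀, hint a ha0, hint b hb0, hc, ← WithZero.exp_sub, hab]
  congr 1
  ring

/-- The idèle `x` has the same valuations as the fractional ideal `I`. -/
def Represents (x : Idele F) (I : (FractionalIdeal (𝓞 F)⁰ F)ˣ) : Prop :=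
  ∀ p, Valued.v (finComp x p) = WithZero.exp (-(FractionalIdeal.count F p I.1))

theorem Represents.mul {x y : Idele F} {I J : (FractionalIdeal (𝓞 F)⁰ F)ˣ} (hx : Represents x I)
    (hy : Represents y J) : Represents (x * y) (I * J) := fun p => by
  rw [finComp_mul, map_mul, hx p, hy p, Units.val_mul,
    FractionalIdeal.count_mul F p I.ne_zero J.ne_zero, ← WithZero.exp_add]
  congr 1; ring

theorem Represents.inv {x : Idele F} {I : (FractionalIdeal (𝓞 F)⁰ F)ˣ} (hx : Represents x I) :
    Represents x⁻¹ I⁻¹ := fun p => by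
  rw [finComp_inv, map_inv₀, hx p, Units.val_inv_eq_inv_val, FractionalIdeal.count_inv,
    ← WithZero.exp_neg]

theorem represents_one : Represents (1 : Idele F) 1 := fun p => by
  simp [FractionalIdeal.count_one]

theorem represents_principal (α : Fˣ) :
    Represents (principal α) (toPrincipalIdeal (𝓞 F) F α) := fun p => by
  rw [valued_finComp_principal, valuation_eq_exp_neg_count]

theorem exists_represents (x : Idele F) : ∃ I, Represents x I := by
  let n : HeightOneSpectrum (𝓞 F) →₀ ℤ :=
    Finsupp.ofSupportFinite (fun p => -WithZero.log (Valued.v (finComp x p)))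
      ((finite_valued_ne_one x).subset fun p hp h => hp (by simp [h]))
  have hI : (n.prod fun p k => (p.asIdeal : FractionalIdeal (𝓞 F)⁰ F) ^ k) ≠ 0 :=
    Finset.prod_ne_zero_iff.2 fun p _ =>
      zpow_ne_zero _ (FractionalIdeal.coeIdeal_ne_zero.2 p.ne_bot)
  refine ⟨Units.mk0 _ hI, fun p => ?_⟩
  rw [Units.val_mk0, FractionalIdeal.count_finsuppProd]
  have : -n p = WithZero.log (Valued.v (finComp x p)) := neg_neg _
  rw [this, WithZero.exp_log]
  simpa using finComp_ne_zero x p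

theorem represents_finSingle (p : HeightOneSpectrum (𝓞 F)) (ϖ : (p.adicCompletion F)ˣ)
    (h : Valued.v (ϖ : p.adicCompletion F) = WithZero.exp (-1 : ℤ)) :
    Represents (finSingle p ϖ) (FractionalIdeal.mk0 F
      ⟨p.asIdeal, mem_nonZeroDivisors_iff_ne_zero.2 p.ne_bot⟩) := fun q => by
  rw [FractionalIdeal.coe_mk0]
  by_cases hq : q = p
  · subst hq
    rw [finComp_finSingle_same, h, FractionalIdeal.count_self]
  · rw [finComp_finSingle_of_ne hq, FractionalIdeal.count_maximal_coprime F q (Ne.symm hq)]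
    simp

variable (D : LogSetup F)

/-- The group `U_S` of idèles that are units at all finite primes outside `S`. -/
def sIdeles : Subgroup (Idele F) where
  carrier := {x | ∀ p ∉ D.S, Valued.v (finComp x p) = 1}
  mul_mem' hx hy p hp := by simp [hx p hp, hy p hp]
  one_mem' p _ := by simp
  inv_mem' hx p hp := by simp [hx p hp]

/-- The ideal classes represented by idèles of `J = F^× U_S` form a subgroup containing the classes
of the primes of `S`, hence are all classes. So `x` has the class of some `y ∈ J`, and differs from
`y` by a principal idèle times an idèle that is a unit at every finite prime. -/
theorem exists_principal_mul_mem_sIdeles (x : Idele F) :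
    ∃ α : Fˣ, principal α * x ∈ sIdeles D := by
  let J : Subgroup (Idele F) := principal.range ⊔ sIdeles D
  let A : Subgroup (ClassGroup (𝓞 F)) :=
    { carrier := {c | ∃ (I : (FractionalIdeal (𝓞 F)⁰ F)ˣ) (y : Idele F), ClassGroup.mk F I = c ∧ Represents y I ∧ y ∈ J}
      mul_mem' := by
        rintro _ _ ⟨I, y, rfl, h, hy⟩ ⟨I', y', rfl, h', hy'⟩
        exact ⟨I * I', y * y', map_mul (ClassGroup.mk F) _ _, h.mul h', mul_mem hy hy'⟩
      one_mem' := ⟨1, 1, map_one (ClassGroup.mk F), represents_one, one_mem _⟩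
      inv_mem' := by
        rintro _ ⟨I, y, rfl, h, hy⟩
        exact ⟨I⁻¹, y⁻¹, map_inv (ClassGroup.mk F) _, h.inv, inv_mem hy⟩ }
  have hA : A = ⊤ := by
    rw [eq_top_iff, ← D.generates, Subgroup.closure_le]
    rintro c ⟨p, hp, rfl⟩
    refine ⟨_, finSingle p (D.π p), ClassGroup.mk_mk0 F _, represents_finSingle p _
      (D.uniformizer p), Subgroup.mem_sup_right fun q hq => ?_⟩
    rw [finComp_finSingle_of_ne (by rintro rfl; exact hq hp), map_one]
  suffices hx : x ∈ J by
    obtain ⟨_, ⟨α, rfl⟩, z, hz, rfl⟩ := Subgroup.mem_sup.1 hx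
    exact ⟨α⁻¹, by rwa [map_inv, inv_mul_cancel_left]⟩
  obtain ⟨I, hI⟩ := exists_represents x
  obtain ⟨I', y, hII', hy, hyJ⟩ : ClassGroup.mk F I ∈ A := hA ▸ Subgroup.mem_top _
  have h1 : ClassGroup.mk F (I * I'⁻¹) = 1 := by rw [map_mul, map_inv, hII', mul_inv_cancel]
  rw [ClassGroup.mk_eq_one_iff, FractionalIdeal.isPrincipal_iff] at h1
  obtain ⟨α, hα⟩ := mem_principal_ideals_iff.2 (h1.imp fun _ => Eq.symm)
  have h2 : x * (principal α * y)⁻¹ ∈ sIdeles D := fun p _ => by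
    -- The ideal of this quotient is `I * (I * I'⁻¹ * I')⁻¹ = 1`.
    have h3 := hI.mul ((represents_principal α).mul hy).inv
    rw [hα, inv_mul_cancel_right, mul_inv_cancel] at h3
    simpa [FractionalIdeal.count_one] using h3 p
  have h3 := J.mul_mem (Subgroup.mem_sup_right h2)
    (J.mul_mem (Subgroup.mem_sup_left ⟨α, rfl⟩) hyJ)
  rwa [inv_mul_cancel_right] at h3

end ClassGroups

/-! ### Logarithms of `S`-idèles -/

section Logs

variable {F : Type*} [Field F] [NumberField F] {D : LogSetup F}

open LogSetup

theorem exists_circle_exp (z : ℂ) (hz : z ≠ 0) :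
    ∃ θ : ℝ, z / (‖z‖ : ℂ) = Circle.exp (2 * Real.pi * θ) := by
  refine ⟨z.arg / (2 * Real.pi), ?_⟩
  have h : 2 * Real.pi * (z.arg / (2 * Real.pi)) = z.arg := by field_simp
  have hn : (‖z‖ : ℂ) ≠ 0 := by simpa using hz
  rw [h, Circle.coe_exp, div_eq_iff hn, mul_comm]
  exact (Complex.norm_mul_exp_arg_mul_I z).symm

@[simp] theorem atPrime_vec (a : D.S → ℝ) (b c d) : atPrime (vec a b c d : D.G) = a := rfl
@[simp] theorem atRes_vec (a : D.S → ℝ) (b c d) : atRes (vec a b c d : D.G) = b := rfl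
@[simp] theorem atAbs_vec (a : D.S → ℝ) (b c d) : atAbs (vec a b c d : D.G) = c := rfl
@[simp] theorem atArg_vec (a : D.S → ℝ) (b c d) : atArg (vec a b c d : D.G) = d := rfl
@[simp] theorem atPrime_add (v v' : D.G) (p) : atPrime (v + v') p = atPrime v p + atPrime v' p := rfl
@[simp] theorem atRes_add (v v' : D.G) (i) : atRes (v + v') i = atRes v i + atRes v' i := rfl
@[simp] theorem atAbs_add (v v' : D.G) (w) : atAbs (v + v') w = atAbs v w + atAbs v' w := rfl
@[simp] theorem atArg_add (v v' : D.G) (w) : atArg (v + v') w = atArg v w + atArg v' w := rfl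
@[simp] theorem atPrime_neg (v : D.G) (p) : atPrime (-v) p = -atPrime v p := rfl
@[simp] theorem atRes_neg (v : D.G) (i) : atRes (-v) i = -atRes v i := rfl
@[simp] theorem atAbs_neg (v : D.G) (w) : atAbs (-v) w = -atAbs v w := rfl
@[simp] theorem atArg_neg (v : D.G) (w) : atArg (-v) w = -atArg v w := rfl
@[simp] theorem atPrime_zero (p) : atPrime (0 : D.G) p = 0 := rfl
@[simp] theorem atRes_zero (i) : atRes (0 : D.G) i = 0 := rfl
@[simp] theorem atAbs_zero (w) : atAbs (0 : D.G) w = 0 := rfl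
@[simp] theorem atArg_zero (w) : atArg (0 : D.G) w = 0 := rfl

theorem vec_ext {v v' : D.G} (h1 : ∀ p, atPrime v p = atPrime v' p)
    (h2 : ∀ i, atRes v i = atRes v' i) (h3 : ∀ w, atAbs v w = atAbs v' w)
    (h4 : ∀ w, atArg v w = atArg v' w) : v = v' := by
  funext j
  rcases j with (p | i) | (w | w)
  exacts [h1 p, h2 i, h3 w, h4 w]

theorem dotProduct_eq (v v' : D.G) : v ⬝ᵥ v' =
    (∑ p, atPrime v p * atPrime v' p + ∑ i, atRes v i * atRes v' i) +
      (∑ w, atAbs v w * atAbs v' w + ∑ w, atArg v w * atArg v' w) := by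
  rw [dotProduct, Fintype.sum_sum_type, Fintype.sum_sum_type, Fintype.sum_sum_type]
  rfl

theorem valued_mul_zpow_uniformizer {x : Idele F} {e : HeightOneSpectrum (𝓞 F) → ℤ}
    (he : ∀ p, Valued.v (finComp x p) = WithZero.exp (-(e p))) (p) :
    Valued.v (finComp x p * ((D.π p ^ (-(e p)) : (p.adicCompletion F)ˣ) : p.adicCompletion F)) =
      1 := by
  rw [map_mul, he, Units.val_zpow_eq_zpow_val, map_zpow₀, D.uniformizer, ← WithZero.exp_zsmul,
    ← WithZero.exp_add]
  simp

theorem exists_isLog {x : Idele F} (hx : x ∈ sIdeles D) : ∃ v, D.IsLog x v := by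
  choose θ hθ using fun w => exists_circle_exp (infComp x w) (infComp_ne_zero x w)
  let e : HeightOneSpectrum (𝓞 F) → ℤ := fun p => -WithZero.log (Valued.v (finComp x p))
  have he : ∀ p, Valued.v (finComp x p) = WithZero.exp (-(e p)) := fun p => by
    simp only [e, neg_neg]
    rw [WithZero.exp_log]
    simpa using finComp_ne_zero x p
  obtain ⟨b, hb⟩ := exists_isResidue D.m_ne_bot _ (valued_mul_zpow_uniformizer (D := D) he)
  obtain ⟨t, ht⟩ := QuotientAddGroup.mk_surjective (D.logm (Additive.ofMul b))
  exact ⟨vec (fun p => e p) (fun i => t i)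
    (fun w => (w.mult : ℝ) / (2 * Real.pi) * Real.log ‖infComp x w‖) θ, e, b, t, he,
    fun p hp => by simp [e, hx p hp], hb, ht.symm, fun _ => rfl, fun _ => rfl, fun _ => rfl, hθ⟩

theorem LogSetup.IsLog.mem_sIdeles {x : Idele F} {v : D.G} (h : D.IsLog x v) : x ∈ sIdeles D := by
  obtain ⟨e, b, t, he, he0, -⟩ := h
  intro p hp
  simp [he, he0 p hp]

theorem LogSetup.IsLog.mul {x y : Idele F} {v v' : D.G} (h : D.IsLog x v) (h' : D.IsLog y v') :
    D.IsLog (x * y) (v + v') := by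
  obtain ⟨e, b, t, he, he0, hb, ht, h1, h2, h3, h4⟩ := h
  obtain ⟨e', b', t', he', he0', hb', ht', h1', h2', h3', h4'⟩ := h'
  refine ⟨e + e', b * b', t + t', fun p => ?_, fun p hp => ?_, ?_, ?_, fun p => ?_, fun i => ?_,
    fun w => ?_, fun w => ?_⟩
  · rw [finComp_mul, map_mul, he, he', ← WithZero.exp_add, Pi.add_apply]
    congr 1; ring
  · simp [he0 p hp, he0' p hp]
  · convert hb.mul hb' fun p => (valued_mul_zpow_uniformizer he p).le using 2 with p
    rw [finComp_mul, Pi.add_apply, neg_add, zpow_add, Units.val_mul]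
    ring
  · rw [ofMul_mul, map_add, ht, ht']; rfl
  · simp [h1, h1']
  · simp [h2, h2']
  · rw [atAbs_add, h3, h3', infComp_mul, norm_mul, Real.log_mul (by simp [infComp_ne_zero])
      (by simp [infComp_ne_zero])]
    ring
  · rw [atArg_add, infComp_mul, norm_mul, mul_add, Circle.exp_add, Circle.coe_mul, ← h4, ← h4']
    push_cast
    rw [mul_div_mul_comm]

theorem LogSetup.IsLog.inv {x : Idele F} {v : D.G} (h : D.IsLog x v) : D.IsLog x⁻¹ (-v) := by
  obtain ⟨e, b, t, he, he0, hb, ht, h1, h2, h3, h4⟩ := h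
  refine ⟨-e, b⁻¹, -t, fun p => ?_, fun p hp => ?_, ?_, ?_, fun p => ?_, fun i => ?_,
    fun w => ?_, fun w => ?_⟩
  · rw [finComp_inv, map_inv₀, he, ← WithZero.exp_neg, Pi.neg_apply]
  · simp [he0 p hp]
  · convert hb.inv D.m_ne_bot fun p => valued_mul_zpow_uniformizer he p using 2 with p
    rw [finComp_inv, Pi.neg_apply, mul_inv, ← Units.val_inv_eq_inv_val, zpow_neg, zpow_neg]
  · rw [ofMul_inv, map_neg, ht]; rfl
  · simp [h1]
  · simp [h2]
  · rw [atAbs_neg, h3, infComp_inv, norm_inv, Real.log_inv]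
    ring
  · rw [atArg_neg, infComp_inv, norm_inv, mul_neg, Circle.exp_neg, Circle.coe_inv, ← h4]
    push_cast
    rw [inv_div_inv, inv_div]

theorem circle_exp_two_pi_eq_one_iff (a : ℝ) :
    Circle.exp (2 * Real.pi * a) = 1 ↔ ∃ n : ℤ, a = n := by
  rw [Circle.exp_eq_one]
  refine exists_congr fun n => ?_
  rw [mul_comm (n : ℝ), mul_right_inj' Real.two_pi_pos.ne']

/-- This is the indeterminacy of the logarithm: by `LogSetup.IsLog.sub`, two logarithms of one idèle
differ by a logarithm of 1. The only freedom is the lift of a class modulo `Λ_m` and the integral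
part of each argument. -/
theorem isLog_one_iff {v : D.G} : D.IsLog 1 v ↔ ∃ t ∈ D.Λm, ∃ a : InfinitePlace F → ℤ,
    v = vec 0 (fun i => (t i : ℝ)) 0 (fun w => (a w : ℝ)) := by
  constructor
  · rintro ⟨e, b, t, he, he0, hb, ht, h1, h2, h3, h4⟩
    have he' : ∀ p, e p = 0 := fun p => by
      have h := he p
      rw [finComp_one, map_one, ← WithZero.exp_zero, WithZero.exp_inj] at h
      omega
    have hb1 : b = 1 := by
      refine hb.unique D.m_ne_bot ?_
      convert isResidue_one (F := F) (m := D.m) using 2 with p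
      simp [he']
    rw [hb1, ofMul_one, map_zero, eq_comm, QuotientAddGroup.eq_zero_iff] at ht
    choose a ha using fun w => (circle_exp_two_pi_eq_one_iff (atArg v w)).1
      (Circle.ext (by rw [← h4]; simp))
    exact ⟨t, ht, a, vec_ext (fun p => by simp [h1, he']) h2 (fun w => by simp [h3]) ha⟩
  · rintro ⟨t, ht, a, rfl⟩
    refine ⟨0, 1, t, by simp, by simp, by simpa using isResidue_one, ?_, by simp, by simp, by simp,
      fun w => ?_⟩
    · rw [ofMul_one, map_zero, eq_comm, QuotientAddGroup.eq_zero_iff]; exact ht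
    · have := (circle_exp_two_pi_eq_one_iff (a w : ℝ)).2 ⟨a w, rfl⟩
      simp [this]

theorem LogSetup.IsLog.sub {x : Idele F} {v v' : D.G} (h : D.IsLog x v) (h' : D.IsLog x v') :
    D.IsLog 1 (v - v') := by simpa [sub_eq_add_neg] using h.mul h'.inv

end Logs

end HeckeAlg

end

noncomputable section

namespace HeckeAlg

/-! ### Reduction modulo `m` as a group homomorphism -/

section ResidueHom

variable {F : Type*} [Field F] [NumberField F]

/-- The group of idèles that are units at the finite primes and `1` at the archimedean places. -/
def finiteUnits (F : Type*) [Field F] [NumberField F] : Subgroup (Idele F) where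
  carrier := {x | IsFiniteUnit x}
  mul_mem' := IsFiniteUnit.mul
  one_mem' := isFiniteUnit_one
  inv_mem' := IsFiniteUnit.inv

/-- Reduction modulo `m` of finite unit idèles. -/
def residueHom (m : Ideal (𝓞 F)) (hm : m ≠ ⊥) : finiteUnits F →* (𝓞 F ⧸ m)ˣ :=
  MonoidHom.mk' (fun x => (exists_isResidue hm (finComp x.1) x.2.1).choose) fun x y =>
    ((exists_isResidue hm (finComp (x * y).1) (x * y).2.1).choose_spec.unique hm
      ((exists_isResidue hm (finComp x.1) x.2.1).choose_spec.mul
        (exists_isResidue hm (finComp y.1) y.2.1).choose_spec fun p => (x.2.1 p).le))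

theorem residueHom_eq_iff {m : Ideal (𝓞 F)} (hm : m ≠ ⊥) (x : finiteUnits F) (b : (𝓞 F ⧸ m)ˣ) :
    residueHom m hm x = b ↔ IsResidue m (finComp x.1) b :=
  ⟨fun h => h ▸ (exists_isResidue hm (finComp x.1) x.2.1).choose_spec,
    fun h => (exists_isResidue hm (finComp x.1) x.2.1).choose_spec.unique hm h⟩

theorem isOneMod_iff {m : Ideal (𝓞 F)} (hm : m ≠ ⊥) (x : finiteUnits F) :
    IsOneMod m x.1 ↔ residueHom m hm x = 1 := by
  rw [residueHom_eq_iff]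
  exact ⟨fun h => h.2, fun h => ⟨x.2, h⟩⟩

end ResidueHom

/-! ### The pairing formula for the value of a character -/

section Pairing

variable {F : Type*} [Field F] [NumberField F] {D : LogSetup F}

open LogSetup

theorem circle_exp_two_pi_add (a b : ℝ) : Circle.exp (2 * Real.pi * (a + b)) =
    Circle.exp (2 * Real.pi * a) * Circle.exp (2 * Real.pi * b) := by
  rw [mul_add, Circle.exp_add]

theorem circle_exp_two_pi_sum {ι : Type*} (s : Finset ι) (f : ι → ℝ) :
    Circle.exp (2 * Real.pi * ∑ i ∈ s, f i) = ∏ i ∈ s, Circle.exp (2 * Real.pi * f i) := by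
  classical
  induction s using Finset.induction_on with
  | empty => simp
  | insert i s hi ih => rw [Finset.sum_insert hi, Finset.prod_insert hi, circle_exp_two_pi_add, ih]

theorem circle_exp_two_pi_mul_int (a : ℝ) (n : ℤ) :
    Circle.exp (2 * Real.pi * (a * n)) = Circle.exp (2 * Real.pi * a) ^ n := by
  rw [← Circle.exp_zsmul, zsmul_eq_mul]
  congr 1
  ring

theorem exists_circle_exp_eq (c : Circle) : ∃ θ : ℝ, Circle.exp (2 * Real.pi * θ) = c :=
  ⟨Complex.arg c / (2 * Real.pi), by
    rw [mul_div_cancel₀ _ Real.two_pi_pos.ne', Circle.exp_arg]⟩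

/-- The class in `(𝓞 F / m)^×` of the `i`-th standard basis vector. -/
def resGen (D : LogSetup F) (i : Fin D.r) : (𝓞 F ⧸ D.m)ˣ :=
  (D.logm.symm (QuotientAddGroup.mk (Pi.single i (1 : ℤ)))).toMul

theorem exists_lift_resGen (D : LogSetup F) (i : Fin D.r) :
    ∃ y : finiteUnits F, residueHom D.m D.m_ne_bot y = resGen D i := by
  obtain ⟨y, hy, h⟩ := exists_isFiniteUnit_isResidue D.m_ne_bot (resGen D i)
  exact ⟨⟨y, hy⟩, (residueHom_eq_iff _ _ _).2 h⟩

/-- A finite unit idèle reducing to the class of the `i`-th standard basis vector. -/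
def resLift (D : LogSetup F) (i : Fin D.r) : finiteUnits F := (exists_lift_resGen D i).choose

theorem residueHom_resLift (D : LogSetup F) (i : Fin D.r) :
    residueHom D.m D.m_ne_bot (resLift D i) = resGen D i := (exists_lift_resGen D i).choose_spec

theorem prod_resGen_zpow {b : (𝓞 F ⧸ D.m)ˣ} {t : Fin D.r → ℤ}
    (h : D.logm (Additive.ofMul b) = QuotientAddGroup.mk t) : ∏ i, resGen D i ^ t i = b := by
  apply Additive.ofMul.injective
  apply D.logm.injective
  rw [h, ofMul_prod, map_sum]
  have h1 : ∀ i, D.logm (Additive.ofMul (resGen D i ^ t i)) =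
      QuotientAddGroup.mk' D.Λm (Pi.single i (t i)) := fun i => by
    rw [ofMul_zpow, map_zsmul, resGen, ofMul_toMul, AddEquiv.apply_symm_apply]
    change t i • QuotientAddGroup.mk' D.Λm (Pi.single i 1) = _
    rw [← map_zsmul, ← Pi.single_smul, smul_eq_mul, mul_one]
  rw [Finset.sum_congr rfl fun i _ => h1 i, ← map_sum, Finset.univ_sum_single]
  rfl

/-- The quotient of the two idèles lies in `U(m)`. This makes χ on residue classes well defined. -/
theorem apply_eq_of_residueHom_eq {χ : Idele F →ₜ* Circle} {m : Ideal (𝓞 F)} (hm : m ≠ ⊥)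
    (hχ : ∀ x, IsOneMod m x → χ x = 1) {x y : finiteUnits F}
    (h : residueHom m hm x = residueHom m hm y) : χ x = χ y := by
  have h1 := hχ _ ((isOneMod_iff hm (x * y⁻¹)).2 (by rw [map_mul, map_inv, h, mul_inv_cancel]))
  rw [Subgroup.coe_mul, map_mul, Subgroup.coe_inv, map_inv] at h1
  exact mul_inv_eq_one.1 h1

theorem finUnit_finSingle_same (p : HeightOneSpectrum (𝓞 F)) (x : (p.adicCompletion F)ˣ) :
    finUnit p (finSingle p x) = x := Units.ext (finComp_finSingle_same p x)

theorem finUnit_finSingle_of_ne {p q : HeightOneSpectrum (𝓞 F)} (h : q ≠ p)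
    (x : (p.adicCompletion F)ˣ) : finUnit q (finSingle p x) = 1 :=
  Units.ext (finComp_finSingle_of_ne h x)

theorem finUnit_prod_finSingle (e : HeightOneSpectrum (𝓞 F) → ℤ) (he : ∀ p, p ∉ D.S → e p = 0)
    (q : HeightOneSpectrum (𝓞 F)) :
    finUnit q (∏ p : D.S, finSingle p.1 (D.π p.1) ^ e p.1) = D.π q ^ e q := by
  rw [map_prod]
  by_cases hq : q ∈ D.S
  · rw [Finset.prod_eq_single (⟨q, hq⟩ : D.S), map_zpow, finUnit_finSingle_same]
    · intro p _ hp
      rw [map_zpow, finUnit_finSingle_of_ne (fun h => hp (Subtype.ext h.symm)), one_zpow]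
    · simp
  · rw [he q hq, zpow_zero]
    refine Finset.prod_eq_one fun p _ => ?_
    rw [map_zpow, finUnit_finSingle_of_ne (by rintro rfl; exact hq p.2), one_zpow]

theorem infUnit_prod_infSingle (x : Idele F) (w : InfinitePlace F) :
    infUnit w (∏ w', infSingle w' (infUnit w' x)) = infUnit w x := by
  rw [map_prod, Finset.prod_eq_single w, infUnit_infSingle_same]
  · exact fun w' _ h => infUnit_infSingle_of_ne h.symm _
  · simp

/-- The value of a character of modulus `m` on `U_S` in terms of its local values. -/
theorem apply_eq_prod {χ : Idele F →ₜ* Circle} (hχ : ∀ x, IsOneMod D.m x → χ x = 1)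
    {x : Idele F} {e : HeightOneSpectrum (𝓞 F) → ℤ} {b : (𝓞 F ⧸ D.m)ˣ} {t : Fin D.r → ℤ}
    (he : ∀ p, Valued.v (finComp x p) = WithZero.exp (-(e p))) (he0 : ∀ p, p ∉ D.S → e p = 0)
    (hb : IsResidue D.m (fun p =>
      finComp x p * ((D.π p ^ (-(e p)) : (p.adicCompletion F)ˣ) : p.adicCompletion F)) b)
    (ht : D.logm (Additive.ofMul b) = QuotientAddGroup.mk t) :
    χ x = (∏ p : D.S, χ (finSingle p.1 (D.π p.1)) ^ e p.1) *
      (∏ i, χ (resLift D i) ^ t i) * ∏ w, χ (infSingle w (infUnit w x)) := by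
  -- `A` carries the uniformizer powers and `B` the archimedean part, so that `x * A⁻¹ * B⁻¹` is a
  -- finite unit with residue `b`.
  set A : Idele F := ∏ p : D.S, finSingle p.1 (D.π p.1) ^ e p.1 with hA
  set B : Idele F := ∏ w, infSingle w (infUnit w x) with hB
  have hAinf : ∀ w, infComp A w = 1 := fun w => by
    have : infUnit w A = 1 := by
      rw [hA, map_prod]
      refine Finset.prod_eq_one fun p _ => ?_
      rw [map_zpow, (Units.ext rfl : infUnit w (finSingle p.1 (D.π p.1)) = 1), one_zpow]
    rw [infComp_eq, this, Units.val_one, map_one]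
  have hBfin : ∀ q, finUnit q B = 1 := fun q => by
    rw [hB, map_prod]
    exact Finset.prod_eq_one fun w _ => Units.ext (finComp_infSingle w (infUnit w x) q)
  have hz : ∀ p, finComp (x * A⁻¹ * B⁻¹) p =
      finComp x p * ((D.π p ^ (-(e p)) : (p.adicCompletion F)ˣ) : p.adicCompletion F) := fun p => by
    rw [← coe_finUnit, map_mul, map_mul, map_inv, map_inv, hBfin, finUnit_prod_finSingle e he0,
      inv_one, mul_one, ← zpow_neg]
    rfl
  have hzf : IsFiniteUnit (x * A⁻¹ * B⁻¹) := by
    refine ⟨fun p => by rw [hz, valued_mul_zpow_uniformizer he], fun w => ?_⟩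
    have hBw : infComp B w = infComp x w := by
      rw [infComp_eq, infUnit_prod_infSingle, infComp_eq]
    simp [hAinf, hBw, infComp_ne_zero]
  have hres : residueHom D.m D.m_ne_bot ⟨_, hzf⟩ =
      residueHom D.m D.m_ne_bot (∏ i, resLift D i ^ t i) := by
    rw [map_prod]
    simp_rw [map_zpow, residueHom_resLift]
    rw [prod_resGen_zpow ht, residueHom_eq_iff]
    convert hb using 2 with p
    exact hz p
  have h1 := apply_eq_of_residueHom_eq D.m_ne_bot hχ hres
  have h2 : x = A * (x * A⁻¹ * B⁻¹) * B := by
    rw [mul_comm x A⁻¹, ← mul_assoc, ← mul_assoc, mul_inv_cancel, one_mul, inv_mul_cancel_right]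
  conv_lhs => rw [h2]
  rw [map_mul, map_mul]
  congr 1
  · congr 1
    · rw [hA, map_prod]; simp_rw [map_zpow]
    · refine h1.trans ?_
      rw [Subgroup.val_finsetProd, map_prod]
      refine Finset.prod_congr rfl fun i _ => ?_
      rw [Subgroup.coe_zpow, map_zpow]
  · rw [hB, map_prod]

/-- The factor `n_w / (2π)` in the modulus coordinate is what makes 2π times its product with φ the
exponent `n_w φ log|x|` of the local character. -/
theorem HasLocalParam.apply_eq {χ : Idele F →ₜ* Circle} {w : InfinitePlace F} {k : ℤ} {φ : ℝ}
    (h : HasLocalParam χ w k φ) {x : Idele F} {θ : ℝ}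
    (hθ : infComp x w / (‖infComp x w‖ : ℂ) = Circle.exp (2 * Real.pi * θ)) :
    χ (infSingle w (infUnit w x)) = Circle.exp (2 * Real.pi *
      (φ * ((w.mult : ℝ) / (2 * Real.pi) * Real.log ‖infComp x w‖) + k * θ)) := by
  apply Circle.ext
  have h1 := h (infUnit w x)
  rw [← infComp_eq, hθ] at h1
  have hpos : 0 < ‖infComp x w‖ := norm_pos_iff.2 (infComp_ne_zero x w)
  rw [h1, circle_exp_two_pi_add, mul_comm (k : ℝ), circle_exp_two_pi_mul_int, Circle.coe_mul,
    Circle.coe_zpow, mul_comm]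
  congr 1
  rw [Circle.coe_exp, Complex.cpow_def_of_ne_zero (by exact_mod_cast hpos.ne'),
    ← Complex.ofReal_log hpos.le]
  congr 1
  have hpi : (Real.pi : ℂ) ≠ 0 := by exact_mod_cast Real.pi_ne_zero
  push_cast
  field_simp

/-- The pairing between dual logarithms of characters and logarithms of idèles. -/
theorem LogSetup.IsDualLog.apply_eq {χ : Idele F →ₜ* Circle} {v y : D.G} {x : Idele F}
    (hχ : ∀ x, IsOneMod D.m x → χ x = 1) (hv : D.IsDualLog χ v) (hy : D.IsLog x y) :
    χ x = Circle.exp (2 * Real.pi * (v ⬝ᵥ y)) := by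
  obtain ⟨e, b, t, he, he0, hb, ht, h1, h2, h3, h4⟩ := hy
  obtain ⟨g1, g2, g3⟩ := hv
  rw [apply_eq_prod hχ he he0 hb ht, dotProduct_eq, circle_exp_two_pi_add, circle_exp_two_pi_add,
    circle_exp_two_pi_sum, circle_exp_two_pi_sum, ← Finset.sum_add_distrib, circle_exp_two_pi_sum]
  congr 1
  · congr 1
    · refine Finset.prod_congr rfl fun p _ => ?_
      rw [g1, h1, circle_exp_two_pi_mul_int]
    · refine Finset.prod_congr rfl fun i _ => ?_
      rw [g2 i (resLift D i) (resLift D i).2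
        ((residueHom_eq_iff D.m_ne_bot _ _).1 (residueHom_resLift D i)), h2,
        circle_exp_two_pi_mul_int]
  · refine Finset.prod_congr rfl fun w _ => ?_
    obtain ⟨k, hk, hloc⟩ := g3 w
    rw [hloc.apply_eq (h4 w), hk, h3]

end Pairing

end HeckeAlg

end

noncomputable section

namespace HeckeAlg

/-! ### The group `Λ₀`, and uniqueness of local parameters -/

section LogLattice

variable {F : Type*} [Field F] [NumberField F] {D : LogSetup F}

open LogSetup

theorem LogSetup.IsLog.mem_sUnitLogs {α : Fˣ} {y : D.G} (h : D.IsLog (principal α) y) :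
    y ∈ D.sUnitLogs :=
  ⟨α, fun p hp => by
    rw [← valued_finComp_principal]
    exact h.mem_sIdeles p (by simpa using hp), h⟩

/-- Both `Λ_m` and `ℤ^{r₂}` consist of logarithms of 1, and logarithms add, so every element is one
logarithm of a principal idèle plus a multiple of `v₀`. -/
theorem mem_Λ₀_iff {y : D.G} :
    y ∈ D.Λ₀ ↔ ∃ (α : Fˣ) (j : ℤ), D.IsLog (principal α) (y - j • D.v0) := by
  constructor
  · intro hy
    induction hy using AddSubgroup.closure_induction with
    | mem y hy =>
      rcases hy with ((⟨α, -, h⟩ | ⟨t, ht, rfl⟩) | ⟨a, rfl⟩) | rfl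
      · exact ⟨α, 0, by simpa using h⟩
      · exact ⟨1, 0, by
          rw [map_one, isLog_one_iff]
          exact ⟨t, ht, 0, vec_ext (by simp) (by simp) (by simp) (by simp)⟩⟩
      · exact ⟨1, 0, by
          rw [map_one, isLog_one_iff]
          exact ⟨0, zero_mem _, a, vec_ext (by simp) (by simp) (by simp) (by simp)⟩⟩
      · exact ⟨1, 1, by
          rw [map_one, isLog_one_iff]
          exact ⟨0, zero_mem _, 0, vec_ext (by simp) (by simp) (by simp) (by simp)⟩⟩
    | zero =>
      exact ⟨1, 0, by
        rw [map_one, isLog_one_iff]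
        exact ⟨0, zero_mem _, 0, vec_ext (by simp) (by simp) (by simp) (by simp)⟩⟩
    | add y y' _ _ ih ih' =>
      obtain ⟨α, j, h⟩ := ih
      obtain ⟨α', j', h'⟩ := ih'
      refine ⟨α * α', j + j', ?_⟩
      rw [map_mul]
      convert h.mul h' using 1
      rw [add_smul]; abel
    | neg y _ ih =>
      obtain ⟨α, j, h⟩ := ih
      refine ⟨α⁻¹, -j, ?_⟩
      rw [map_inv]
      convert h.inv using 1
      rw [neg_smul]; abel
  · rintro ⟨α, j, h⟩
    have h1 : y - j • D.v0 ∈ D.Λ₀ :=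
      AddSubgroup.subset_closure (Or.inl (Or.inl (Or.inl h.mem_sUnitLogs)))
    have h2 : D.v0 ∈ D.Λ₀ := AddSubgroup.subset_closure (Or.inr rfl)
    simpa using add_mem h1 (zsmul_mem h2 j)

theorem IsLog.mem_Λ₀ {α : Fˣ} {y : D.G} (h : D.IsLog (principal α) y) : y ∈ D.Λ₀ :=
  mem_Λ₀_iff.2 ⟨α, 0, by simpa using h⟩

theorem dotProduct_v0_eq_zero {v : D.G} (hv : ∀ w, atAbs v w = 0) : v ⬝ᵥ D.v0 = 0 := by
  rw [dotProduct_eq]; simp [hv, v0]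

/-- Vectors with zero modulus coordinates are orthogonal to `v₀`, so only logarithms of principal
idèles need testing. -/
theorem mem_dualΛ₀_of_isLog {v : D.G} (hv : ∀ w, atAbs v w = 0)
    (h : ∀ (α : Fˣ) (y : D.G), D.IsLog (principal α) y → ∃ n : ℤ, v ⬝ᵥ y = n) :
    v ∈ D.dualΛ₀ := fun y hy => by
  obtain ⟨α, j, hα⟩ := mem_Λ₀_iff.1 hy
  obtain ⟨n, hn⟩ := h α _ hα
  refine ⟨n, ?_⟩
  rw [← hn, dotProduct_sub, dotProduct_smul, dotProduct_v0_eq_zero hv]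
  simp

theorem LogSetup.IsDualLog.mem_dualΛ₀ {χ : Idele F →ₜ* Circle} (hχ : χ ∈ heckeCharsMod D.m)
    {v : D.G} (h : D.IsDualLog χ v) (hv : ∀ w, atAbs v w = 0) : v ∈ D.dualΛ₀ :=
  mem_dualΛ₀_of_isLog hv fun α y hy => by
    have h1 := h.apply_eq hχ.2 hy
    rw [hχ.1 α] at h1
    exact (circle_exp_two_pi_eq_one_iff _).1 h1.symm

theorem circle_exp_two_pi_eq_iff (a b : ℝ) :
    Circle.exp (2 * Real.pi * a) = Circle.exp (2 * Real.pi * b) ↔ ∃ n : ℤ, a - b = n := by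
  rw [← circle_exp_two_pi_eq_one_iff, mul_sub, Circle.exp_sub, div_eq_one]

theorem exists_circle_exp_mul_ne_one {a : ℝ} (ha : a ≠ 0) :
    ∃ s : ℝ, Circle.exp (2 * Real.pi * (a * s)) ≠ 1 := by
  -- This choice makes the value exp(πi) = -1.
  refine ⟨1 / (2 * a), ?_⟩
  rw [Ne, circle_exp_two_pi_eq_one_iff]
  rintro ⟨n, hn⟩
  have h2 : (1 : ℝ) = ((2 * n : ℤ) : ℝ) := by
    push_cast; rw [← hn]; field_simp
  have : (1 : ℤ) = 2 * n := by exact_mod_cast h2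
  omega

theorem exists_infComp_eq [IsTotallyComplex F] (w : InfinitePlace F) {z : ℂ} (hz : z ≠ 0) :
    ∃ x : Idele F, infComp x w = z := by
  obtain ⟨x, hx⟩ := InfinitePlace.Completion.surjective_extensionEmbedding_of_isComplex
    (IsTotallyComplex.isComplex w) z
  have hx0 : x ≠ 0 := by rintro rfl; exact hz (by rw [← hx, map_zero])
  refine ⟨infSingle w (Units.mk0 x hx0), ?_⟩
  rw [infComp_eq, infUnit_infSingle_same, Units.val_mk0, hx]

/-- At a complex place, log-modulus `r` and argument θ vary independently over ℝ: `r = 0` isolates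
`k` and `θ = 0` isolates φ. A real place would see only the parity of `k`. -/
theorem HasLocalParam.unique [IsTotallyComplex F] {χ : Idele F →ₜ* Circle} {w : InfinitePlace F}
    {k k' : ℤ} {φ φ' : ℝ} (h : HasLocalParam χ w k φ) (h' : HasLocalParam χ w k' φ') :
    k = k' ∧ φ = φ' := by
  have key : ∀ (r θ : ℝ), Circle.exp (2 * Real.pi *
      (φ * ((w.mult : ℝ) / (2 * Real.pi) * r) + k * θ)) = Circle.exp (2 * Real.pi *
      (φ' * ((w.mult : ℝ) / (2 * Real.pi) * r) + k' * θ)) := fun r θ => by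
    have hne : (Real.exp r : ℂ) * Circle.exp (2 * Real.pi * θ) ≠ 0 :=
      mul_ne_zero (by exact_mod_cast (Real.exp_pos r).ne') (Circle.coe_ne_zero _)
    obtain ⟨x, hx⟩ := exists_infComp_eq w hne
    have hn : ‖infComp x w‖ = Real.exp r := by
      rw [hx, norm_mul, Circle.norm_coe, mul_one, Complex.norm_real, Real.norm_eq_abs,
        abs_of_pos (Real.exp_pos r)]
    have hθ : infComp x w / (‖infComp x w‖ : ℂ) = Circle.exp (2 * Real.pi * θ) := by
      rw [hn, hx, mul_div_cancel_left₀]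
      exact_mod_cast (Real.exp_pos r).ne'
    have h1 := h.apply_eq hθ
    have h2 := h'.apply_eq hθ
    rw [hn, Real.log_exp] at h1 h2
    exact h1.symm.trans h2
  constructor
  · by_contra hne
    obtain ⟨s, hs⟩ := exists_circle_exp_mul_ne_one
      (a := (k : ℝ) - k') (sub_ne_zero.2 (by exact_mod_cast hne))
    have := key 0 s
    simp only [mul_zero, zero_add] at this
    rw [circle_exp_two_pi_eq_iff, ← sub_mul, ← circle_exp_two_pi_eq_one_iff] at this
    exact hs this
  · by_contra hne
    have hmult : (w.mult : ℝ) / (2 * Real.pi) ≠ 0 :=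
      div_ne_zero (by exact_mod_cast w.mult_ne_zero) Real.two_pi_pos.ne'
    obtain ⟨s, hs⟩ := exists_circle_exp_mul_ne_one
      (a := (φ - φ') * ((w.mult : ℝ) / (2 * Real.pi))) (mul_ne_zero (sub_ne_zero.2 hne) hmult)
    have := key s 0
    simp only [mul_zero, add_zero] at this
    rw [circle_exp_two_pi_eq_iff, ← sub_mul, ← mul_assoc, ← circle_exp_two_pi_eq_one_iff] at this
    exact hs this

end LogLattice

/-! ### Dual logarithms of characters, and logarithms of test idèles -/

section DualLogs

variable {F : Type*} [Field F] [NumberField F] {D : LogSetup F}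

open LogSetup

theorem LogSetup.IsDualLog.mul {χ χ' : Idele F →ₜ* Circle} {v v' : D.G} (h : D.IsDualLog χ v)
    (h' : D.IsDualLog χ' v') (hv : ∀ w, atAbs v w = 0) (hv' : ∀ w, atAbs v' w = 0) :
    D.IsDualLog (χ * χ') (v + v') := by
  refine ⟨fun p => ?_, fun i y hy hres => ?_, fun w => ?_⟩
  · rw [atPrime_add, circle_exp_two_pi_add, ← h.1, ← h'.1]; rfl
  · rw [atRes_add, circle_exp_two_pi_add, ← h.2.1 i y hy hres, ← h'.2.1 i y hy hres]; rfl
  · obtain ⟨k, hk, hl⟩ := h.2.2 w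
    obtain ⟨k', hk', hl'⟩ := h'.2.2 w
    refine ⟨k + k', by simp [hk, hk'], fun x => ?_⟩
    change ((χ _ * χ' _ : Circle) : ℂ) = _
    have hx : (InfinitePlace.Completion.extensionEmbedding w (x : w.Completion)) ≠ 0 := by simp
    rw [Circle.coe_mul, hl x, hl' x, zpow_add₀ (div_ne_zero hx (by simp)), atAbs_add, hv, hv']
    simp

theorem isDualLog_one_of_mem {v : D.G} (hv : v ∈ D.intℓ) : D.IsDualLog 1 v := by
  have key : ∀ a : ℝ, (∃ z : ℤ, a = z) → (1 : Circle) = Circle.exp (2 * Real.pi * a) :=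
    fun a ha => ((circle_exp_two_pi_eq_one_iff a).2 ha).symm
  refine ⟨fun p => key _ (hv.1 (Sum.inl p)), fun i y _ _ => key _ (hv.1 (Sum.inr i)),
    fun w => ⟨0, ?_, fun x => ?_⟩⟩
  · rw [Int.cast_zero]; exact hv.2 (Sum.inr w)
  · have : atAbs v w = 0 := hv.2 (Sum.inl w)
    rw [this]
    simp

theorem LogSetup.IsDualLog.mem_intℓ [IsTotallyComplex F] {v : D.G} (h : D.IsDualLog 1 v) :
    v ∈ D.intℓ := by
  have hloc : ∀ w, atArg v w = 0 ∧ atAbs v w = 0 := fun w => by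
    obtain ⟨k, hk, hl⟩ := h.2.2 w
    have h1 : HasLocalParam (1 : Idele F →ₜ* Circle) w 0 0 := fun x => by simp
    obtain ⟨rfl, h2⟩ := hl.unique h1
    exact ⟨by simpa using hk, h2⟩
  refine ⟨?_, ?_⟩
  · rintro (p | i)
    · exact (circle_exp_two_pi_eq_one_iff _).1 (h.1 p).symm
    · exact (circle_exp_two_pi_eq_one_iff _).1 (h.2.1 i _ (resLift D i).2
        ((residueHom_eq_iff D.m_ne_bot _ _).1 (residueHom_resLift D i))).symm
  · rintro (w | w)
    exacts [(hloc w).2, (hloc w).1]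

theorem exists_isDualLog {χ : Idele F →ₜ* Circle} (hχ : χ ∈ almostAlgebraic D.m) :
    ∃ v, D.IsDualLog χ v ∧ ∀ w, atAbs v w = 0 := by
  choose k hk using hχ.2
  choose θ hθ using fun p : D.S => exists_circle_exp_eq (χ (finSingle p.1 (D.π p.1)))
  choose η hη using fun i => exists_circle_exp_eq (χ (resLift D i))
  refine ⟨vec θ η 0 (fun w => k w), ⟨fun p => (hθ p).symm, fun i y hy hres => ?_,
    fun w => ⟨k w, rfl, hk w⟩⟩, fun _ => rfl⟩
  rw [atRes_vec, hη]
  refine apply_eq_of_residueHom_eq D.m_ne_bot hχ.1.2 (x := ⟨y, hy⟩) ?_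
  rw [residueHom_resLift, residueHom_eq_iff]
  exact hres

theorem atAbs_eq_zero_of_mem [IsTotallyComplex F] {χ : Idele F →ₜ* Circle}
    (hχ : χ ∈ almostAlgebraic D.m) {v : D.G} (h : D.IsDualLog χ v) (w) : atAbs v w = 0 := by
  obtain ⟨k, -, hl⟩ := h.2.2 w
  obtain ⟨k', hl'⟩ := hχ.2 w
  exact (hl.unique hl').2

/-- A principal idèle changes neither value and moves `x` into the `S`-idèles, where the pairing
formula decides. -/
theorem LogSetup.IsDualLog.eq {χ χ' : Idele F →ₜ* Circle} (hχ : χ ∈ heckeCharsMod D.m)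
    (hχ' : χ' ∈ heckeCharsMod D.m) {v : D.G} (h : D.IsDualLog χ v) (h' : D.IsDualLog χ' v) :
    χ = χ' := by
  ext x
  obtain ⟨α, hα⟩ := exists_principal_mul_mem_sIdeles D x
  obtain ⟨y, hy⟩ := exists_isLog hα
  have h1 := (h.apply_eq hχ.2 hy).trans (h'.apply_eq hχ'.2 hy).symm
  rw [map_mul, map_mul, hχ.1, hχ'.1, one_mul, one_mul] at h1
  rw [h1]

/-- The logarithm of an idèle that is `1` at the finite primes. -/
theorem isLog_of_finComp_eq_one {x : Idele F} {v : D.G} (hx : ∀ p, finComp x p = 1)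
    (h1 : ∀ p, atPrime v p = 0) (h2 : ∀ i, atRes v i = 0)
    (h3 : ∀ w, atAbs v w = (w.mult : ℝ) / (2 * Real.pi) * Real.log ‖infComp x w‖)
    (h4 : ∀ w, infComp x w / (‖infComp x w‖ : ℂ) = Circle.exp (2 * Real.pi * atArg v w)) :
    D.IsLog x v :=
  ⟨0, 1, 0, by simp [hx], by simp, by simpa [hx] using isResidue_one, by simp, by simpa using h1,
    by simpa using h2, h3, h4⟩

theorem isLog_of_near_one {x : Idele F} {v : D.G} (hx : ∀ p, Valued.v (finComp x p) = 1)
    (hx' : ∀ p, Valued.v (finComp x p - 1) ≤ WithZero.exp (-(ordAt p D.m : ℤ)))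
    (h1 : ∀ p, atPrime v p = 0) (h2 : ∀ i, atRes v i = 0)
    (h3 : ∀ w, atAbs v w = (w.mult : ℝ) / (2 * Real.pi) * Real.log ‖infComp x w‖)
    (h4 : ∀ w, infComp x w / (‖infComp x w‖ : ℂ) = Circle.exp (2 * Real.pi * atArg v w)) :
    D.IsLog x v :=
  ⟨0, 1, 0, by simp [hx], by simp, ⟨1, by simp, fun p => by
    rw [coe_one_adic]; simpa using hx' p⟩, by simp, by simpa using h1,
    by simpa using h2, h3, h4⟩

open Classical in
theorem isLog_finSingle (p : D.S) :
    D.IsLog (finSingle p.1 (D.π p.1)) (vec (Pi.single p 1) 0 0 0) := by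
  classical
  refine ⟨Pi.single p.1 1, 1, 0, fun q => ?_, fun q hq => ?_, ?_, by simp, fun q => ?_, by simp,
    by simp, by simp⟩
  · by_cases h : q = p.1
    · subst h; rw [finComp_finSingle_same, D.uniformizer, Pi.single_eq_same]
    · rw [finComp_finSingle_of_ne h, Pi.single_eq_of_ne h]; simp
  · exact Pi.single_eq_of_ne (by rintro rfl; exact hq p.2) _
  · convert isResidue_one (F := F) (m := D.m) using 2 with q
    by_cases h : q = p.1
    · subst h; rw [finComp_finSingle_same, Pi.single_eq_same]; simp
    · rw [finComp_finSingle_of_ne h, Pi.single_eq_of_ne h]; simp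
  · rw [atPrime_vec]
    by_cases h : q = p
    · subst h; simp
    · rw [Pi.single_eq_of_ne h, Pi.single_eq_of_ne (fun h' => h (Subtype.ext h'))]; simp

theorem isLog_of_isResidue {x : Idele F} (hx : IsFiniteUnit x) {b : (𝓞 F ⧸ D.m)ˣ}
    (hb : IsResidue D.m (finComp x) b) {t : Fin D.r → ℤ}
    (ht : D.logm (Additive.ofMul b) = QuotientAddGroup.mk t) :
    D.IsLog x (vec 0 (fun i => t i) 0 0) :=
  ⟨0, b, t, by simp [hx.1], by simp, by simpa using hb, ht, by simp, by simp, by simp [hx.2],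
    by simp [hx.2]⟩

end DualLogs

/-! ### The character attached to a vector of `Λ₀^⊥` -/

section Construction

variable {F : Type*} [Field F] [NumberField F] {D : LogSetup F}

open LogSetup

theorem exists_principal_mul_isLog (D : LogSetup F) (x : Idele F) :
    ∃ y : D.G, ∃ α : Fˣ, D.IsLog (principal α * x) y := by
  obtain ⟨α, hα⟩ := exists_principal_mul_mem_sIdeles D x
  exact (exists_isLog hα).imp fun y hy => ⟨α, hy⟩

/-- Well-definedness of the character: two choices differ by the logarithm of a principal idèle,
which lies in `Λ₀`. -/
theorem circle_exp_dotProduct_eq {v : D.G} (hv : v ∈ D.dualΛ₀) {x : Idele F} {α α' : Fˣ}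
    {y y' : D.G} (h : D.IsLog (principal α * x) y) (h' : D.IsLog (principal α' * x) y') :
    Circle.exp (2 * Real.pi * (v ⬝ᵥ y)) = Circle.exp (2 * Real.pi * (v ⬝ᵥ y')) := by
  have h1 := h.mul h'.inv
  rw [mul_inv, mul_mul_mul_comm, mul_inv_cancel, mul_one, ← map_inv, ← map_mul,
    ← sub_eq_add_neg] at h1
  rw [circle_exp_two_pi_eq_iff, ← dotProduct_sub]
  exact hv _ (IsLog.mem_Λ₀ h1)

/-- The character of the idèle class group with a given dual logarithm, as a homomorphism. -/
def charHom (v : D.G) (hv : v ∈ D.dualΛ₀) : Idele F →* Circle :=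
  MonoidHom.mk' (fun x => Circle.exp (2 * Real.pi * (v ⬝ᵥ (exists_principal_mul_isLog D x).choose)))
    fun x x' => by
      obtain ⟨α, h⟩ := (exists_principal_mul_isLog D x).choose_spec
      obtain ⟨α', h'⟩ := (exists_principal_mul_isLog D x').choose_spec
      obtain ⟨β, h''⟩ := (exists_principal_mul_isLog D (x * x')).choose_spec
      have h1 := h.mul h'
      rw [mul_mul_mul_comm, ← map_mul] at h1
      rw [circle_exp_dotProduct_eq hv h'' h1, dotProduct_add, circle_exp_two_pi_add]

theorem charHom_apply {v : D.G} (hv : v ∈ D.dualΛ₀) {x : Idele F} {α : Fˣ} {y : D.G}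
    (h : D.IsLog (principal α * x) y) : charHom v hv x = Circle.exp (2 * Real.pi * (v ⬝ᵥ y)) := by
  obtain ⟨β, h'⟩ := (exists_principal_mul_isLog D x).choose_spec
  exact circle_exp_dotProduct_eq hv h' h

theorem charHom_apply_of_isLog {v : D.G} (hv : v ∈ D.dualΛ₀) {x : Idele F} {y : D.G}
    (h : D.IsLog x y) : charHom v hv x = Circle.exp (2 * Real.pi * (v ⬝ᵥ y)) :=
  charHom_apply hv (α := 1) (by simpa using h)

/-- Pair with the standard basis vector of `ℤ^{r₂}` at `w`. -/
theorem exists_atArg_eq_int {v : D.G} (hv : v ∈ D.dualΛ₀) (w : InfinitePlace F) :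
    ∃ k : ℤ, atArg v w = k := by
  classical
  obtain ⟨k, hk⟩ := hv (vec 0 0 0 (fun w' => ((Pi.single w 1 : InfinitePlace F → ℤ) w' : ℝ)))
    (AddSubgroup.subset_closure (Or.inl (Or.inr ⟨_, rfl⟩)))
  refine ⟨k, ?_⟩
  rw [dotProduct_eq] at hk
  simpa [Pi.single_apply] using hk

/-- Near 1 an idèle has a logarithm without prime or residue part, so the character is there ∏ (x_w
/ |x_w|)^{k_w} with integral exponents. -/
theorem continuous_charHom {v : D.G} (hv : v ∈ D.dualΛ₀) (h0 : ∀ w, atAbs v w = 0) :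
    Continuous (charHom v hv) := by
  choose k hk using exists_atArg_eq_int hv
  apply continuous_of_continuousAt_one
  have hind : Topology.IsInducing Circle.coeHom := ⟨rfl⟩
  rw [hind.continuousAt_iff]
  have hev : (fun x : Idele F => ∏ w, (infComp x w / (‖infComp x w‖ : ℂ)) ^ k w) =ᶠ[nhds 1]
      Circle.coeHom ∘ charHom v hv := by
    filter_upwards [eventually_isOneMod D.m_ne_bot] with x hx
    choose θ hθ using fun w => exists_circle_exp (infComp x w) (infComp_ne_zero x w)
    have hlog : D.IsLog x (vec 0 0
        (fun w => (w.mult : ℝ) / (2 * Real.pi) * Real.log ‖infComp x w‖) θ) :=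
      isLog_of_near_one hx.1 hx.2 (by simp) (by simp) (by simp) hθ
    rw [Function.comp_apply, charHom_apply_of_isLog hv hlog, dotProduct_eq]
    simp only [h0, atPrime_vec, atRes_vec, Pi.zero_apply, mul_zero, Finset.sum_const_zero, zero_mul,
      add_zero, zero_add, atArg_vec]
    rw [circle_exp_two_pi_sum, map_prod]
    refine Finset.prod_congr rfl fun w _ => ?_
    rw [hk, mul_comm (k w : ℝ), circle_exp_two_pi_mul_int, hθ]
    rfl
  refine ContinuousAt.congr ?_ hev
  refine tendsto_finsetProd _ fun w _ => ?_
  have hc := continuous_infComp (F := F) w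
  refine ContinuousAt.zpow₀ (hc.continuousAt.div
    (Complex.continuous_ofReal.comp hc.norm).continuousAt (by simp)) _
    (Or.inl (div_ne_zero (infComp_ne_zero _ _) (by simp)))

/-- The continuous character with a given dual logarithm. -/
def charOf (v : D.G) (hv : v ∈ D.dualΛ₀) (h0 : ∀ w, atAbs v w = 0) : Idele F →ₜ* Circle :=
  ⟨charHom v hv, continuous_charHom hv h0⟩

theorem isDualLog_charOf {v : D.G} (hv : v ∈ D.dualΛ₀) (h0 : ∀ w, atAbs v w = 0) :
    D.IsDualLog (charOf v hv h0) v := by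
  classical
  refine ⟨fun p => ?_, fun i y hy hres => ?_, fun w => ?_⟩
  · refine (charHom_apply_of_isLog hv (isLog_finSingle p)).trans ?_
    rw [dotProduct_eq]
    simp [Pi.single_apply]
  · refine (charHom_apply_of_isLog hv (isLog_of_isResidue hy hres
      (t := Pi.single i 1) (by simp))).trans ?_
    rw [dotProduct_eq]
    simp [Pi.single_apply]
  · obtain ⟨k, hk⟩ := exists_atArg_eq_int hv w
    refine ⟨k, hk, fun x => ?_⟩
    have hinf : infComp (infSingle w x) w =
        InfinitePlace.Completion.extensionEmbedding w (x : w.Completion) := by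
      rw [infComp_eq, infUnit_infSingle_same]
    obtain ⟨θ, hθ⟩ := exists_circle_exp _ (infComp_ne_zero (infSingle w x) w)
    have hlog : D.IsLog (infSingle w x) (vec 0 0
        (fun w' => (w'.mult : ℝ) / (2 * Real.pi) * Real.log ‖infComp (infSingle w x) w'‖)
        (Pi.single w θ)) := by
      refine isLog_of_finComp_eq_one (by simp) (by simp) (by simp) (by simp) fun w' => ?_
      by_cases h : w' = w
      · subst h; simpa using hθ
      · rw [infComp_eq, infUnit_infSingle_of_ne h]
        simp [Pi.single_eq_of_ne h]
    have h1 := charHom_apply_of_isLog hv hlog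
    rw [dotProduct_eq] at h1
    simp only [h0, atPrime_vec, atRes_vec, Pi.zero_apply, mul_zero, Finset.sum_const_zero, zero_mul,
      add_zero, zero_add, atArg_vec, Pi.single_apply, mul_ite, Finset.sum_ite_eq',
      Finset.mem_univ, if_true] at h1
    change ((charHom v hv (infSingle w x) : Circle) : ℂ) = _
    rw [h1, hk, mul_comm (k : ℝ), circle_exp_two_pi_mul_int, Circle.coe_zpow, ← hθ, hinf, h0]
    simp

theorem charOf_mem {v : D.G} (hv : v ∈ D.dualΛ₀) (h0 : ∀ w, atAbs v w = 0) :
    charOf v hv h0 ∈ almostAlgebraic D.m := by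
  refine ⟨⟨fun α => ?_, fun x hx => ?_⟩, fun w => ?_⟩
  · refine (charHom_apply hv (x := principal α) (α := α⁻¹) (y := 0) ?_).trans (by simp)
    rw [← map_mul, inv_mul_cancel, map_one, isLog_one_iff]
    exact ⟨0, zero_mem _, 0, vec_ext (by simp) (by simp) (by simp) (by simp)⟩
  · refine (charHom_apply_of_isLog hv (y := 0) ?_).trans (by simp)
    have := isLog_of_isResidue (D := D) hx.1 hx.2 (t := 0) (by simp)
    convert this using 1
    exact vec_ext (by simp) (by simp) (by simp) (by simp)
  · obtain ⟨k, -, hl⟩ := (isDualLog_charOf hv h0).2.2 w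
    rw [h0] at hl
    exact ⟨k, hl⟩

/-- The almost-algebraic characters of modulus `m` correspond to the elements of `Λ₀^⊥ ∩ W` modulo
`ℤ^ℓ`, for a group `W` such that the elements of `Λ₀^⊥` with vanishing modulus coordinates lie
in `W`. -/
theorem exists_addEquiv [IsTotallyComplex F] (W : AddSubgroup D.G)
    (hW : ∀ v ∈ W, ∀ w, atAbs v w = 0)
    (hW' : ∀ v ∈ D.dualΛ₀, (∀ w, atAbs v w = 0) → v ∈ W) :
    ∃ e : Additive (almostAlgebraic D.m) ≃+
        (D.dualΛ₀ ⊓ W : AddSubgroup D.G) ⧸ D.intℓ.addSubgroupOf (D.dualΛ₀ ⊓ W),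
      ∀ (χ : almostAlgebraic D.m) (v : (D.dualΛ₀ ⊓ W : AddSubgroup D.G)),
        e (Additive.ofMul χ) = QuotientAddGroup.mk v ↔ D.IsDualLog χ v := by
  have h0 : ∀ v : (D.dualΛ₀ ⊓ W : AddSubgroup D.G), ∀ w, atAbs v.1 w = 0 :=
    fun v => hW v v.2.2
  -- The isomorphism is built backwards, from vectors to characters, where no choice modulo `ℤ^ℓ`
  -- arises; `ℤ^ℓ` then appears as the kernel.
  let f : (D.dualΛ₀ ⊓ W : AddSubgroup D.G) →+ Additive (almostAlgebraic D.m) :=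
    AddMonoidHom.mk' (fun v => Additive.ofMul ⟨charOf v.1 v.2.1 (h0 v), charOf_mem _ _⟩)
      fun v v' => congrArg Additive.ofMul (Subtype.ext
        ((isDualLog_charOf (v + v').2.1 (h0 (v + v'))).eq (charOf_mem _ (h0 (v + v'))).1
          (mul_mem (charOf_mem v.2.1 (h0 v)) (charOf_mem v'.2.1 (h0 v'))).1
          ((isDualLog_charOf v.2.1 (h0 v)).mul (isDualLog_charOf v'.2.1 (h0 v')) (h0 v) (h0 v'))))
  have hf : ∀ χ v, f v = Additive.ofMul χ ↔ D.IsDualLog χ v := fun χ v => by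
    constructor
    · intro h
      have h1 : (⟨charOf v.1 v.2.1 (h0 v), charOf_mem _ _⟩ : almostAlgebraic D.m) = χ :=
        Additive.ofMul.injective h
      rw [← h1]
      exact isDualLog_charOf v.2.1 (h0 v)
    · intro h
      exact congrArg Additive.ofMul (Subtype.ext
        ((isDualLog_charOf v.2.1 (h0 v)).eq (charOf_mem v.2.1 (h0 v)).1 χ.2.1 h))
  have hsurj : Function.Surjective f := fun χ => by
    obtain ⟨v, hv, hv0⟩ := exists_isDualLog χ.toMul.2
    have hd := hv.mem_dualΛ₀ χ.toMul.2.1 hv0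
    exact ⟨⟨v, hd, hW' v hd hv0⟩, (hf χ.toMul _).2 hv⟩
  have hker : f.ker = D.intℓ.addSubgroupOf (D.dualΛ₀ ⊓ W) := by
    ext v
    rw [AddMonoidHom.mem_ker, AddSubgroup.mem_addSubgroupOf, ← ofMul_one, hf]
    exact ⟨fun h => h.mem_intℓ, fun h => isDualLog_one_of_mem h⟩
  refine ⟨((QuotientAddGroup.quotientAddEquivOfEq hker.symm).trans
    (QuotientAddGroup.quotientKerEquivOfSurjective f hsurj)).symm, fun χ v => ?_⟩
  rw [AddEquiv.symm_apply_eq, ← hf, eq_comm]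
  rfl

end Construction

end HeckeAlg

end

noncomputable section

namespace HeckeAlg

/-! ### Complex embeddings grouped by place -/

section Embeddings

variable {F : Type*} [Field F]

open ComplexEmbedding

theorem conjugate_ne [IsTotallyComplex F] (σ : F →+* ℂ) : conjugate σ ≠ σ :=
  IsTotallyComplex.complexEmbedding_not_isReal σ

@[simp] theorem extendOdd_embedding (a : InfinitePlace F → ℝ) (w : InfinitePlace F) :
    extendOdd a w.embedding = a w := by
  simp [extendOdd]

theorem extendOdd_conjugate [IsTotallyComplex F] (a : InfinitePlace F → ℝ) (σ : F →+* ℂ) :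
    extendOdd a (conjugate σ) = -extendOdd a σ := by
  have hne := conjugate_ne σ
  unfold extendOdd
  rw [InfinitePlace.mk_conjugate_eq]
  rcases InfinitePlace.embedding_mk_eq σ with h | h
  · rw [h, if_neg hne, if_pos rfl]
  · rw [h, if_pos rfl, if_neg hne.symm, neg_neg]

variable [NumberField F]

open Classical in
theorem filter_mk_eq [IsTotallyComplex F] (w : InfinitePlace F) :
    ({σ : F →+* ℂ | InfinitePlace.mk σ = w} : Finset _) =
      {w.embedding, conjugate w.embedding} := by
  ext σ
  conv_lhs => rw [← w.mk_embedding]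
  simp only [Finset.mem_filter, Finset.mem_univ, true_and, Finset.mem_insert,
    Finset.mem_singleton]
  rw [eq_comm, InfinitePlace.mk_eq_iff, eq_comm, @eq_comm _ σ (conjugate _)]

/-- A product over the embeddings of a totally complex field, place by place. -/
theorem prod_embeddings [IsTotallyComplex F] {M : Type*} [CommMonoid M] (f : (F →+* ℂ) → M) :
    ∏ σ, f σ = ∏ w : InfinitePlace F, f w.embedding * f (conjugate w.embedding) := by
  classical
  rw [← Finset.prod_fiberwise (g := InfinitePlace.mk)]
  refine Finset.prod_congr rfl fun w _ => ?_
  rw [filter_mk_eq, Finset.prod_pair (conjugate_ne _).symm]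

theorem sum_embeddings [IsTotallyComplex F] {M : Type*} [AddCommMonoid M] (f : (F →+* ℂ) → M) :
    ∑ σ, f σ = ∑ w : InfinitePlace F, (f w.embedding + f (conjugate w.embedding)) :=
  prod_embeddings (M := Multiplicative M) f

end Embeddings

/-! ### Consequences of Dirichlet's unit theorem -/

section UnitLogs

variable {F : Type*} [Field F] [NumberField F]

open Units.dirichletUnitTheorem

/-- Dropping the coordinate at `w₀` gives the logarithmic space of Dirichlet's theorem, which unit
logarithms span; passing to powers only rescales them. The dropped coordinate is recovered from the
sum being zero. -/
theorem span_log_units (P : (𝓞 F)ˣ → Prop) (hP : ∀ u, ∃ n : ℕ, n ≠ 0 ∧ P (u ^ n))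
    (c : InfinitePlace F → ℝ) (hc : ∑ w, c w = 0) :
    c ∈ Submodule.span ℝ {x : InfinitePlace F → ℝ | ∃ u, P u ∧
      x = fun w => (w.mult : ℝ) * Real.log (w ((u : 𝓞 F) : F))} := by
  classical
  set T := Submodule.span ℝ {x : InfinitePlace F → ℝ | ∃ u, P u ∧
      x = fun w => (w.mult : ℝ) * Real.log (w ((u : 𝓞 F) : F))} with hT
  let r : (InfinitePlace F → ℝ) →ₗ[ℝ] logSpace F := LinearMap.funLeft ℝ ℝ Subtype.val
  have hmap : T.map r = ⊤ := by
    rw [eq_top_iff, ← unitLattice_span_eq_top, Submodule.span_le]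
    rintro _ ⟨u, -, rfl⟩
    obtain ⟨n, hn, hu⟩ := hP u.toMul
    have h1 : (n : ℝ) • (Units.logEmbedding F) u ∈ T.map r := by
      refine ⟨_, Submodule.subset_span ⟨_, hu, rfl⟩, ?_⟩
      funext w
      change (w.1.mult : ℝ) * Real.log (w.1 (((u.toMul ^ n : (𝓞 F)ˣ) : 𝓞 F) : F)) =
        (n : ℝ) * ((w.1.mult : ℝ) * Real.log (w.1 ((u.toMul : 𝓞 F) : F)))
      simp only [Units.val_pow_eq_pow_val, map_pow, Real.log_pow]
      ring
    have h2 := (T.map r).smul_mem ((n : ℝ)⁻¹) h1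
    rwa [smul_smul, inv_mul_cancel₀ (by exact_mod_cast hn), one_smul] at h2
  obtain ⟨t, ht, htc⟩ : r c ∈ T.map r := hmap ▸ Submodule.mem_top
  have hsum : ∑ w, t w = 0 := by
    have hle : T ≤ LinearMap.ker (Fintype.linearCombination ℝ (fun _ : InfinitePlace F => (1 : ℝ))) := by
      rw [hT, Submodule.span_le]
      rintro _ ⟨u, -, rfl⟩
      have := Units.sum_mult_mul_log u
      simpa [Fintype.linearCombination_apply] using this
    simpa [Fintype.linearCombination_apply] using hle ht
  have : c = t := by
    have hne : ∀ w : InfinitePlace F, w ≠ w₀ → c w = t w := fun w hw =>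
      (congrFun htc ⟨w, hw⟩).symm
    funext w
    by_cases hw : w = w₀
    · rw [Fintype.sum_eq_add_sum_compl w₀] at hc hsum
      rw [Finset.sum_congr rfl fun w hw => hne w (by simpa using hw)] at hc
      rw [hw]; linarith
    · exact hne w hw
  rwa [this]

/-- The linear form `a` kills the hyperplane of sum zero, in particular the difference of two basis
vectors. -/
theorem eq_of_forall_sum_log_eq_zero (P : (𝓞 F)ˣ → Prop)
    (hP : ∀ u, ∃ n : ℕ, n ≠ 0 ∧ P (u ^ n)) (a : InfinitePlace F → ℝ)
    (h : ∀ u, P u → ∑ w : InfinitePlace F, a w * ((w.mult : ℝ) * Real.log (w ((u : 𝓞 F) : F))) = 0)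
    (w w' : InfinitePlace F) : a w = a w' := by
  classical
  have hle : Submodule.span ℝ {x : InfinitePlace F → ℝ | ∃ u, P u ∧
      x = fun w => (w.mult : ℝ) * Real.log (w ((u : 𝓞 F) : F))} ≤
        LinearMap.ker (Fintype.linearCombination ℝ a) := by
    rw [Submodule.span_le]
    rintro _ ⟨u, hu, rfl⟩
    have := h u hu
    simp only [SetLike.mem_coe, LinearMap.mem_ker, Fintype.linearCombination_apply, smul_eq_mul]
    simpa only [mul_comm (a _)] using this
  have := hle (span_log_units P hP (Pi.single w 1 - Pi.single w' 1) (by simp))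
  simpa [Fintype.linearCombination_apply, Pi.single_apply, sub_mul, sub_eq_zero] using this

theorem exists_pow_mk_eq_one {m : Ideal (𝓞 F)} (hm : m ≠ ⊥) (u : (𝓞 F)ˣ) :
    ∃ n : ℕ, n ≠ 0 ∧ Ideal.Quotient.mk m ((u ^ n : (𝓞 F)ˣ) : 𝓞 F) = 1 := by
  have : Finite (𝓞 F ⧸ m) := m.finiteQuotientOfFreeOfNeBot hm
  have h := isOfFinOrder_of_finite (Units.map (Ideal.Quotient.mk m).toMonoidHom u)
  obtain ⟨n, hn, h⟩ := isOfFinOrder_iff_pow_eq_one.1 h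
  refine ⟨n, hn.ne', ?_⟩
  simpa using congrArg Units.val h

end UnitLogs

/-! ### The multiplicative relation on units -/

section UnitRelation

variable {F : Type*} [Field F] [NumberField F] {D : LogSetup F}

open LogSetup ComplexEmbedding

@[simp] theorem finComp_unitIdele (u : (𝓞 F)ˣ) (p) :
    finComp (unitIdele u) p = (((u : 𝓞 F) : F) : p.adicCompletion F) := rfl

@[simp] theorem infComp_unitIdele (u : (𝓞 F)ˣ) (w : InfinitePlace F) :
    infComp (unitIdele u) w = w.embedding ((u : 𝓞 F) : F) := infComp_principal _ w

theorem valued_finComp_unitIdele (u : (𝓞 F)ˣ) (p : HeightOneSpectrum (𝓞 F)) :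
    Valued.v (finComp (unitIdele u) p) = 1 := by
  have h : (((u : 𝓞 F) : F) : p.adicCompletion F) *
      ((((u⁻¹ : (𝓞 F)ˣ) : 𝓞 F) : F) : p.adicCompletion F) = 1 := by
    rw [← coe_mul_adic, Units.mul_inv, coe_one_adic]
  have h2 := congrArg Valued.v h
  rw [map_mul, map_one] at h2
  exact le_antisymm (valued_coe_le_one p _) (h2 ▸ mul_le_of_le_one_right' (valued_coe_le_one p _))

theorem isLog_unitIdele {u : (𝓞 F)ˣ} (hu : Ideal.Quotient.mk D.m (u : 𝓞 F) = 1)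
    {θ : InfinitePlace F → ℝ}
    (hθ : ∀ w : InfinitePlace F, w.embedding ((u : 𝓞 F) : F) /
      (‖w.embedding ((u : 𝓞 F) : F)‖ : ℂ) = Circle.exp (2 * Real.pi * θ w)) :
    D.IsLog (unitIdele u) (vec 0 0
      (fun w => (w.mult : ℝ) / (2 * Real.pi) * Real.log (w ((u : 𝓞 F) : F))) θ) :=
  ⟨0, 1, 0, by simpa using valued_finComp_unitIdele u, by simp,
    by simpa using isResidue_coe (u : 𝓞 F) 1 hu, by simp, by simp, by simp,
    fun w => by simp [InfinitePlace.norm_embedding_eq], by simpa using hθ⟩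

/-- Integrality on the logarithm of `u` gives ∏ (z_w / |z_w|)^{k_w} = 1. A conjugate pair of
embeddings contributes (z / z̄)^k = (z / |z|)^{2k}, so this product is the square of that one.
Unlike that one it is free of absolute values, so automorphisms can be applied to it. -/
theorem prod_embeddings_zpow_eq_one [IsTotallyComplex F] {v : D.G} (hv : v ∈ D.dualΛ₀)
    (h0 : ∀ w, atAbs v w = 0) {k : (F →+* ℂ) → ℤ} (hk : ∀ σ, extendOdd (atArg v) σ = k σ)
    {u : (𝓞 F)ˣ} (hu : Ideal.Quotient.mk D.m (u : 𝓞 F) = 1) :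
    ∏ σ : F →+* ℂ, σ ((u : 𝓞 F) : F) ^ k σ = 1 := by
  have hne : ∀ σ : F →+* ℂ, σ ((u : 𝓞 F) : F) ≠ 0 := fun σ => by simp
  choose θ hθ using fun w : InfinitePlace F => exists_circle_exp _ (hne w.embedding)
  obtain ⟨n, hn⟩ := hv _ (IsLog.mem_Λ₀ (isLog_unitIdele hu hθ))
  rw [dotProduct_eq] at hn
  simp only [h0, atPrime_vec, atRes_vec, Pi.zero_apply, mul_zero, Finset.sum_const_zero, zero_mul,
    add_zero, zero_add, atArg_vec] at hn
  have h1 := (circle_exp_two_pi_eq_one_iff _).2 ⟨n, hn⟩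
  rw [circle_exp_two_pi_sum] at h1
  have h2 : ∏ w : InfinitePlace F, (w.embedding ((u : 𝓞 F) : F) /
      (‖w.embedding ((u : 𝓞 F) : F)‖ : ℂ)) ^ k w.embedding = 1 := by
    have h3 := congrArg Circle.coeHom h1
    rw [map_prod, map_one] at h3
    rw [← h3]
    refine Finset.prod_congr rfl fun w _ => ?_
    rw [← extendOdd_embedding (atArg v), hk, mul_comm ((k _ : ℤ) : ℝ), circle_exp_two_pi_mul_int,
      hθ]
    rfl
  have hkc : ∀ σ, k (conjugate σ) = -k σ := fun σ => by
    have := extendOdd_conjugate (atArg v) σ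
    rw [hk, hk] at this
    exact_mod_cast this
  rw [prod_embeddings]
  have h4 : ∀ w : InfinitePlace F, w.embedding ((u : 𝓞 F) : F) ^ k w.embedding *
      (conjugate w.embedding) ((u : 𝓞 F) : F) ^ k (conjugate w.embedding) =
      ((w.embedding ((u : 𝓞 F) : F) /
        (‖w.embedding ((u : 𝓞 F) : F)‖ : ℂ)) ^ k w.embedding) ^ 2 := fun w => by
    set z := w.embedding ((u : 𝓞 F) : F) with hz
    have hz0 : z ≠ 0 := hne _
    have hcz : (starRingEnd ℂ) z ≠ 0 := by simpa using hz0
    rw [hkc, conjugate_coe_eq, zpow_neg, ← inv_zpow, ← mul_zpow, ← zpow_natCast, ← zpow_mul,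
      mul_comm (k _), zpow_mul]
    congr 1
    have hn : (‖z‖ : ℂ) ≠ 0 := by simpa using hz0
    rw [zpow_natCast, div_pow, ← Complex.mul_conj']
    field_simp
    rw [hz]
  rw [Finset.prod_congr rfl fun w _ => h4 w, Finset.prod_pow, h2, one_pow]

end UnitRelation

end HeckeAlg

end

noncomputable section

namespace HeckeAlg

/-! ### Galois action on complex embeddings -/

section Galois

open ComplexEmbedding

variable {F L : Type*} [Field F] [Field L] [NumberField L] [IsGalois ℚ L] [Algebra F L]
  [Algebra L ℂ]

/-- The complex embedding of `F` obtained from an automorphism of a Galois extension of `ℚ`. -/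
def galEmb (g : Gal(L/ℚ)) : F →+* ℂ :=
  (algebraMap L ℂ).comp ((g : L →+* L).comp (algebraMap F L))

theorem galEmb_apply (g : Gal(L/ℚ)) (x : F) :
    galEmb g x = algebraMap L ℂ (g (algebraMap F L x)) := rfl

theorem galEmb_surjective [CharZero F] :
    Function.Surjective (galEmb : Gal(L/ℚ) → (F →+* ℂ)) := by
  intro σ
  have : Algebra.IsAlgebraic F L := Algebra.IsAlgebraic.tower_top (K := ℚ) F
  obtain ⟨τ, hτ⟩ : ∃ τ : L →+* ℂ, τ.comp (algebraMap F L) = σ :=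
    ⟨ComplexEmbedding.lift L σ, ComplexEmbedding.lift_comp_algebraMap L σ⟩
  refine ⟨AlgHom.restrictNormal' τ.toRatAlgHom L, RingHom.ext fun x => ?_⟩
  rw [galEmb_apply, ← hτ]
  exact AlgHom.restrictNormal_commutes τ.toRatAlgHom L (algebraMap F L x)

variable (L) in
/-- Complex conjugation on a Galois extension of `ℚ` embedded in `ℂ`. -/
def galConj : Gal(L/ℚ) := (Complex.conjAe.restrictScalars ℚ).restrictNormal L

theorem algebraMap_galConj (x : L) :
    algebraMap L ℂ (galConj L x) = (starRingEnd ℂ) (algebraMap L ℂ x) :=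
  AlgEquiv.restrictNormal_commutes (Complex.conjAe.restrictScalars ℚ) L x

theorem galConj_galConj (x : L) : galConj L (galConj L x) = x :=
  (algebraMap L ℂ).injective (by simp [algebraMap_galConj])

theorem galEmb_galConj_mul (g : Gal(L/ℚ)) :
    (galEmb (galConj L * g) : F →+* ℂ) = conjugate (galEmb g) :=
  RingHom.ext fun x => algebraMap_galConj _

theorem galEmb_eq_iff {g g' : Gal(L/ℚ)} {x : F} :
    galEmb g x = galEmb g' x ↔ g (algebraMap F L x) = g' (algebraMap F L x) :=
  (algebraMap L ℂ).injective.eq_iff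

/-- Left multiplication by `h` as a permutation of the complex embeddings. -/
theorem exists_perm_galEmb [NumberField F] (h : Gal(L/ℚ)) :
    ∃ e : Equiv.Perm (F →+* ℂ), ∀ g : Gal(L/ℚ), e (galEmb g) = galEmb (h * g) := by
  choose γ hγ using galEmb_surjective (F := F) (L := L)
  have hinj : Function.Injective fun σ : F →+* ℂ => (galEmb (h * γ σ) : F →+* ℂ) := by
    intro σ τ hστ
    refine RingHom.ext fun x => ?_
    rw [← hγ σ, ← hγ τ, galEmb_eq_iff]
    exact h.injective (galEmb_eq_iff.1 (RingHom.congr_fun hστ x))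
  refine ⟨Equiv.ofBijective _ (Finite.injective_iff_bijective.1 hinj), fun g => ?_⟩
  refine RingHom.ext fun x => ?_
  change galEmb (h * γ (galEmb g)) x = _
  rw [galEmb_eq_iff]
  exact congrArg h (galEmb_eq_iff.1 (RingHom.congr_fun (hγ (galEmb g)) x))

/-- Both relations can be read in `L`, where `h` carries the twisted one to the given one. -/
theorem prod_embeddings_perm [NumberField F] {h : Gal(L/ℚ)} {e : Equiv.Perm (F →+* ℂ)}
    (he : ∀ g : Gal(L/ℚ), e (galEmb g) = galEmb (h * g)) {k : (F →+* ℂ) → ℤ} {u : F}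
    (hu : ∏ σ : F →+* ℂ, σ u ^ k σ = 1) : ∏ σ : F →+* ℂ, σ u ^ k (e σ) = 1 := by
  choose γ hγ using galEmb_surjective (F := F) (L := L)
  have h1 : ∏ σ : F →+* ℂ, (γ σ (algebraMap F L u)) ^ k (e σ) = 1 := by
    apply h.injective
    apply (algebraMap L ℂ).injective
    rw [map_prod, map_prod, map_one, map_one, ← hu, ← Equiv.prod_comp e fun σ => σ u ^ k σ]
    refine Finset.prod_congr rfl fun σ _ => ?_
    rw [map_zpow₀, map_zpow₀]
    congr 1
    conv_rhs => rw [← hγ σ, he]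
    rfl
  have h2 := congrArg (algebraMap L ℂ) h1
  rw [map_prod, map_one] at h2
  rw [← h2]
  refine Finset.prod_congr rfl fun σ _ => ?_
  rw [map_zpow₀]
  conv_lhs => rw [← hγ σ]
  congr 2
  · exact congrArg e (hγ σ)

end Galois

/-! ### CM subfields from a normal subgroup -/

section CMSubfield

open ComplexEmbedding IntermediateField

/-- The automorphism has order 2, and its fixed field is totally real because every embedding turns
it into complex conjugation. -/
theorem isCMField_of_forall_isConj {K : Type*} [Field K] [NumberField K] [IsTotallyComplex K]
    {σ : Gal(K/ℚ)} (hσ : ∀ φ : K →+* ℂ, IsConj φ σ) : IsCMField K := by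
  let φ : K →+* ℂ := Classical.choice (inferInstance : Nonempty _)
  have hσ' : Nat.card (Subgroup.zpowers σ) = 2 := by
    rw [Nat.card_zpowers, orderOf_isConj_two_of_ne_one (hσ φ)]
    exact (isConj_ne_one_iff (hσ φ)).mpr <| IsTotallyComplex.complexEmbedding_not_isReal φ
  let L := fixedField (Subgroup.zpowers σ)
  have : IsTotallyReal L := ⟨fun w ↦ by
    obtain ⟨W, rfl⟩ := w.comap_surjective (K := K)
    dsimp only
    rw [← W.mk_embedding, InfinitePlace.comap_mk, InfinitePlace.isReal_mk_iff, isReal_iff]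
    refine RingHom.ext fun x => ?_
    have h1 := RingHom.congr_fun (hσ W.embedding) (x : K)
    have h2 : σ (x : K) = x := x.2 ⟨σ, Subgroup.mem_zpowers σ⟩
    change _ = W.embedding (σ (x : K)) at h1
    rw [h2] at h1
    exact h1⟩
  have : Algebra.IsQuadraticExtension L K := ⟨by rw [finrank_fixedField_eq_card, hσ']⟩
  exact IsCMField.ofCMExtension L K

variable {F L : Type*} [Field F] [NumberField F] [Field L] [NumberField L] [IsGalois ℚ L]
  [Algebra F L] [Algebra L ℂ]

/-- Take the elements of `F` fixed by `M`. Modulo `M`, conjugation `c` is central, so it preserves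
this field and induces the same involution under every embedding, which is the CM condition.
Containing `K` makes the field totally complex. -/
theorem exists_isCMField_of_normal (M : Subgroup Gal(L/ℚ)) [M.Normal]
    (hM : ∀ h, galConj L * h * galConj L * h⁻¹ ∈ M) (K : IntermediateField ℚ F)
    [IsTotallyComplex K] (hK : ∀ n ∈ M, ∀ x ∈ K, n (algebraMap F L x) = algebraMap F L x) :
    ∃ K' : IntermediateField ℚ F, IsCMField K' ∧ K ≤ K' ∧
      ∀ g g' : Gal(L/ℚ), (∀ x ∈ K', (galEmb g x : ℂ) = galEmb g' x) →
        ∃ n ∈ M, (galEmb g' : F →+* ℂ) = galEmb (g * n) := by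
  set c := galConj L
  have hcc : ∀ x, c (c x) = x := galConj_galConj
  let j : F →ₐ[ℚ] L := (algebraMap F L).toRatAlgHom
  have hj : ∀ x, j x = algebraMap F L x := fun x => rfl
  -- `B` is the Galois group of `L` over `F`, so the new field corresponds to `M ⊔ B`.
  let B : Subgroup Gal(L/ℚ) := fixingSubgroup j.fieldRange
  have hB : ∀ b ∈ B, ∀ x, b (j x) = j x := fun b hb x => hb ⟨j x, x, rfl⟩
  have hmem : ∀ y : L, y ∈ fixedField (M ⊔ B) ↔ (∀ n ∈ M, n y = y) ∧ ∀ b ∈ B, b y = y := by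
    intro y
    have h1 : y ∈ fixedField (M ⊔ B) ↔ M ⊔ B ≤ MulAction.stabilizer Gal(L/ℚ) y :=
      ⟨fun h g hg => h ⟨g, hg⟩, fun h g => h g.2⟩
    rw [h1, sup_le_iff]
    exact Iff.rfl
  have hrange : ∀ y ∈ fixedField (M ⊔ B), ∃ x, j x = y := by
    intro y hy
    have h1 : y ∈ fixedField B := fun b => ((hmem y).1 hy).2 b b.2
    rwa [IsGalois.fixedField_fixingSubgroup] at h1
  let K' : IntermediateField ℚ F := (fixedField (M ⊔ B)).comap j
  have hK' : ∀ x, x ∈ K' ↔ ∀ n ∈ M, n (j x) = j x := fun x =>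
    ⟨fun h => ((hmem _).1 h).1, fun h => (hmem _).2 ⟨h, fun b hb => hB b hb x⟩⟩
  have hle : K ≤ K' := fun x hx => (hK' x).2 fun n hn => hK n hn x hx
  have hconj : ∀ x ∈ K', ∃ y ∈ K', j y = c (j x) := by
    intro x hx
    have h1 : c (j x) ∈ fixedField (M ⊔ B) := by
      rw [hmem]
      refine ⟨fun n hn => ?_, fun b hb => ?_⟩
      · have := (hK' x).1 hx _ (Subgroup.Normal.conj_mem ‹_› n hn c⁻¹)
        have h2 := congrArg c this
        simpa [AlgEquiv.mul_apply] using h2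
      -- This is a conjugate of `c * b * c * b⁻¹`; that it fixes `j x` means `b` fixes `c (j x)`.
      · have h2 : b * c * b⁻¹ * c ∈ M := by
          simpa [mul_assoc] using Subgroup.Normal.conj_mem ‹_› _ (hM b) c⁻¹
        have h4 : b (c (b⁻¹ (c (j x)))) = j x := (hK' x).1 hx _ h2
        have h5 : c (b⁻¹ (c (j x))) = j x := b.injective (h4.trans (hB b hb x).symm)
        have h6 : b⁻¹ (c (j x)) = c (j x) := by rw [← hcc (b⁻¹ _), h5]
        conv_lhs => rw [← h6, ← AlgEquiv.mul_apply, mul_inv_cancel, AlgEquiv.one_apply]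
    obtain ⟨y, hy⟩ := hrange _ h1
    refine ⟨y, ?_, hy⟩
    change j y ∈ fixedField (M ⊔ B)
    rwa [hy]
  choose! r hr hjr using hconj
  have hinj : Function.Injective j := j.toRingHom.injective
  let ρ : K' →ₐ[ℚ] K' :=
    { toFun := fun x => ⟨r x, hr x x.2⟩
      map_one' := Subtype.ext <| hinj <| (hjr 1 (one_mem _)).trans (by simp)
      map_mul' := fun x y => Subtype.ext <| hinj <| (hjr _ (mul_mem x.2 y.2)).trans <| by
        simp [hjr x x.2, hjr y y.2]
      map_zero' := Subtype.ext <| hinj <| (hjr 0 (zero_mem _)).trans (by simp)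
      map_add' := fun x y => Subtype.ext <| hinj <| (hjr _ (add_mem x.2 y.2)).trans <| by
        simp [hjr x x.2, hjr y y.2]
      commutes' := fun q => Subtype.ext <| hinj <| (hjr _ (K'.algebraMap_mem q)).trans <| by
        simp }
  have hρ : ρ.comp ρ = AlgHom.id ℚ K' := AlgHom.ext fun x => Subtype.ext <| hinj <|
    (hjr _ (hr x x.2)).trans <| by rw [hjr x x.2, hcc]; rfl
  have : IsTotallyComplex K' := by
    let := (inclusion hle).toAlgebra
    exact isTotallyComplex_of_algebra K K'
  refine ⟨K', ?_, hle, fun g g' h => ?_⟩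
  · refine isCMField_of_forall_isConj (σ := AlgEquiv.ofAlgHom ρ ρ hρ hρ) fun φ => ?_
    obtain ⟨g, hg⟩ := galEmb_surjective (L := L) (ComplexEmbedding.lift F φ)
    have hφ : ∀ x : K', φ x = algebraMap L ℂ (g (j x)) := fun x => by
      rw [← ComplexEmbedding.lift_algebraMap_apply F φ x, ← hg]
      rfl
    refine RingHom.ext fun x => ?_
    change (starRingEnd ℂ) (φ x) = φ (ρ x)
    rw [hφ, hφ, ← algebraMap_galConj]
    congr 1
    change c (g (j x)) = g (j (r x))
    rw [hjr x x.2]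
    have h1 : c (g⁻¹ (c (g (j x)))) = j x := by simpa using (hK' x).1 x.2 _ (hM g⁻¹)
    have h2 : g⁻¹ (c (g (j x))) = c (j x) := by rw [← h1, hcc, h1]
    rw [← h2]
    exact (g.apply_symm_apply _).symm
  -- By the Galois correspondence and normality of `M`, `g⁻¹ * g'` is a product `n * b`, and `b`
  -- acts trivially on `F`.
  · have h1 : g⁻¹ * g' ∈ fixingSubgroup (fixedField (M ⊔ B)) := by
      rintro ⟨y, hy⟩
      obtain ⟨x, rfl⟩ := hrange y hy
      have h2 := galEmb_eq_iff.1 (h x hy)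
      change g⁻¹ (g' (j x)) = j x
      rw [hj, ← h2, ← AlgEquiv.mul_apply, inv_mul_cancel, AlgEquiv.one_apply]
    rw [fixingSubgroup_fixedField] at h1
    obtain ⟨n, hn, b, hb, hnb⟩ := Subgroup.mem_sup_of_normal_left.1 h1
    refine ⟨n, hn, RingHom.ext fun x => galEmb_eq_iff.2 ?_⟩
    have h3 := hB b hb x
    rw [eq_inv_mul_iff_mul_eq] at hnb
    rw [← hnb, ← hj, ← mul_assoc, AlgEquiv.mul_apply, h3]

end CMSubfield

/-! ### Exponents factor through the maximal CM subfield -/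

section Weil

open ComplexEmbedding LogSetup

variable {F : Type*} [Field F] [NumberField F]

/-- Logarithms of absolute values turn the relation into a linear one with coefficients `k σ + k
(conjugate σ)`. Dirichlet's theorem makes these equal over all places, and their sum is zero. -/
theorem exponent_conjugate [IsTotallyComplex F] {k : (F →+* ℂ) → ℤ} (hk : ∑ σ, k σ = 0)
    {P : (𝓞 F)ˣ → Prop} (hP : ∀ u, ∃ n : ℕ, n ≠ 0 ∧ P (u ^ n))
    (h : ∀ u, P u → ∏ σ : F →+* ℂ, σ ((u : 𝓞 F) : F) ^ k σ = 1) (σ : F →+* ℂ) :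
    k (conjugate σ) = -k σ := by
  set a : InfinitePlace F → ℝ := fun w => k w.embedding + k (conjugate w.embedding) with ha
  have h1 : ∀ u, P u → ∑ w : InfinitePlace F,
      a w * ((w.mult : ℝ) * Real.log (w ((u : 𝓞 F) : F))) = 0 := by
    intro u hu
    have h2 := congrArg (fun z : ℂ => Real.log ‖z‖) (h u hu)
    simp only [norm_prod, norm_one, Real.log_one] at h2
    have hne : ∀ σ ∈ (Finset.univ : Finset (F →+* ℂ)), ‖σ ((u : 𝓞 F) : F) ^ k σ‖ ≠ 0 :=
      fun σ _ => norm_ne_zero_iff.2 (zpow_ne_zero _ (by simp))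
    rw [Real.log_prod hne] at h2
    simp only [norm_zpow, Real.log_zpow] at h2
    rw [sum_embeddings] at h2
    simp only [conjugate_coe_eq, RCLike.norm_conj, InfinitePlace.norm_embedding_eq] at h2
    rw [← mul_zero (2 : ℝ), ← h2, Finset.mul_sum]
    refine Finset.sum_congr rfl fun w _ => ?_
    rw [InfinitePlace.mult_isComplex ⟨w, IsTotallyComplex.isComplex w⟩]
    push_cast
    ring
  have h2 : ∑ w, a w = 0 := by
    rw [sum_embeddings] at hk
    simp only [ha]
    exact_mod_cast hk
  have h3 : ∀ w, a w = 0 := fun w => by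
    have h4 : ∑ w', a w' = Fintype.card (InfinitePlace F) * a w := by
      rw [Finset.sum_congr rfl fun w' _ => eq_of_forall_sum_log_eq_zero P hP a h1 w' w]
      simp
    rw [h2] at h4
    have : Nonempty (InfinitePlace F) := ⟨w⟩
    exact (mul_eq_zero.1 h4.symm).resolve_left (by simp)
  have h4 : k (InfinitePlace.mk σ).embedding + k (conjugate (InfinitePlace.mk σ).embedding) = 0 := by
    have := h3 (InfinitePlace.mk σ)
    simp only [ha] at this
    exact_mod_cast this
  rcases InfinitePlace.embedding_mk_eq σ with h | h
  · rw [h] at h4; linarith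
  · rw [h, involutive_conjugate F] at h4; linarith

/-- An odd family of exponents killing a subgroup of finite index of the units factors through
the maximal CM subfield. -/
theorem exponent_eq_of_restrict_eq {K : IntermediateField ℚ F}
    (hK : Maximal (fun L : IntermediateField ℚ F => IsCMField L) K) [IsTotallyComplex F]
    {k : (F →+* ℂ) → ℤ} (hk : ∑ σ, k σ = 0)
    {P : (𝓞 F)ˣ → Prop} (hP : ∀ u, ∃ n : ℕ, n ≠ 0 ∧ P (u ^ n))
    (h : ∀ u, P u → ∏ σ : F →+* ℂ, σ ((u : 𝓞 F) : F) ^ k σ = 1) {σ τ : F →+* ℂ}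
    (hστ : ∀ x ∈ K, σ x = τ x) : k σ = k τ := by
  have : IsCMField K := hK.prop
  let L := IntermediateField.normalClosure ℚ F ℂ
  have : Normal ℚ L :=
    (Algebra.IsAlgebraic.isNormalClosure_normalClosure fun x => IsAlgClosed.splits _).normal
  have : NumberField L := { }
  have : IsGalois ℚ L := { }
  let := (((IsAlgClosed.lift (R := ℚ) : F →ₐ[ℚ] ℂ).codRestrict L.toSubalgebra fun x =>
    (AlgHom.fieldRange_le_normalClosure _) ⟨x, rfl⟩ : F →ₐ[ℚ] L) : F →+* L).toAlgebra
  -- Oddness under conjugation, applied to the relation twisted by `a`.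
  have hmul : ∀ a b : Gal(L/ℚ),
      k (galEmb (a * galConj L * b)) = -k (galEmb (a * b)) := by
    intro a b
    obtain ⟨e, he⟩ := exists_perm_galEmb (F := F) a
    have h1 : ∑ σ, k (e σ) = 0 := by rw [Equiv.sum_comp e]; exact hk
    have h2 := exponent_conjugate (k := fun σ => k (e σ)) h1 hP
      (fun u hu => prod_embeddings_perm he (h u hu)) (galEmb b)
    rwa [← galEmb_galConj_mul, he, he, ← mul_assoc] at h2
  have hgc : ∀ (g : Gal(L/ℚ)) (x : K), galConj L (g (algebraMap F L x)) =
      g (algebraMap F L (IsCMField.complexConj K x : K)) := fun g x => by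
    apply (algebraMap L ℂ).injective
    rw [algebraMap_galConj]
    exact (IsCMField.complexEmbedding_complexConj K ((galEmb g).comp (algebraMap K F)) x).symm
  -- Quantifying over both `a` and `b`, and over all conjugates of `K`, makes `M` normal. The
  -- condition on `K` ensures that the resulting field contains `K`, so that maximality applies.
  let M : Subgroup Gal(L/ℚ) :=
    { carrier := {n | (∀ a b, k (galEmb (a * n * b)) = k (galEmb (a * b))) ∧
        ∀ g : Gal(L/ℚ), ∀ x ∈ K, n (g (algebraMap F L x)) = g (algebraMap F L x)}
      mul_mem' := fun {n n'} hn hn' => ⟨fun a b => by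
          rw [← mul_assoc, mul_assoc (a * n), hn.1, ← mul_assoc, hn'.1], fun g x hx => by
          rw [AlgEquiv.mul_apply, hn'.2 g x hx, hn.2 g x hx]⟩
      one_mem' := ⟨fun a b => by rw [mul_one], fun g x _ => rfl⟩
      inv_mem' := fun {n} hn => ⟨fun a b => by
          rw [← hn.1, inv_mul_cancel_right], fun g x hx => by
          conv_lhs => rw [← hn.2 g x hx]
          exact n.symm_apply_apply _⟩ }
  have : M.Normal := ⟨fun n hn g => ⟨fun a b => by
      have := hn.1 (a * g) (g⁻¹ * b)
      simpa [mul_assoc] using this, fun g' x hx => by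
      have := hn.2 (g⁻¹ * g') x hx
      simp only [AlgEquiv.mul_apply] at this ⊢
      rw [this]
      exact g.apply_symm_apply _⟩⟩
  obtain ⟨K', hK', hle, H⟩ := exists_isCMField_of_normal M
    -- Conjugation is inserted twice, so the signs cancel; on conjugates of `K`, conjugation is
    -- induced by `complexConj K`.
    (fun h => ⟨fun a b => by
      have h1 := hmul a (h * galConj L * h⁻¹ * b)
      have h2 := hmul (a * h) (h⁻¹ * b)
      simp only [← mul_assoc] at h1 h2 ⊢
      rw [h1, h2, neg_neg, mul_inv_cancel_right], fun g x hx => by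
      have h1 := hgc (h⁻¹ * g) ⟨x, hx⟩
      simp only [AlgEquiv.mul_apply] at h1 ⊢
      rw [h1]
      refine (congrArg (galConj L) (h.apply_symm_apply _)).trans ?_
      rw [← hgc g ⟨x, hx⟩, galConj_galConj]⟩)
    K (fun n hn x hx => hn.2 1 x hx)
  have hKK : K' ≤ K := hK.le_of_ge hK' hle
  obtain ⟨g, rfl⟩ := galEmb_surjective (L := L) σ
  obtain ⟨g', rfl⟩ := galEmb_surjective (L := L) τ
  obtain ⟨n, hn, hg⟩ := H g g' fun x hx => hστ x (hKK hx)
  have := hn.1 g 1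
  rw [mul_one, mul_one] at this
  rw [hg, this]

theorem factorsThrough_of_mem_dualΛ₀ {K : IntermediateField ℚ F}
    (hK : Maximal (fun L : IntermediateField ℚ F => IsCMField L) K) [IsTotallyComplex F]
    {D : LogSetup F} {v : D.G} (hv : v ∈ D.dualΛ₀) (h0 : ∀ w, atAbs v w = 0) :
    FactorsThrough K (atArg v) := by
  have h1 : ∀ σ : F →+* ℂ, ∃ k : ℤ, extendOdd (atArg v) σ = k := fun σ => by
    obtain ⟨k, hk⟩ := exists_atArg_eq_int hv (InfinitePlace.mk σ)
    unfold extendOdd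
    split_ifs
    · exact ⟨k, hk⟩
    · exact ⟨-k, by rw [hk]; push_cast; rfl⟩
  choose k hk using h1
  have hsum : ∑ σ, k σ = 0 := by
    have : ∑ σ, extendOdd (atArg v) σ = 0 := by
      rw [sum_embeddings]
      simp [extendOdd_conjugate]
    simp only [hk] at this
    exact_mod_cast this
  have key := fun σ τ => exponent_eq_of_restrict_eq hK hsum (exists_pow_mk_eq_one D.m_ne_bot)
    (fun u hu => prod_embeddings_zpow_eq_one hv h0 hk hu) (σ := σ) (τ := τ)
  -- Any lift of φ to `F` would do, by `key`.
  refine ⟨fun φ => k (ComplexEmbedding.lift F φ), fun σ => ?_⟩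
  rw [hk, key σ _ fun x hx => ?_]
  exact (ComplexEmbedding.lift_algebraMap_apply F (σ.comp (algebraMap K F)) ⟨x, hx⟩).symm

end Weil

end HeckeAlg

end

noncomputable section

namespace HeckeAlg

/-! ### The norm on argument coordinates and equations for `H` -/

section NormArg

open ComplexEmbedding LogSetup

variable {F : Type*} [Field F] [NumberField F]

theorem extendOdd_of_odd [IsTotallyComplex F] {g : (F →+* ℂ) → ℝ}
    (hg : ∀ σ, g (conjugate σ) = -g σ) (σ : F →+* ℂ) :
    extendOdd (fun w => g w.embedding) σ = g σ := by
  rcases InfinitePlace.embedding_mk_eq σ with h | h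
  · conv_lhs => rw [← h]
    rw [extendOdd_embedding, h]
  · have h2 := extendOdd_conjugate (fun w => g w.embedding) σ
    conv_lhs at h2 => rw [← h]
    rw [extendOdd_embedding, h, hg] at h2
    linarith

theorem sum_mul_eq [IsTotallyComplex F] (a b : InfinitePlace F → ℝ) :
    2 * ∑ w, a w * b w = ∑ σ, extendOdd a σ * extendOdd b σ := by
  rw [sum_embeddings, Finset.mul_sum]
  refine Finset.sum_congr rfl fun w _ => ?_
  rw [extendOdd_conjugate, extendOdd_conjugate, extendOdd_embedding, extendOdd_embedding]
  ring

variable (K : IntermediateField ℚ F)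

open Classical in
/-- The sum of the `a_σ` over the embeddings `σ` of `F` extending an embedding `φ` of `K`, as a
linear map. -/
def normEmb (φ : K →+* ℂ) : (InfinitePlace F → ℝ) →ₗ[ℝ] ℝ where
  toFun a := ∑ σ : F →+* ℂ with σ.comp (algebraMap K F) = φ, extendOdd a σ
  map_add' a b := by simp only [extendOdd_add, Finset.sum_add_distrib]
  map_smul' c a := by simp only [extendOdd_smul, Finset.mul_sum, RingHom.id_apply, smul_eq_mul]

theorem normEmb_embedding (a : InfinitePlace F → ℝ) (τ : InfinitePlace K) :
    normEmb K τ.embedding a = normArg K a τ := rfl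

/-- `normArg` as a linear map. -/
def normArgₗ : (InfinitePlace F → ℝ) →ₗ[ℝ] (InfinitePlace K → ℝ) :=
  LinearMap.pi fun τ => normEmb K τ.embedding

@[simp] theorem normArgₗ_apply (a : InfinitePlace F → ℝ) : normArgₗ K a = normArg K a := rfl

open Classical in
theorem normEmb_conjugate [IsTotallyComplex F] (a : InfinitePlace F → ℝ) (φ : K →+* ℂ) :
    normEmb K (conjugate φ) a = -normEmb K φ a := by
  change ∑ σ : F →+* ℂ with σ.comp (algebraMap K F) = conjugate φ, extendOdd a σ =
    -∑ σ : F →+* ℂ with σ.comp (algebraMap K F) = φ, extendOdd a σ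
  rw [← Finset.sum_neg_distrib]
  refine Finset.sum_nbij' conjugate conjugate ?_ ?_ (fun σ _ => involutive_conjugate F σ)
    (fun σ _ => involutive_conjugate F σ) (fun σ _ => by rw [extendOdd_conjugate, neg_neg])
  · intro σ hσ
    simp only [Finset.mem_filter, Finset.mem_univ, true_and] at hσ ⊢
    rw [conjugate_comp, hσ]
    exact involutive_conjugate K φ
  · intro σ hσ
    simp only [Finset.mem_filter, Finset.mem_univ, true_and] at hσ ⊢
    rw [conjugate_comp, hσ]

theorem normEmb_eq_zero [IsTotallyComplex F] {a : InfinitePlace F → ℝ}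
    (ha : normArg K a = 0) (φ : K →+* ℂ) : normEmb K φ a = 0 := by
  have h := congrFun ha (InfinitePlace.mk φ)
  rw [← normEmb_embedding] at h
  rcases InfinitePlace.embedding_mk_eq φ with h1 | h1
  · rwa [h1] at h
  · rw [h1, normEmb_conjugate] at h
    simpa using h

/-- The norm is adjoint to inflation of families from `K`; the 2 counts the two embeddings at each
place. -/
theorem sum_mul_normEmb [IsTotallyComplex F] (a b : InfinitePlace F → ℝ) {f : (K →+* ℂ) → ℝ}
    (hb : ∀ σ : F →+* ℂ, extendOdd b σ = f (σ.comp (algebraMap K F))) :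
    2 * ∑ w, a w * b w = ∑ φ, f φ * normEmb K φ a := by
  classical
  rw [sum_mul_eq, ← Finset.sum_fiberwise (g := fun σ : F →+* ℂ => σ.comp (algebraMap K F))]
  refine Finset.sum_congr rfl fun φ _ => ?_
  rw [show normEmb K φ a = ∑ σ : F →+* ℂ with σ.comp (algebraMap K F) = φ, extendOdd a σ from rfl,
    Finset.mul_sum]
  refine Finset.sum_congr rfl fun σ hσ => ?_
  rw [hb, (Finset.mem_filter.1 hσ).2, mul_comm]

/-- Use 1 at a lift ρ of τ and -1 at its conjugate. The conjugate lies over an embedding of `K`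
chosen at no place, so only ρ is counted. -/
theorem exists_normArg_eq_single [IsTotallyComplex F] [IsTotallyComplex K]
    [DecidableEq (InfinitePlace K)] (τ : InfinitePlace K) :
    ∃ e : InfinitePlace F → ℤ, normArg K (fun w => (e w : ℝ)) = Pi.single τ 1 := by
  classical
  set ρ := ComplexEmbedding.lift F τ.embedding with hρ
  have hρK : ρ.comp (algebraMap K F) = τ.embedding := ComplexEmbedding.lift_comp_algebraMap F _
  let g : (F →+* ℂ) → ℤ := Pi.single ρ 1 - Pi.single (conjugate ρ) 1
  have hodd : ∀ σ, g (conjugate σ) = -g σ := fun σ => by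
    simp only [g, Pi.sub_apply, Pi.single_apply, (involutive_conjugate F).injective.eq_iff,
      (involutive_conjugate F).eq_iff (x := σ) (y := ρ)]
    ring
  refine ⟨fun w => g w.embedding, funext fun τ' => ?_⟩
  have h1 : ∀ σ, extendOdd (fun w => (g w.embedding : ℝ)) σ = g σ :=
    extendOdd_of_odd (g := fun σ => (g σ : ℝ)) fun σ => by rw [hodd]; push_cast; rfl
  have h2 : conjugate τ.embedding ≠ τ'.embedding := fun h => by
    have h3 := congrArg InfinitePlace.mk h
    rw [InfinitePlace.mk_conjugate_eq, InfinitePlace.mk_embedding, InfinitePlace.mk_embedding] at h3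
    rw [h3] at h
    exact conjugate_ne _ h
  unfold normArg
  have h4 : τ.embedding = τ'.embedding ↔ τ' = τ :=
    ⟨fun h => by rw [← τ.mk_embedding, h, τ'.mk_embedding], fun h => by rw [h]⟩
  rw [Finset.sum_congr rfl fun σ _ => h1 σ]
  simp only [g, Pi.sub_apply, Int.cast_sub, Finset.sum_sub_distrib, Pi.single_apply, Int.cast_ite,
    Int.cast_one, Int.cast_zero, Finset.sum_ite_eq', Finset.mem_filter, Finset.mem_univ, true_and,
    conjugate_comp, hρK, h2, h4, if_false, sub_zero]

/-- The norm is onto already over ℤ; an integral section lets arguments be corrected by integers and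
splits off the kernel. -/
theorem exists_normArg_section [IsTotallyComplex F] [IsTotallyComplex K] :
    ∃ s : (InfinitePlace K → ℝ) →ₗ[ℝ] (InfinitePlace F → ℝ), (∀ b, normArg K (s b) = b) ∧
      ∀ b : InfinitePlace K → ℤ, ∃ a : InfinitePlace F → ℤ, s (fun τ => b τ) = fun w => (a w : ℝ) := by
  classical
  choose e he using exists_normArg_eq_single K
  refine ⟨Fintype.linearCombination ℝ fun τ w => (e τ w : ℝ), fun b => ?_, fun b =>
    ⟨∑ τ, b τ • e τ, ?_⟩⟩
  · rw [← normArgₗ_apply, Fintype.linearCombination_apply, map_sum]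
    simp only [map_smul, normArgₗ_apply, he]
    funext τ
    simp [Pi.single_apply]
  · funext w
    simp [Fintype.linearCombination_apply]

theorem exists_normArg_eq_int (a : InfinitePlace F → ℤ) :
    ∃ b : InfinitePlace K → ℤ, normArg K (fun w => (a w : ℝ)) = fun τ => (b τ : ℝ) := by
  have h : ∀ σ : F →+* ℂ, ∃ z : ℤ, extendOdd (fun w => (a w : ℝ)) σ = z := fun σ => by
    unfold extendOdd
    split_ifs
    · exact ⟨_, rfl⟩
    · exact ⟨-a (InfinitePlace.mk σ), by push_cast; rfl⟩
  choose z hz using h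
  classical
  refine ⟨fun τ => ∑ σ : F →+* ℂ with σ.comp (algebraMap K F) = τ.embedding, z σ, funext fun τ => ?_⟩
  unfold normArg
  simp only [hz]
  push_cast
  congr

variable {K} {D : LogSetup F}

/-- By the adjunction, orthogonality to families inflated from `K` is vanishing of the norm. -/
theorem mem_H_iff [IsTotallyComplex F] [IsTotallyComplex K] {v : D.G} :
    v ∈ H K D ↔ (∀ p, atPrime v p = 0) ∧ (∀ i, atRes v i = 0) ∧ normArg K (atArg v) = 0 := by
  classical
  constructor
  · intro hv
    have h0 : FactorsThrough K (0 : InfinitePlace F → ℝ) := ⟨0, fun σ => by simp [extendOdd]⟩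
    refine ⟨fun p => ?_, fun i => ?_, funext fun τ => ?_⟩
    · have := hv (vec (Pi.single p 1) 0 0 0) ⟨fun w => rfl, h0⟩
      rw [dotProduct_eq] at this
      simpa [Pi.single_apply] using this
    · have := hv (vec 0 (Pi.single i 1) 0 0) ⟨fun w => rfl, h0⟩
      rw [dotProduct_eq] at this
      simpa [Pi.single_apply] using this
    -- The odd test function at τ; pairing with its inflation extracts the norm at τ.
    · let f : (K →+* ℂ) → ℝ := Pi.single τ.embedding 1 - Pi.single (conjugate τ.embedding) 1
      have hodd : ∀ φ, f (conjugate φ) = -f φ := fun φ => by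
        simp only [f, Pi.sub_apply, Pi.single_apply, (involutive_conjugate K).injective.eq_iff,
          (involutive_conjugate K).eq_iff (x := φ) (y := τ.embedding)]
        ring
      have hf : ∀ σ : F →+* ℂ, extendOdd (fun w => f (w.embedding.comp (algebraMap K F))) σ =
          f (σ.comp (algebraMap K F)) :=
        extendOdd_of_odd (g := fun σ : F →+* ℂ => f (σ.comp (algebraMap K F))) fun σ => by
          rw [conjugate_comp, hodd]
      have h1 := hv (vec 0 0 0 fun w => f (w.embedding.comp (algebraMap K F)))
        ⟨fun w => rfl, f, hf⟩
      rw [dotProduct_eq] at h1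
      have h2 := sum_mul_normEmb K (atArg v) _ hf
      simp only [atPrime_vec, atRes_vec, atAbs_vec, atArg_vec, Pi.zero_apply, mul_zero,
        Finset.sum_const_zero, zero_add] at h1
      rw [h1] at h2
      simp only [f, Pi.sub_apply, sub_mul, Finset.sum_sub_distrib, Pi.single_apply, ite_mul,
        one_mul, zero_mul, Finset.sum_ite_eq', Finset.mem_univ, if_true, normEmb_conjugate,
        normEmb_embedding] at h2
      change normArg K (atArg v) τ = 0
      linarith
  · rintro ⟨h1, h2, h3⟩ y ⟨hy, f, hf⟩
    have h4 := sum_mul_normEmb K (atArg v) _ hf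
    simp only [normEmb_eq_zero K h3, mul_zero, Finset.sum_const_zero, mul_eq_zero,
      OfNat.ofNat_ne_zero, false_or] at h4
    rw [dotProduct_eq, h4]
    simp [h1, h2, hy]

end NormArg

end HeckeAlg

end

noncomputable section

namespace HeckeAlg

/-! ### Units with totally positive norm in `K⁺` -/

section GoodUnits

open ComplexEmbedding LogSetup

variable {F : Type*} [Field F] [NumberField F] {K : IntermediateField ℚ F} {D : LogSetup F}

open Classical in
theorem apply_norm_eq_prod (φ : K →+* ℂ) (x : F) :
    φ (Algebra.norm K x) = ∏ σ : F →+* ℂ with σ.comp (algebraMap K F) = φ, σ x := by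
  let := φ.toAlgebra
  rw [show φ (Algebra.norm K x) = algebraMap K ℂ (Algebra.norm K x) from rfl,
    Algebra.norm_eq_prod_embeddings]
  refine Finset.prod_bij' (fun σ _ => (σ : F →+* ℂ))
    (fun σ hσ => { σ with commutes' := fun r => RingHom.congr_fun (Finset.mem_filter.1 hσ).2 r })
    ?_ ?_ ?_ ?_ ?_
  · exact fun σ _ => Finset.mem_filter.2 ⟨Finset.mem_univ _, RingHom.ext σ.commutes⟩
  all_goals intros; first | exact Finset.mem_univ _ | rfl

theorem div_norm_eq_circle_exp [IsTotallyComplex F] {x : F} {θ : InfinitePlace F → ℝ}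
    (hθ : ∀ w : InfinitePlace F, w.embedding x / (‖w.embedding x‖ : ℂ) =
      Circle.exp (2 * Real.pi * θ w)) (σ : F →+* ℂ) :
    σ x / (‖σ x‖ : ℂ) = Circle.exp (2 * Real.pi * extendOdd θ σ) := by
  have h := hθ (InfinitePlace.mk σ)
  rcases InfinitePlace.embedding_mk_eq σ with h1 | h1
  · rw [← extendOdd_embedding θ, h1] at h
    exact h
  · rw [← extendOdd_embedding θ, h1, extendOdd_conjugate, mul_neg, Circle.exp_neg,
      Circle.coe_inv_eq_conj] at h
    have h2 := congrArg (starRingEnd ℂ) h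
    simpa [conjugate_coe_eq] using h2

/-- The arguments of the norm, up to integers. -/
theorem norm_div_norm_eq_circle_exp [IsTotallyComplex F] {x : F} {θ : InfinitePlace F → ℝ}
    (hθ : ∀ w : InfinitePlace F, w.embedding x / (‖w.embedding x‖ : ℂ) =
      Circle.exp (2 * Real.pi * θ w)) (τ : InfinitePlace K) :
    τ.embedding (Algebra.norm K x) / (‖τ.embedding (Algebra.norm K x)‖ : ℂ) =
      Circle.exp (2 * Real.pi * normArg K θ τ) := by
  classical
  have h1 : Circle.exp (2 * Real.pi * normArg K θ τ) =
      ∏ σ : F →+* ℂ with σ.comp (algebraMap K F) = τ.embedding,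
        Circle.exp (2 * Real.pi * extendOdd θ σ) := by
    rw [← circle_exp_two_pi_sum]
    unfold normArg
    congr
  rw [h1, apply_norm_eq_prod, norm_prod, Complex.ofReal_prod, ← Finset.prod_div_distrib]
  refine Eq.trans ?_ (map_prod Circle.coeHom _ _).symm
  exact Finset.prod_congr rfl fun σ _ => div_norm_eq_circle_exp hθ σ

theorem circle_exp_normArg_eq_one [IsTotallyComplex F] {u : (𝓞 F)ˣ} (hu : IsGoodUnit K D u)
    {θ : InfinitePlace F → ℝ}
    (hθ : ∀ w : InfinitePlace F, w.embedding ((u : 𝓞 F) : F) /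
      (‖w.embedding ((u : 𝓞 F) : F)‖ : ℂ) = Circle.exp (2 * Real.pi * θ w)) (τ : InfinitePlace K) :
    Circle.exp (2 * Real.pi * normArg K θ τ) = 1 := by
  apply Circle.coe_injective
  rw [← norm_div_norm_eq_circle_exp hθ, Circle.coe_one]
  set z := τ.embedding (Algebra.norm K ((u : 𝓞 F) : F))
  have h1 : (starRingEnd ℂ) z = z := hu.2.1 τ.embedding
  have h2 : 0 < z.re := hu.2.2 τ.embedding
  have h3 : (z.re : ℂ) = z := Complex.conj_eq_iff_re.1 h1
  rw [← h3, Complex.norm_real, Real.norm_of_nonneg h2.le]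
  exact div_self (by exact_mod_cast h2.ne')

/-- For any choice of arguments θ, positivity of the norm of `u` makes the norm of θ integral;
subtract an integral preimage of it. -/
theorem exists_mem_H_isLog [IsTotallyComplex F] [IsTotallyComplex K] {u : (𝓞 F)ˣ}
    (hu : IsGoodUnit K D u) : ∃ θ : InfinitePlace F → ℝ, normArg K θ = 0 ∧
      D.IsLog (unitIdele u) (vec 0 0
        (fun w => (w.mult : ℝ) / (2 * Real.pi) * Real.log (w ((u : 𝓞 F) : F))) θ) := by
  choose θ hθ using fun w : InfinitePlace F =>
    exists_circle_exp (w.embedding ((u : 𝓞 F) : F)) (by simp)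
  choose b hb using fun τ => (circle_exp_two_pi_eq_one_iff _).1 (circle_exp_normArg_eq_one hu hθ τ)
  obtain ⟨s, hs, hsint⟩ := exists_normArg_section K
  obtain ⟨a, ha⟩ := hsint b
  refine ⟨θ - s (fun τ => b τ), ?_, isLog_unitIdele hu.1 fun w => ?_⟩
  · rw [← normArgₗ_apply, map_sub, normArgₗ_apply, normArgₗ_apply, hs, sub_eq_zero]
    exact funext hb
  · have h1 : Circle.exp (2 * Real.pi * (-a w : ℝ)) = 1 :=
      (circle_exp_two_pi_eq_one_iff _).2 ⟨-a w, by push_cast; rfl⟩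
    rw [hθ, ha, Pi.sub_apply, sub_eq_add_neg, circle_exp_two_pi_add, h1, mul_one]

theorem vec_mem_H [IsTotallyComplex F] [IsTotallyComplex K] {c θ : InfinitePlace F → ℝ}
    (hθ : normArg K θ = 0) : (vec 0 0 c θ : D.G) ∈ H K D :=
  mem_H_iff.2 ⟨fun _ => rfl, fun _ => rfl, hθ⟩

theorem sub_mem_kerNorm [IsTotallyComplex F] [IsTotallyComplex K] {x : Idele F} {v v' : D.G}
    (hv : v ∈ H K D) (hv' : v' ∈ H K D) (h : D.IsLog x v) (h' : D.IsLog x v') :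
    v - v' ∈ kerNorm K D := by
  obtain ⟨t, -, a, hta⟩ := isLog_one_iff.1 (h.sub h')
  have h1 := mem_H_iff.1 (sub_mem hv hv')
  refine ⟨a, fun τ => ?_, ?_⟩
  · have h2 := congrFun h1.2.2 τ
    rwa [hta, atArg_vec] at h2
  · refine vec_ext h1.1 h1.2.1 (fun w => ?_) fun w => ?_ <;> rw [hta] <;> rfl

/-- In a CM field a unit divided by its conjugate is a root of unity, so some power `N` of the norm
is real. The exponent `n` handles the congruence, and the 2 positivity. -/
theorem exists_isGoodUnit_pow [IsCMField K] (D : LogSetup F) (u : (𝓞 F)ˣ) :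
    ∃ n : ℕ, n ≠ 0 ∧ IsGoodUnit K D (u ^ n) := by
  obtain ⟨n, hn, hu⟩ := exists_pow_mk_eq_one D.m_ne_bot u
  let v : (𝓞 K)ˣ := Units.map (RingOfIntegers.norm K) u
  have hv : ((v : 𝓞 K) : K) = Algebra.norm K ((u : 𝓞 F) : F) := rfl
  obtain ⟨N, hN, hvN⟩ := isOfFinOrder_iff_pow_eq_one.1
    (isOfFinOrder_of_finite (IsCMField.unitsMulComplexConjInv K v))
  have h1 : IsCMField.complexConj K ((v : 𝓞 K) : K) ^ N = ((v : 𝓞 K) : K) ^ N := by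
    rw [← map_pow] at hvN
    have h := congrArg Subtype.val hvN
    rw [IsCMField.unitsMulComplexConjInv_apply] at h
    have h' := congrArg (fun z : (𝓞 K)ˣ => ((z : 𝓞 K) : K)) (mul_inv_eq_one.1 h)
    simpa using h'.symm
  have h2 : ∀ φ : K →+* ℂ, (starRingEnd ℂ) (φ (v : 𝓞 K) ^ N) = φ (v : 𝓞 K) ^ N := fun φ => by
    rw [map_pow, ← IsCMField.complexEmbedding_complexConj, ← map_pow, h1, map_pow]
  refine ⟨n * (2 * N), by positivity, ?_, fun φ => ?_, fun φ => ?_⟩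
  · rw [pow_mul]
    push_cast at hu ⊢
    rw [map_pow, hu, one_pow]
  · push_cast
    rw [map_pow, map_pow, ← hv, mul_comm 2 N, mul_left_comm, pow_mul]
    change (starRingEnd ℂ) _ = _
    rw [map_pow, h2]
  · push_cast
    rw [map_pow, map_pow, ← hv, mul_left_comm, mul_comm, mul_comm n, pow_mul, pow_mul]
    obtain ⟨r, hr⟩ := Complex.conj_eq_iff_real.1 (h2 φ)
    rw [hr]
    have : r ≠ 0 := by
      rintro rfl
      simp at hr
    rw [← pow_mul]
    norm_cast
    rw [mul_comm, pow_mul]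
    positivity

end GoodUnits

/-! ### `U` spans `H` -/

section Span

open LogSetup

variable {F : Type*} [Field F] [NumberField F] {K : IntermediateField ℚ F} {D : LogSetup F}

theorem U_le_Λ₀ : U K D ≤ D.Λ₀ := by
  rw [U, AddSubgroup.closure_le]
  rintro v ((rfl | ⟨a, -, rfl⟩) | ⟨-, u, -, hu⟩)
  · exact AddSubgroup.subset_closure (Or.inr rfl)
  · exact AddSubgroup.subset_closure (Or.inl (Or.inr ⟨a, rfl⟩))
  · exact IsLog.mem_Λ₀ hu

variable [IsTotallyComplex F] [IsTotallyComplex K]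

theorem normArg_zero : normArg K (0 : InfinitePlace F → ℝ) = 0 := map_zero (normArgₗ K)

theorem U_le_H : U K D ≤ (H K D).toAddSubgroup := by
  rw [U, AddSubgroup.closure_le]
  rintro v ((rfl | ⟨a, ha, rfl⟩) | ⟨hv, -⟩)
  · exact vec_mem_H normArg_zero
  · exact vec_mem_H (funext ha)
  · exact hv

/-- The projection `q = id - s ∘ Nm` onto the kernel preserves integral vectors, so the images of
the basis vectors are integral and span it. -/
theorem vec_mem_span_kerNorm {d : InfinitePlace F → ℝ} (hd : normArg K d = 0) :
    (vec 0 0 0 d : D.G) ∈ Submodule.span ℝ (kerNorm K D) := by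
  classical
  let ι : (InfinitePlace F → ℝ) →ₗ[ℝ] D.G :=
    { toFun := fun d => vec 0 0 0 d
      map_add' := fun _ _ => vec_ext (by simp) (by simp) (by simp) (by simp)
      map_smul' := fun c d => vec_ext (fun p => (mul_zero c).symm) (fun p => (mul_zero c).symm)
        (fun p => (mul_zero c).symm) (fun p => rfl) }
  obtain ⟨s, hs, hsint⟩ := exists_normArg_section K
  let q : (InfinitePlace F → ℝ) →ₗ[ℝ] (InfinitePlace F → ℝ) := LinearMap.id - s ∘ₗ normArgₗ K
  have hq : q d = d := by simp [q, hd]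
  have hqk : ∀ x, normArg K (q x) = 0 := fun x => by
    rw [← normArgₗ_apply]
    change normArgₗ K (x - s (normArgₗ K x)) = 0
    rw [map_sub, normArgₗ_apply K (s _), hs, sub_self]
  have hd' : d = ∑ w, d w • q (Pi.single w 1) := by
    calc d = q d := hq.symm
      _ = q (∑ w, d w • Pi.single w 1) := by
        congr 1
        funext w
        simp [Finset.sum_apply, Pi.single_apply]
      _ = _ := by simp only [map_sum, map_smul]
  change ι d ∈ _
  rw [hd', map_sum]
  refine Submodule.sum_mem _ fun w _ => ?_
  rw [map_smul]
  refine Submodule.smul_mem _ _ (Submodule.subset_span ?_)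
  obtain ⟨b, hb⟩ := exists_normArg_eq_int K (Pi.single w 1)
  obtain ⟨a, ha⟩ := hsint b
  have hsingle : (Pi.single w 1 : InfinitePlace F → ℝ) =
      fun w' => ((Pi.single w 1 : InfinitePlace F → ℤ) w' : ℝ) := by
    funext w'
    simp [Pi.single_apply]
  have hqa : q (Pi.single w 1) = fun w' => ((Pi.single w 1 - a : InfinitePlace F → ℤ) w' : ℝ) := by
    funext w'
    simp only [q, LinearMap.sub_apply, LinearMap.id_apply, LinearMap.comp_apply, normArgₗ_apply]
    rw [hsingle, hb, ha]
    simp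
  refine ⟨Pi.single w 1 - a, fun τ => ?_, ?_⟩
  · rw [← hqa, hqk]
    rfl
  · rw [← hqa]
    rfl

theorem span_U [IsCMField K] : Submodule.span ℝ (U K D : Set D.G) = H K D := by
  refine le_antisymm (Submodule.span_le.2 U_le_H) fun v hv => ?_
  set T := Submodule.span ℝ (U K D : Set D.G)
  have hU : ∀ v ∈ ({D.v0} ∪ kerNorm K D ∪ unitLogs K D : Set D.G), v ∈ T := fun v hv =>
    Submodule.subset_span (AddSubgroup.subset_closure hv)
  have hker : ∀ d : InfinitePlace F → ℝ, normArg K d = 0 → (vec 0 0 0 d : D.G) ∈ T := fun d hd =>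
    Submodule.span_mono (fun v hv => AddSubgroup.subset_closure (Or.inl (Or.inr hv)))
      (vec_mem_span_kerNorm hd)
  let ι : (InfinitePlace F → ℝ) →ₗ[ℝ] D.G :=
    { toFun := fun c => vec 0 0 c 0
      map_add' := fun _ _ => vec_ext (by simp) (by simp) (by simp) (by simp)
      map_smul' := fun c d => vec_ext (fun p => (mul_zero c).symm) (fun p => (mul_zero c).symm)
        (fun p => rfl) (fun p => (mul_zero c).symm) }
  have hlog : ∀ c : InfinitePlace F → ℝ, ∑ w, c w = 0 → ι c ∈ T := by
    intro c hc
    suffices hle : _ ≤ T.comap ι from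
      hle (span_log_units _ (exists_isGoodUnit_pow (K := K) D) c hc)
    rw [Submodule.span_le]
    rintro _ ⟨u, hu, rfl⟩
    obtain ⟨θ, hθ, hl⟩ := exists_mem_H_isLog hu
    have h1 := hU _ (Or.inr ⟨vec_mem_H hθ, u, hu, hl⟩)
    -- Removing the arguments and scaling by 2π leaves Dirichlet's vector `n_w log|u|_w`.
    have h2 := T.smul_mem (2 * Real.pi) (T.sub_mem h1 (hker θ hθ))
    change ι _ ∈ T
    convert h2 using 1
    refine vec_ext (D := D) (fun p => ?_) (fun i => ?_) (fun w => ?_) fun w => ?_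
    · change (0 : ℝ) = 2 * Real.pi * (0 - 0); ring
    · change (0 : ℝ) = 2 * Real.pi * (0 - 0); ring
    · change (w.mult : ℝ) * Real.log _ = 2 * Real.pi * ((w.mult : ℝ) / _ * Real.log _ - 0)
      field_simp
      ring
    · change (0 : ℝ) = 2 * Real.pi * (θ w - θ w); ring
  obtain ⟨h1, h2, h3⟩ := mem_H_iff.1 hv
  -- The multiple of `v₀` whose removal gives modulus coordinates of sum zero.
  set t : ℝ := (∑ w, atAbs v w) / ∑ w : InfinitePlace F, (w.mult : ℝ)
  have hpos : 0 < ∑ w : InfinitePlace F, (w.mult : ℝ) :=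
    Finset.sum_pos (fun w _ => by exact_mod_cast w.mult_pos) Finset.univ_nonempty
  have h4 : v = t • D.v0 + ι (fun w => atAbs v w - t * w.mult) + vec 0 0 0 (atArg v) := by
    refine vec_ext (fun p => ?_) (fun i => ?_) (fun w => ?_) fun w => ?_
    · change _ = t * 0 + 0 + 0; rw [h1]; ring
    · change _ = t * 0 + 0 + 0; rw [h2]; ring
    · change _ = t * (w.mult : ℝ) + (atAbs v w - t * w.mult) + 0; ring
    · change _ = t * 0 + 0 + atArg v w; ring
  rw [h4]
  refine T.add_mem (T.add_mem (T.smul_mem _ (hU _ (Or.inl (Or.inl rfl)))) (hlog _ ?_)) (hker _ h3)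
  rw [Finset.sum_sub_distrib, ← Finset.mul_sum, div_mul_cancel₀ _ hpos.ne', sub_self]

end Span

end HeckeAlg

end

noncomputable section

namespace HeckeAlg

/-! ### Discreteness and rank -/

section FullRank

theorem hasFullRank_of_discreteTopology {V : Type*} [NormedAddCommGroup V] [NormedSpace ℝ V]
    [FiniteDimensional ℝ V] {A : AddSubgroup V} (hA : DiscreteTopology A) {W : Submodule ℝ V}
    (h : Submodule.span ℝ (A : Set V) = W) : HasFullRank A W := by
  refine ⟨fun x hx => ?_, h, ?_⟩
  · rw [← h]
    exact Submodule.subset_span hx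
  · have h1 : Submodule.span ℤ (A : Set V) = AddSubgroup.toIntSubmodule A :=
      Submodule.span_eq (AddSubgroup.toIntSubmodule A)
    have h2 : DiscreteTopology (Submodule.span ℤ (A : Set V)) := by rw [h1]; exact hA
    have h3 := Real.finrank_eq_int_finrank_of_discrete h2
    rw [Set.finrank, Set.finrank, h, h1] at h3
    exact h3.symm

open LogSetup

variable {F : Type*} [Field F] [NumberField F] {K : IntermediateField ℚ F} {D : LogSetup F}

theorem LogSetup.IsLog.exists_unitIdele {α : Fˣ} {v : D.G} (h : D.IsLog (principal α) v)
    (h0 : ∀ p, atPrime v p = 0) : ∃ u : (𝓞 F)ˣ, principal α = unitIdele u := by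
  obtain ⟨e, b, t, he, he0, -, -, h1, -⟩ := h
  have he' : ∀ p, e p = 0 := fun p => by
    by_cases hp : p ∈ D.S
    · exact_mod_cast (h1 ⟨p, hp⟩).symm.trans (h0 ⟨p, hp⟩)
    · exact he0 p hp
  have hval : ∀ p : HeightOneSpectrum (𝓞 F), p.valuation F (α : F) = 1 := fun p => by
    rw [← valued_finComp_principal, he, he', neg_zero, WithZero.exp_zero]
  obtain ⟨x, hx⟩ := HeightOneSpectrum.mem_integers_of_valuation_le_one F (α : F)
    fun p => (hval p).le
  obtain ⟨y, hy⟩ := HeightOneSpectrum.mem_integers_of_valuation_le_one F ((α⁻¹ : Fˣ) : F)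
    fun p => by rw [Units.val_inv_eq_inv_val, map_inv₀, hval p, inv_one]
  have hxy : x * y = 1 := by
    apply RingOfIntegers.coe_injective
    rw [map_mul, hx, hy, map_one, Units.mul_inv]
  exact ⟨⟨x, y, hxy, by rw [mul_comm, hxy]⟩, congrArg principal (Units.ext hx.symm)⟩

/-- A nonzero algebraic integer cannot have all its absolute values below 1. -/
theorem eq_one_of_norm_sub_lt_one {u : (𝓞 F)ˣ}
    (h : ∀ w : InfinitePlace F, ‖w.embedding ((u : 𝓞 F) : F) - 1‖ < 1) : u = 1 := by
  by_contra hu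
  have h1 : (u : 𝓞 F) - 1 ≠ 0 := fun h => hu (Units.ext (sub_eq_zero.1 h))
  have h2 : ∀ w : InfinitePlace F, w (((u : 𝓞 F) - 1 : 𝓞 F) : F) < 1 := fun w => by
    have h3 : (((u : 𝓞 F) - 1 : 𝓞 F) : F) = ((u : 𝓞 F) : F) - 1 := by simp
    rw [← InfinitePlace.norm_embedding_eq, h3, map_sub, map_one]
    exact h w
  obtain ⟨w⟩ : Nonempty (InfinitePlace F) := inferInstance
  exact (InfinitePlace.one_le_of_lt_one h1 fun z _ => h2 z).not_gt (h2 w)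

theorem LogSetup.IsLog.infComp_eq {x : Idele F} {v : D.G} (h : D.IsLog x v) (w : InfinitePlace F) :
    infComp x w = Complex.exp (2 * Real.pi / w.mult * atAbs v w) *
      Circle.exp (2 * Real.pi * atArg v w) := by
  obtain ⟨e, b, t, -, -, -, -, -, -, h3, h4⟩ := h
  have hn : (‖infComp x w‖ : ℂ) ≠ 0 := by simpa using infComp_ne_zero x w
  rw [← h4, h3, ← mul_div_assoc, eq_div_iff hn, mul_comm (infComp x w)]
  congr 1
  have hm : (w.mult : ℂ) ≠ 0 := by exact_mod_cast w.mult_pos.ne'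
  have hpi : (Real.pi : ℂ) ≠ 0 := by exact_mod_cast Real.pi_ne_zero
  rw [← Real.exp_log (norm_pos_iff.2 (infComp_ne_zero x w)), Complex.ofReal_exp]
  congr 1
  rw [Real.log_exp]
  push_cast
  field_simp

theorem sum_atAbs_eq_zero {u : (𝓞 F)ˣ} {v : D.G} (h : D.IsLog (unitIdele u) v) :
    ∑ w, atAbs v w = 0 := by
  obtain ⟨e, b, t, -, -, -, -, -, -, h3, -⟩ := h
  have h1 := congrArg (fun r => 1 / (2 * Real.pi) * r) (Units.sum_mult_mul_log u)
  simp only [mul_zero, Finset.mul_sum] at h1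
  rw [← h1]
  refine Finset.sum_congr rfl fun w _ => ?_
  rw [h3, infComp_unitIdele, InfinitePlace.norm_embedding_eq]
  ring

/-- Vanishing prime coordinates make `v` the logarithm of a unit plus `j • v₀`. The product formula
and smallness of the sum force `j = 0`; then the unit is close to 1 everywhere, hence 1, and what
remains is an integral argument vector with entries below 1. -/
theorem eq_zero_of_mem_of_small [IsTotallyComplex F] [IsTotallyComplex K] {v : D.G}
    (hv : v ∈ D.Λ₀ ⊓ (H K D).toAddSubgroup) (h1 : |∑ w, atAbs v w| < 1)
    (h2 : ∀ w, |atArg v w| < 1)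
    (h3 : ∀ w : InfinitePlace F, ‖Complex.exp (2 * Real.pi / w.mult * atAbs v w) *
      Circle.exp (2 * Real.pi * atArg v w) - 1‖ < 1) : v = 0 := by
  obtain ⟨α, j, hα⟩ := mem_Λ₀_iff.1 hv.1
  obtain ⟨hp, hr, hN⟩ := mem_H_iff.1 hv.2
  obtain ⟨u, hu⟩ := hα.exists_unitIdele fun p => by
    change atPrime v p - j • (0 : ℝ) = 0
    rw [hp, smul_zero, sub_zero]
  rw [hu] at hα
  have hj : j = 0 := by
    have h4 := sum_atAbs_eq_zero hα
    have h5 : ∀ w, atAbs (v - j • D.v0) w = atAbs v w - j • (w.mult : ℝ) := fun w => rfl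
    simp only [h5, Finset.sum_sub_distrib, ← Finset.smul_sum, sub_eq_zero] at h4
    rw [h4, zsmul_eq_mul, ← Nat.cast_sum, abs_mul, Nat.abs_cast, ← Int.cast_abs] at h1
    by_contra hj
    have h6 : 1 ≤ |j| := Int.one_le_abs hj
    obtain ⟨w⟩ : Nonempty (InfinitePlace F) := inferInstance
    have h7 : 1 ≤ ∑ w : InfinitePlace F, w.mult :=
      (Nat.one_le_iff_ne_zero.2 w.mult_pos.ne').trans
        (Finset.single_le_sum (f := fun w : InfinitePlace F => w.mult) (fun _ _ => Nat.zero_le _)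
          (Finset.mem_univ w))
    have h8 : (1 : ℝ) ≤ (|j| : ℤ) := by exact_mod_cast h6
    have h9 : (1 : ℝ) ≤ (∑ w : InfinitePlace F, w.mult : ℕ) := by exact_mod_cast h7
    nlinarith
  rw [hj, zero_smul, sub_zero] at hα
  have hu1 : u = 1 := eq_one_of_norm_sub_lt_one fun w => by
    rw [← infComp_unitIdele, hα.infComp_eq]
    exact h3 w
  have h4 : unitIdele (1 : (𝓞 F)ˣ) = 1 := by
    rw [unitIdele, map_one, map_one]
  rw [hu1, h4] at hα
  obtain ⟨t, -, a, hta⟩ := isLog_one_iff.1 hα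
  refine vec_ext hp hr (fun w => by rw [hta]; rfl) fun w => ?_
  have h5 := h2 w
  have h6 : atArg v w = a w := by rw [hta]; rfl
  rw [h6, ← Int.cast_abs] at h5
  have h7 : |a w| < 1 := by exact_mod_cast h5
  rw [h6, Int.abs_lt_one_iff.1 h7]
  simp

theorem continuous_atAbs (w) : Continuous fun v : D.G => atAbs v w := continuous_apply _

theorem continuous_atArg (w) : Continuous fun v : D.G => atArg v w := continuous_apply _

theorem discreteTopology_Λ₀_inf_H [IsTotallyComplex F] [IsTotallyComplex K] :
    DiscreteTopology (D.Λ₀ ⊓ (H K D).toAddSubgroup : AddSubgroup D.G) := by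
  have hev : ∀ᶠ v : D.G in nhds 0, |∑ w, atAbs v w| < 1 ∧ (∀ w, |atArg v w| < 1) ∧
      ∀ w : InfinitePlace F, ‖Complex.exp (2 * Real.pi / w.mult * atAbs v w) *
        Circle.exp (2 * Real.pi * atArg v w) - 1‖ < 1 := by
    refine .and ?_ (.and (Filter.eventually_all.2 fun w => ?_) (Filter.eventually_all.2 fun w => ?_))
    · have : Continuous fun v : D.G => |∑ w, atAbs v w| :=
        (continuous_finsetSum _ fun w _ => continuous_atAbs w).abs
      exact this.tendsto' 0 0 (by simp) |>.eventually_lt_const one_pos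
    · exact (continuous_atArg w).abs.tendsto' 0 0 (by simp) |>.eventually_lt_const one_pos
    · have h1 := continuous_atAbs (D := D) w
      have h2 := continuous_atArg (D := D) w
      have : Continuous fun v : D.G => ‖Complex.exp (2 * Real.pi / w.mult * atAbs v w) *
        Circle.exp (2 * Real.pi * atArg v w) - 1‖ := by fun_prop
      exact this.tendsto' 0 0 (by simp) |>.eventually_lt_const one_pos
  refine discreteTopology_of_isOpen_singleton_zero ?_
  rw [isOpen_iff_mem_nhds]
  rintro _ rfl
  filter_upwards [(continuous_subtype_val.tendsto' _ _ rfl).eventually hev] with v hv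
  exact Subtype.ext (eq_zero_of_mem_of_small v.2 hv.1 hv.2.1 hv.2.2)

theorem hasFullRank_U [IsTotallyComplex F] [IsCMField K] : HasFullRank (U K D) (H K D) := by
  have hle : U K D ≤ D.Λ₀ ⊓ (H K D).toAddSubgroup := le_inf U_le_Λ₀ U_le_H
  have := discreteTopology_Λ₀_inf_H (K := K) (D := D)
  exact hasFullRank_of_discreteTopology (DiscreteTopology.of_subset this hle) span_U

theorem hasFullRank_Λ₀_inf_H [IsTotallyComplex F] [IsCMField K] :
    HasFullRank (D.Λ₀ ⊓ (H K D).toAddSubgroup) (H K D) := by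
  refine hasFullRank_of_discreteTopology discreteTopology_Λ₀_inf_H (le_antisymm ?_ ?_)
  · exact Submodule.span_le.2 fun v hv => hv.2
  · refine span_U.symm.le.trans (Submodule.span_mono ?_)
    exact (le_inf U_le_Λ₀ U_le_H : U K D ≤ D.Λ₀ ⊓ (H K D).toAddSubgroup)

end FullRank

end HeckeAlg

end
theorem mainTheorem4 {F : Type*} [Field F] [NumberField F] (K : IntermediateField ℚ F)
    (hK : Maximal (fun L : IntermediateField ℚ F => NumberField.IsCMField L) K)
    (D : HeckeAlg.LogSetup F) :
    -- a character of modulus `m` is almost-algebraic iff its dual logarithm is in `Λ₀^⊥ ∩ H^⊥`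
    (∀ χ ∈ HeckeAlg.heckeCharsMod D.m, ∀ v : D.G, D.IsDualLog χ v →
      (χ ∈ HeckeAlg.almostAlgebraic D.m ↔
        v ∈ D.dualΛ₀ ⊓ (HeckeAlg.Hperp K D).toAddSubgroup)) ∧
    -- the dual logarithm is an isomorphism from the group of almost-algebraic characters of
    -- modulus `m` onto `(Λ₀^⊥ ∩ H^⊥) / ℤ^ℓ`
    D.intℓ ≤ D.dualΛ₀ ⊓ (HeckeAlg.Hperp K D).toAddSubgroup ∧
    (∃ e : Additive (HeckeAlg.almostAlgebraic D.m) ≃+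
        (D.dualΛ₀ ⊓ (HeckeAlg.Hperp K D).toAddSubgroup : AddSubgroup D.G) ⧸
          D.intℓ.addSubgroupOf (D.dualΛ₀ ⊓ (HeckeAlg.Hperp K D).toAddSubgroup),
      ∀ (χ : HeckeAlg.almostAlgebraic D.m)
        (v : (D.dualΛ₀ ⊓ (HeckeAlg.Hperp K D).toAddSubgroup : AddSubgroup D.G)),
        e (Additive.ofMul χ) = QuotientAddGroup.mk v ↔ D.IsDualLog χ v) ∧
    -- `Λ₀ ∩ H` has full rank in `H`
    HeckeAlg.HasFullRank (D.Λ₀ ⊓ (HeckeAlg.H K D).toAddSubgroup) (HeckeAlg.H K D) ∧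
    -- every class `𝓛_S(u)` used to define `U` has a representative in `H`, which is
    -- unique modulo the kernel of the norm
    (∀ u : (NumberField.RingOfIntegers F)ˣ, HeckeAlg.IsGoodUnit K D u →
      (∃ v ∈ HeckeAlg.H K D, D.IsLog (HeckeAlg.unitIdele u) v) ∧
      ∀ v ∈ HeckeAlg.H K D, ∀ v' ∈ HeckeAlg.H K D, D.IsLog (HeckeAlg.unitIdele u) v →
        D.IsLog (HeckeAlg.unitIdele u) v' → v - v' ∈ HeckeAlg.kerNorm K D) ∧
    -- `U` is contained in `Λ₀` and in `H`, and has full rank in `H`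
    HeckeAlg.U K D ≤ D.Λ₀ ∧
    HeckeAlg.HasFullRank (HeckeAlg.U K D) (HeckeAlg.H K D) := by
  have : IsCMField K := hK.prop
  have : IsTotallyComplex F := isTotallyComplex_of_algebra K F
  -- Only here does the maximality of `K` enter.
  have hweil : ∀ v ∈ D.dualΛ₀, (∀ w, HeckeAlg.LogSetup.atAbs v w = 0) →
      v ∈ (HeckeAlg.Hperp K D).toAddSubgroup := fun v hv h0 =>
    ⟨h0, HeckeAlg.factorsThrough_of_mem_dualΛ₀ hK hv h0⟩
  have hmem : ∀ χ ∈ HeckeAlg.almostAlgebraic D.m, ∀ v : D.G, D.IsDualLog χ v →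
      v ∈ D.dualΛ₀ ⊓ (HeckeAlg.Hperp K D).toAddSubgroup := fun χ hχ v hv => by
    have h0 := HeckeAlg.atAbs_eq_zero_of_mem hχ hv
    have hd := hv.mem_dualΛ₀ hχ.1 h0
    exact ⟨hd, hweil v hd h0⟩
  refine ⟨fun χ hχ v hv => ⟨fun h => hmem χ h v hv, fun h => ⟨hχ, fun w => ?_⟩⟩,
    fun v hv => hmem 1 (one_mem _) v (HeckeAlg.isDualLog_one_of_mem hv),
    HeckeAlg.exists_addEquiv _ (fun v hv => hv.1) hweil, HeckeAlg.hasFullRank_Λ₀_inf_H,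
    fun u hu => ⟨?_, fun v hv v' hv' h h' => HeckeAlg.sub_mem_kerNorm hv hv' h h'⟩,
    HeckeAlg.U_le_Λ₀, HeckeAlg.hasFullRank_U⟩
  · obtain ⟨k, -, hk⟩ := hv.2.2 w
    rw [h.2.1 w] at hk
    exact ⟨k, hk⟩
  · obtain ⟨θ, hθ, h⟩ := HeckeAlg.exists_mem_H_isLog hu
    exact ⟨_, HeckeAlg.vec_mem_H hθ, h⟩
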